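/- Conventions. All posets are finite. Let $P$ be a graded poset of rank $n+1$ with a least and a greatest element. For $S\subseteq[n]=\{1,\dots,n\}$ let $\alpha_P(S)$ be the number of chains in $P$ whose set of ranks is $S$, let $\beta_P(S)=\sum_{T\subseteq S}(-1)^{|S\setminus T|}\alpha_P(T)$, and let $u_S=u_1\cdots u_n$ be the word with $u_i=b$ if $i\in S$ and $u_i=a$ otherwise. The ab-index of $P$ is $\Psi_P=\sum_{S\subseteq[n]}\beta_P(S)\,u_S$, a polynomial in the noncommuting variables $a,b$. A cd-index of $P$ is a polynomial $\Phi$ in noncommuting variables $c,d$ with $\Phi(a+b,\,ab+ba)=\Psi_P$. Give $c$ degree $1$ and $d$ degree $2$; a monic cd-polynomial of degree $n$ is a cd-polynomial all of whose monomials have degree $n$ and in which the coefficient of $c^n$ is $1$. On a Coxeter group with length function $\ell$, the Bruhat order is given by the subword property: $v\le w$ if and only if every (equivalently, some) reduced word for $w$ contains a reduced word for $v$ as a subword. It is ranked by $\ell$, so $[u,w]$ has rank $\ell(w)-\ell(u)$. Theorem. Let $R$ be any commutative ring of coefficients (for example $\mathbb Z$ or $\mathbb R$). (1) Let $u\le w$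 in any Coxeter group with $\ell(w)=\ell(u)+n+1$, $n\ge 0$. Then $[u,w]$ has exactly one cd-index over $R$, and it is a monic cd-polynomial of degree $n$. (2) For every $n\ge 0$, the affine span over $R$ of the set of cd-indices of all Bruhat intervals of rank $n+1$ in Coxeter groups is the whole affine space of monic cd-polynomials of degree $n$ with coefficients in $R$. (3) Let $(W,\{s_1,s_2,\dots\})$ be the Coxeter system whose Coxeter graph is complete with every edge labelled $3$. Define sets of words by $\mathcal F_1=\{s_1\}$, $\mathcal F_2=\{s_1s_2\}$ and $\mathcal F_n=\mathcal F_{n-1}s_n\cup s_n\mathcal F_{n-2}s_n$ for $n\ge 3$. For every $n\ge1$, the set $\mathcal F_n$ consists of exactly $F_n$ words (the $n$-th Fibonacci number, $F_1=F_2=1$), each of them reduced and of length $n$; the cd-indices of the lower Bruhat intervals $[1,w]$, for $w\in\mathcal F_n$, are linearly independent over $R$; and their affine span over $R$ is the affine space of monic cd-polynomials of degree $n-1$ with coefficients in $R$. -/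

import Mathlib

/-! ### Noncommutative polynomials in `a, b` and in `c, d` -/

/-- The noncommuting letters `a`, `b`. -/
inductive ABLetter
  | a
  | b

/-- The noncommuting letters `c`, `d`. -/
inductive CDLetter
  | c
  | d

/-- `R⟨a, b⟩`, the free algebra on `a, b`: formal linear combinations of words. -/
abbrev ABPoly (R : Type*) [CommRing R] := MonoidAlgebra R (FreeMonoid ABLetter)

/-- `R⟨c, d⟩`, the free algebra on `c, d`: formal linear combinations of words. -/
abbrev CDPoly (R : Type*) [CommRing R] := MonoidAlgebra R (FreeMonoid CDLetter)

/-- The variable `a` or `b` of `R⟨a, b⟩`. -/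
noncomputable def ABPoly.var (R : Type*) [CommRing R] (x : ABLetter) : ABPoly R :=
  MonoidAlgebra.of R (FreeMonoid ABLetter) (FreeMonoid.of x)

/-- The values `c = a + b` and `d = ab + ba`. -/
noncomputable def CDLetter.toAB (R : Type*) [CommRing R] : CDLetter → ABPoly R
  | .c => ABPoly.var R .a + ABPoly.var R .b
  | .d => ABPoly.var R .a * ABPoly.var R .b + ABPoly.var R .b * ABPoly.var R .a

/-- The substitution `c ↦ a + b`, `d ↦ ab + ba`, an algebra map `R⟨c, d⟩ → R⟨a, b⟩`. -/
noncomputable def CDPoly.toAB (R : Type*) [CommRing R] : CDPoly R →ₐ[R] ABPoly R :=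
  MonoidAlgebra.lift R (ABPoly R) (FreeMonoid CDLetter) (FreeMonoid.lift (CDLetter.toAB R))

/-- `deg c = 1` and `deg d = 2`. -/
def CDLetter.deg : CDLetter → ℕ
  | .c => 1
  | .d => 2

/-- The degree of a cd-monomial. -/
def CDLetter.wordDeg (m : FreeMonoid CDLetter) : ℕ :=
  (m.toList.map CDLetter.deg).sum

/-- The monic cd-polynomials of degree `n`: all monomials have degree `n`, and the coefficient of
`c ^ n` is `1`. -/
def CDPoly.monic (R : Type*) [CommRing R] (n : ℕ) : Set (CDPoly R) :=
  {p | (∀ m ∈ p.coeff.support, CDLetter.wordDeg m = n) ∧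
    p.coeff (FreeMonoid.of CDLetter.c ^ n) = 1}

/-! ### Flag vectors, the ab-index and the cd-index of a finite graded poset -/

/-- The rank of an element: the largest length of a chain descending from it. In a finite graded
poset this is the rank function that is `0` on minimal elements. -/
noncomputable def posetRank {P : Type*} [PartialOrder P] (x : P) : ℕ :=
  (Order.height x).toNat

/-- The flag f-vector: `flagF P S` is the number of chains in `P` whose set of ranks is `S`. -/
noncomputable def flagF (P : Type*) [PartialOrder P] [Finite P] (S : Finset ℕ) : ℕ :=
  Set.ncard {C : Set P | IsChain (· ≤ ·) C ∧ posetRank '' C = (S : Set ℕ)}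

/-- The flag h-vector: `flagH P S = ∑_{T ⊆ S} (-1)^{|S - T|} flagF P T`. -/
noncomputable def flagH (P : Type*) [PartialOrder P] [Finite P] (S : Finset ℕ) : ℤ :=
  ∑ T ∈ S.powerset, (-1) ^ (S \ T).card * (flagF P T : ℤ)

/-- The ab-monomial `u₁ u₂ ⋯ uₙ` of `S ⊆ {1, …, n}`: `uᵢ = b` if `i ∈ S` and `uᵢ = a` otherwise. -/
def abMonomial (n : ℕ) (S : Finset ℕ) : FreeMonoid ABLetter :=
  FreeMonoid.ofList
    ((List.range' 1 n).map fun i => if i ∈ S then ABLetter.b else ABLetter.a)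

/-- The ab-index `∑_{S ⊆ {1, …, n}} flagH P S • u_S` of a poset `P`, graded of rank `n + 1` with a
least and a greatest element. -/
noncomputable def abIndex (R : Type*) [CommRing R] (P : Type*) [PartialOrder P] [Finite P]
    (n : ℕ) : ABPoly R :=
  ∑ S ∈ (Finset.Icc 1 n).powerset, MonoidAlgebra.single (abMonomial n S) ((flagH P S : ℤ) : R)

/-- `Φ` is a cd-index of `P` (graded of rank `n + 1`): substituting `c = a + b` and `d = ab + ba`
in `Φ` gives the ab-index of `P`. -/
def IsCDIndex {R : Type*} [CommRing R] (P : Type*) [PartialOrder P] [Finite P] (n : ℕ)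
    (Φ : CDPoly R) : Prop :=
  CDPoly.toAB R Φ = abIndex R P n

open Classical in
/-- The cd-index of `P` (graded of rank `n + 1`); `0` if `P` has none. -/
noncomputable def cdIndex (R : Type*) [CommRing R] (P : Type*) [PartialOrder P] [Finite P]
    (n : ℕ) : CDPoly R :=
  if h : ∃ Φ : CDPoly R, IsCDIndex P n Φ then h.choose else 0

/-! ### Bruhat order -/

namespace CoxeterSystem

/-- Bruhat order, by the subword property: `v ≤ w` if every reduced word for `w` has a subword that
is a reduced word for `v`. -/
def BruhatLE {B W : Type*} [Group W] {M : CoxeterMatrix B} (cs : CoxeterSystem M W)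
    (v w : W) : Prop :=
  ∀ ω : List B, cs.IsReduced ω → cs.wordProd ω = w →
    ∃ ω' : List B, ω'.Sublist ω ∧ cs.IsReduced ω' ∧ cs.wordProd ω' = v

theorem BruhatLE.refl {B W : Type*} [Group W] {M : CoxeterMatrix B} (cs : CoxeterSystem M W)
    (w : W) : cs.BruhatLE w w :=
  fun ω h1 h2 => ⟨ω, List.Sublist.refl ω, h1, h2⟩

theorem BruhatLE.trans {B W : Type*} [Group W] {M : CoxeterMatrix B} {cs : CoxeterSystem M W}
    {x v w : W} (h : cs.BruhatLE x v) (h' : cs.BruhatLE v w) : cs.BruhatLE x w := by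
  intro ω h1 h2
  obtain ⟨ω₁, s1, r1, p1⟩ := h' ω h1 h2
  obtain ⟨ω₂, s2, r2, p2⟩ := h ω₁ r1 p1
  exact ⟨ω₂, s2.trans s1, r2, p2⟩

theorem BruhatLE.length_le {B W : Type*} [Group W] {M : CoxeterMatrix B}
    {cs : CoxeterSystem M W} {v w : W} (h : cs.BruhatLE v w) : cs.length v ≤ cs.length w := by
  obtain ⟨ω, hω, rfl⟩ := cs.exists_isReduced w
  obtain ⟨ω', s, r, rfl⟩ := h ω hω rfl
  rw [hω.eq, r.eq]
  exact s.length_le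

theorem BruhatLE.antisymm {B W : Type*} [Group W] {M : CoxeterMatrix B}
    {cs : CoxeterSystem M W} {v w : W} (h : cs.BruhatLE v w) (h' : cs.BruhatLE w v) : v = w := by
  have hl := h'.length_le
  obtain ⟨ω, hω, rfl⟩ := cs.exists_isReduced w
  obtain ⟨ω', s, r, rfl⟩ := h ω hω rfl
  rw [hω.eq, r.eq] at hl
  rw [s.eq_of_length_le hl]

/-- The Bruhat interval `[u, w]`, with the order induced by Bruhat order. -/
def BruhatInterval {B W : Type*} [Group W] {M : CoxeterMatrix B} (cs : CoxeterSystem M W)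
    (u w : W) : Type _ :=
  {x : W // cs.BruhatLE u x ∧ cs.BruhatLE x w}

instance {B W : Type*} [Group W] {M : CoxeterMatrix B} (cs : CoxeterSystem M W) (u w : W) :
    PartialOrder (cs.BruhatInterval u w) where
  le x y := cs.BruhatLE x.1 y.1
  le_refl x := BruhatLE.refl cs x.1
  le_trans _ _ _ h h' := h.trans h'
  le_antisymm _ _ h h' := Subtype.ext (h.antisymm h')

instance {B W : Type*} [Group W] {M : CoxeterMatrix B} (cs : CoxeterSystem M W) (u w : W) :
    Finite (cs.BruhatInterval u w) := by
  obtain ⟨ω, hω, hw⟩ := cs.exists_isReduced w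
  have hf : Set.Finite {x : W | ∃ l ∈ ω.sublists, cs.wordProd l = x} :=
    (List.finite_toSet ω.sublists).image cs.wordProd
  have hs : {x : W | cs.BruhatLE u x ∧ cs.BruhatLE x w} ⊆
      {x : W | ∃ l ∈ ω.sublists, cs.wordProd l = x} := by
    rintro x ⟨-, hx⟩
    obtain ⟨ω', s, -, p⟩ := hx ω hω hw.symm
    exact ⟨ω', List.mem_sublists.2 s, p⟩
  exact (hf.subset hs).to_subtype

end CoxeterSystem

/-- The cd-indices of all Bruhat intervals `[u, w]` of rank `n + 1`, in all Coxeter groups. Bruhat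
order is ranked by length, so the rank of `[u, w]` is `ℓ(w) - ℓ(u)`. -/
def bruhatCDIndices (R : Type*) [CommRing R] (n : ℕ) : Set (CDPoly R) :=
  {Φ | ∃ (B W : Type) (_ : Group W) (M : CoxeterMatrix B) (cs : CoxeterSystem M W) (u w : W),
    cs.BruhatLE u w ∧ cs.length w = cs.length u + (n + 1) ∧
      Φ = cdIndex R (cs.BruhatInterval u w) n}

/-! ### The explicit family -/

/-- The Coxeter matrix on generators `s₁, s₂, …` whose Coxeter graph is complete with all edges
labelled `3`. The generator `sᵢ` has index `i - 1`. -/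
def completeThree : CoxeterMatrix ℕ where
  M := Matrix.of fun i j => if i = j then 1 else 3
  isSymm := by
    ext i j
    simp [eq_comm]
  diagonal i := by simp
  off_diagonal i j h := by simp [h]

/-- The Coxeter system `(W, {s₁, s₂, …})` of `completeThree`. -/
def completeThreeSystem : CoxeterSystem completeThree completeThree.Group :=
  completeThree.toCoxeterSystem

/-- The sets of words `F₁ = {s₁}`, `F₂ = {s₁ s₂}` and `Fₙ = Fₙ₋₁ sₙ ∪ sₙ Fₙ₋₂ sₙ` for `n ≥ 3`
(the letter `sᵢ` is written `i - 1`). -/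
def fibWords : ℕ → Finset (List ℕ)
  | 0 => ∅
  | 1 => {[0]}
  | 2 => {[0, 1]}
  | n + 3 => (fibWords (n + 2)).image (fun ω => ω ++ [n + 2]) ∪
      (fibWords (n + 1)).image (fun ω => (n + 2) :: (ω ++ [n + 2]))

/-! Existence of the cd-index. If `s` is a right descent of `w` and `vs > v`, right multiplication
by `s` is a parity-changing involution of `[v, w]`; the remaining intervals are compared with such
ones, so Bruhat intervals are Eulerian (`sum_Icc_neg_one_pow_rank`). Put `e = a - b`. Sorting chains
by their least element gives a recursion for the ab-index in `e` and `b` (`psi`, `abIndex_eq_psi`).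
Replacing `b` by `(c - e)/2` and resumming leaves `c`, powers of `e`, and the weights `κ = 2(ζ -
1)/(ζ + 1)` in the incidence algebra (`psi_eq_kappa`). This `κ` changes sign under `ζ ↦ ζ⁻¹`, and in
an Eulerian poset `ζ⁻¹` is `ζ` twisted by `(-1)^rank`; hence `κ` vanishes in even rank
(`kappa_eq_zero`), only even powers of `e` survive, and `e² = c² - 2d`. The halves disappear because
cd-coefficients are integer combinations of ab-coefficients (`coeff_mem_of_coeff_toAB_mem`); the
same fact gives uniqueness and homogeneity.

Spanning. For `q ≠ 1` in the parabolic subgroup omitting `s_k`, the words `q s_k` and `s_k q s_k`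
are as free as possible, because all labels are `3`: mapping to `S₃` shows that neither `s_k` nor
`s_k s_j s_k` lies in that subgroup. So `[1, q s_k]` is `[1, q]` times a two-element chain, which
acts on cd-indices by the pyramid operation `pyr`. And `[1, s_k q s_k]` is `[1, q]` times two such
chains, with the two copies of `s_k` identified and their join removed; this zipping subtracts `d`
times the cd-index of `[1, q]` (`psi_zip`). A combination over `Fₙ` therefore becomes `pyr(A + pyr
B) - dB`, with `A` and `B` combinations over `Fₙ₋₁` and `Fₙ₋₂`. Since `(X, Y) ↦ pyr X + dY` is
bijective onto homogeneous cd-polynomials of degree at least `2`, induction gives both independence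
and spanning. All the cd-indices are monic, so a combination is monic exactly when its weights sum
to `1`. -/

namespace CoxeterSystem

variable {B W : Type*} [Group W] {M : CoxeterMatrix B} (cs : CoxeterSystem M W)

/-! ### The strong exchange property -/

open Classical in
/-- The action of a generator on pairs of a group element `t` and a parity: conjugate `t` by the
generator, and change the parity if `t` is the generator. -/
noncomputable def reflectionStep (i : B) : Function.End (W × ZMod 2) :=
  fun p => (cs.simple i * p.1 * cs.simple i, p.2 + if p.1 = cs.simple i then 1 else 0)

-- The added parity counts how often `t` appears in the list of reflections `s_j (s_i s_j)^l`, `l <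
-- 2k`, of the dihedral group.
open Classical in
theorem reflectionStep_mul_pow_apply (i j : B) (k : ℕ) (t : W) (z : ZMod 2) :
    ((cs.reflectionStep i * cs.reflectionStep j) ^ k) (t, z) =
      ((cs.simple i * cs.simple j) ^ k * t * (cs.simple j * cs.simple i) ^ k,
        z + ∑ l ∈ Finset.range (2 * k),
          if t = cs.simple j * (cs.simple i * cs.simple j) ^ l then 1 else 0) := by
  set p := cs.simple i * cs.simple j with hp
  have hpinv : cs.simple j * cs.simple i = p⁻¹ := by simp [hp]
  have hconj : ∀ k : ℕ, cs.simple j * p ^ k = (p⁻¹) ^ k * cs.simple j := by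
    intro k
    induction k with
    | zero => simp
    | succ k ih =>
      rw [pow_succ, ← mul_assoc, ih, pow_succ, mul_assoc, mul_assoc, ← hpinv, hp]
      simp [mul_assoc]
  induction k with
  | zero => simp; rfl
  | succ k ih =>
    rw [pow_succ']
    change (cs.reflectionStep i * cs.reflectionStep j) (((_ : Function.End _) ^ k) (t, z)) = _
    rw [ih]
    change cs.reflectionStep i (cs.reflectionStep j _) = _
    simp only [reflectionStep]
    rw [hpinv]
    refine Prod.ext ?_ ?_
    · simp only
      rw [pow_succ', pow_succ p⁻¹, ← hpinv, hp]
      simp only [mul_assoc]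
    · simp only
      rw [show 2 * (k + 1) = 2 * k + 1 + 1 by ring, Finset.sum_range_succ, Finset.sum_range_succ,
        add_assoc, add_assoc, add_assoc]
      congr 2
      have key : ∀ x : W, p ^ k * t * (p⁻¹) ^ k = x ↔ t = (p⁻¹) ^ k * x * p ^ k := by
        intro x
        rw [inv_pow]
        constructor
        · rintro rfl
          group
        · intro h
          rw [h]
          group
      have h1 : (p ^ k * t * (p⁻¹) ^ k = cs.simple j) ↔ t = cs.simple j * p ^ (2 * k) := by
        rw [key, two_mul, pow_add, ← mul_assoc, hconj k]
      have h2 : (cs.simple j * (p ^ k * t * (p⁻¹) ^ k) * cs.simple j = cs.simple i) ↔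
          t = cs.simple j * p ^ (2 * k + 1) := by
        have : (cs.simple j * (p ^ k * t * (p⁻¹) ^ k) * cs.simple j = cs.simple i) ↔
            p ^ k * t * (p⁻¹) ^ k = cs.simple j * p := by
          generalize p ^ k * t * (p⁻¹) ^ k = q
          rw [hp]
          constructor
          · intro h
            rw [← h]
            simp [mul_assoc]
          · rintro rfl
            simp [mul_assoc]
        have hconj' : (p⁻¹) ^ k * (cs.simple j * p) = cs.simple j * p ^ (k + 1) := by
          rw [← mul_assoc, ← hconj, mul_assoc, ← pow_succ]
        rw [this, key, hconj', mul_assoc, ← pow_add, show k + 1 + k = 2 * k + 1 by ring]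
      exact congrArg₂ (· + ·) (if_congr h1 rfl rfl) (if_congr h2 rfl rfl)

/-- With `m = M i j`, the list of `2m` reflections has period `m`, so every hit is counted an even
number of times. -/
theorem isLiftable_reflectionStep : M.IsLiftable cs.reflectionStep := by
  classical
  intro i j
  funext ⟨t, z⟩
  rw [reflectionStep_mul_pow_apply, cs.simple_mul_simple_pow, M.symmetric i j,
    cs.simple_mul_simple_pow, one_mul, mul_one, two_mul, Finset.sum_range_add]
  have : ∀ x : ℕ, (cs.simple i * cs.simple j) ^ (M j i + x) = (cs.simple i * cs.simple j) ^ x := by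
    intro x
    rw [pow_add, M.symmetric j i, cs.simple_mul_simple_pow, one_mul]
  simp only [this, CharTwo.add_self_eq_zero, add_zero]
  rfl

/-- The action of a Coxeter group on pairs of a group element and a parity. -/
noncomputable def reflectionAction : W →* Function.End (W × ZMod 2) :=
  cs.lift ⟨cs.reflectionStep, cs.isLiftable_reflectionStep⟩

theorem reflectionAction_simple (i : B) :
    cs.reflectionAction (cs.simple i) = cs.reflectionStep i :=
  cs.lift_apply_simple _ i

open Classical in
theorem reflectionAction_wordProd (ω : List B) (t : W) (z : ZMod 2) :
    cs.reflectionAction (cs.wordProd ω) (t, z) =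
      (cs.wordProd ω * t * (cs.wordProd ω)⁻¹, z + ((cs.rightInvSeq ω).count t : ZMod 2)) := by
  induction ω generalizing t z with
  | nil => simp; rfl
  | cons i ω ih =>
    rw [wordProd_cons, map_mul]
    change cs.reflectionAction (cs.simple i) (cs.reflectionAction (cs.wordProd ω) (t, z)) = _
    rw [ih, reflectionAction_simple]
    simp only [reflectionStep, rightInvSeq]
    have h : cs.wordProd ω * t * (cs.wordProd ω)⁻¹ = cs.simple i ↔
        (cs.wordProd ω)⁻¹ * cs.simple i * cs.wordProd ω = t := by
      constructor
      · intro h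
        rw [← h]
        group
      · rintro rfl
        group
    refine Prod.ext ?_ ?_
    · simp [mul_assoc]
    · simp only [List.count_cons, beq_iff_eq, h]
      push_cast
      rw [add_assoc]

open Classical in
theorem exists_reflectionAction_eq (w : W) : ∃ N : W → ZMod 2,
    ∀ t z, cs.reflectionAction w (t, z) = (w * t * w⁻¹, z + N t) := by
  obtain ⟨ω, rfl⟩ := cs.wordProd_surjective w
  exact ⟨_, cs.reflectionAction_wordProd ω⟩

/-- Write `t = g s g⁻¹`. The parity picked up by `g⁻¹` on the way from `t` to `s` is undone by `g`
on the way back, so only the flip at `s` remains. -/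
theorem reflectionAction_self {t : W} (ht : cs.IsReflection t) (z : ZMod 2) :
    cs.reflectionAction t (t, z) = (t, z + 1) := by
  classical
  obtain ⟨g, i, rfl⟩ := ht
  obtain ⟨N, hN⟩ := cs.exists_reflectionAction_eq g⁻¹
  obtain ⟨N', hN'⟩ := cs.exists_reflectionAction_eq g
  set t := g * cs.simple i * g⁻¹ with ht
  have hgt : g⁻¹ * t * g = cs.simple i := by rw [ht]; group
  have h1 : cs.reflectionAction g⁻¹ (t, z) = (cs.simple i, z + N t) := by
    rw [hN, inv_inv, hgt]
  have h2 : cs.reflectionAction g (cs.reflectionAction g⁻¹ (t, z)) = (t, z) := by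
    change (cs.reflectionAction g * cs.reflectionAction g⁻¹) (t, z) = _
    rw [← map_mul, mul_inv_cancel, map_one]
    rfl
  rw [h1, hN'] at h2
  have h3 : cs.reflectionAction t (t, z) =
      cs.reflectionAction g (cs.reflectionAction (cs.simple i)
        (cs.reflectionAction g⁻¹ (t, z))) := by
    conv_lhs => rw [ht]
    rw [map_mul, map_mul]
    rfl
  rw [h3, h1, reflectionAction_simple]
  simp only [reflectionStep, if_true, simple_mul_simple_self, one_mul]
  rw [hN']
  refine Prod.ext ht.symm ?_
  have := congrArg Prod.snd h2
  simp only at this ⊢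
  rw [add_right_comm, this]

/-- Every right inversion of `w` occurs in the right inversion sequence of every word for `w`. -/
theorem IsRightInversion.mem_rightInvSeq {ω : List B} {t : W}
    (h : cs.IsRightInversion (cs.wordProd ω) t) : t ∈ cs.rightInvSeq ω := by
  classical
  by_contra hmem
  -- If `t` is missing for `ω`, then `wt` flips the parity at `t`, so `t` occurs in the inversion
  -- sequence of the reduced word `η` of `wt`. Then `w = (wt)t` is shorter than `wt`, against the
  -- hypothesis.
  obtain ⟨η, hη, hw⟩ := cs.exists_isReduced (cs.wordProd ω * t)
  have h1 := cs.reflectionAction_wordProd ω t 1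
  rw [List.count_eq_zero_of_not_mem hmem, Nat.cast_zero, add_zero] at h1
  have h2 : cs.reflectionAction (cs.wordProd ω * t) (t, 0) =
      cs.reflectionAction (cs.wordProd ω) (cs.reflectionAction t (t, 0)) := by
    rw [map_mul]
    rfl
  rw [cs.reflectionAction_self h.1, zero_add, h1, hw, reflectionAction_wordProd] at h2
  have h3 := congrArg Prod.snd h2
  simp only [zero_add] at h3
  have h4 : t ∈ cs.rightInvSeq η := by
    by_contra h5
    rw [List.count_eq_zero_of_not_mem h5] at h3
    exact absurd h3 (by decide)
  have h5 := (cs.isRightInversion_of_mem_rightInvSeq hη h4).2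
  rw [← hw, mul_assoc, h.1.mul_self, mul_one] at h5
  exact absurd h.2 (by omega)

/-- The strong exchange property. -/
theorem IsRightInversion.exists_eraseIdx {ω : List B} {t : W}
    (h : cs.IsRightInversion (cs.wordProd ω) t) :
    ∃ j < ω.length, cs.wordProd ω * t = cs.wordProd (ω.eraseIdx j) := by
  obtain ⟨j, hj, rfl⟩ := List.mem_iff_getElem.mp (IsRightInversion.mem_rightInvSeq cs h)
  refine ⟨j, by simpa using hj, ?_⟩
  rw [← List.getD_eq_getElem _ 1 hj, wordProd_mul_getD_rightInvSeq]

theorem exists_eraseIdx_of_isRightDescent {ω : List B} {i : B}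
    (h : cs.IsRightDescent (cs.wordProd ω) i) :
    ∃ j < ω.length, cs.wordProd ω * cs.simple i = cs.wordProd (ω.eraseIdx j) :=
  IsRightInversion.exists_eraseIdx cs ((cs.isRightInversion_simple_iff_isRightDescent _ _).2 h)

/-- Every word contains a reduced word with the same product. -/
theorem exists_isReduced_sublist (ω : List B) :
    ∃ η : List B, η.Sublist ω ∧ cs.IsReduced η ∧ cs.wordProd η = cs.wordProd ω := by
  induction ω using List.reverseRecOn with
  | nil => exact ⟨[], List.Sublist.refl _, by simp [IsReduced], rfl⟩
  | append_singleton ω i ih =>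
    obtain ⟨η, hs, hr, hp⟩ := ih
    rcases cs.length_mul_simple (cs.wordProd η) i with h | h
    · refine ⟨η ++ [i], hs.append (List.Sublist.refl _), ?_, ?_⟩
      · simp [IsReduced, wordProd_append, h, hr.eq]
      · simp [wordProd_append, hp]
    · obtain ⟨j, hj, he⟩ := cs.exists_eraseIdx_of_isRightDescent (ω := η) (i := i)
        (by simp only [IsRightDescent]; omega)
      refine ⟨η.eraseIdx j, ((List.eraseIdx_sublist η j).trans hs).trans
        (List.sublist_append_left _ _), ?_, ?_⟩
      · rw [IsReduced, ← he]
        have := List.length_eraseIdx_add_one hj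
        have := hr.eq
        omega
      · rw [← he, hp, wordProd_append, wordProd_singleton]

theorem IsReduced.concat {ω : List B} {i : B} (hω : cs.IsReduced ω)
    (h : cs.length (cs.wordProd ω) < cs.length (cs.wordProd ω * cs.simple i)) :
    cs.IsReduced (ω ++ [i]) := by
  rcases cs.length_mul_simple (cs.wordProd ω) i with h' | h'
  · simp [IsReduced, wordProd_append, h', hω.eq]
  · omega

/-! ### Bruhat order by reflections -/

/-- `x < x t` for a reflection `t` that increases the length. -/
def ReflectionLT (x y : W) : Prop :=
  ∃ t, cs.IsReflection t ∧ y = x * t ∧ cs.length x < cs.length y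

/-- The order generated by `x < x t` for reflections `t` that increase the length. -/
def ReflectionLE : W → W → Prop := Relation.ReflTransGen cs.ReflectionLT

variable {cs}

theorem reflectionLT_mul_simple {x : W} {i : B} (h : cs.length x < cs.length (x * cs.simple i)) :
    cs.ReflectionLT x (x * cs.simple i) :=
  ⟨_, cs.isReflection_simple i, rfl, h⟩

theorem reflectionLT_mul_simple' {x : W} {i : B} (h : cs.length (x * cs.simple i) < cs.length x) :
    cs.ReflectionLT (x * cs.simple i) x :=
  ⟨_, cs.isReflection_simple i, by simp, h⟩

/-- If `xs < x`, then `xs < x < y`. If `s` lengthens both, conjugating `t` by `s` gives `xs < ys`.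
If it lengthens `x` and shortens `y`, apply strong exchange to a reduced word of `y` ending in `s`.
-/
theorem ReflectionLT.mul_simple {x y : W} (h : cs.ReflectionLT x y) (i : B) :
    cs.ReflectionLE (x * cs.simple i) y ∨ cs.ReflectionLE (x * cs.simple i) (y * cs.simple i) := by
  have hxy := h
  obtain ⟨t, ht, hy, hlt⟩ := h
  have hx : x = y * t := by rw [hy, mul_assoc, ht.mul_self, mul_one]
  rcases cs.length_mul_simple x i with hxi | hxi
  · rcases cs.length_mul_simple y i with hyi | hyi
    · right
      refine Relation.ReflTransGen.single ⟨cs.simple i * t * (cs.simple i)⁻¹, ht.conj _, ?_, ?_⟩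
      · rw [hy]
        simp [mul_assoc]
      · omega
    · left
      obtain ⟨η, hη, hp⟩ := cs.exists_isReduced (y * cs.simple i)
      have hword : y = cs.wordProd (η ++ [i]) := by
        rw [wordProd_append, ← hp]
        simp
      obtain ⟨j, hj, he⟩ := IsRightInversion.exists_eraseIdx cs (ω := η ++ [i]) (t := t)
        ⟨ht, by rw [← hword, ← hx]; exact hlt⟩
      rw [← hword, ← hx] at he
      rw [List.length_append, List.length_singleton] at hj
      -- Erasing a letter of `η` makes `xs` shorter than `ys`; erasing the final `s` means `xs = y`.
      rcases Nat.lt_or_ge j η.length with hj' | hj'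
      · rw [List.eraseIdx_append_of_lt_length hj', wordProd_append, wordProd_singleton] at he
        have hxi' : x * cs.simple i = cs.wordProd (η.eraseIdx j) := by
          rw [he]
          simp
        have hle := cs.length_wordProd_le (η.eraseIdx j)
        have := List.length_eraseIdx_add_one hj'
        have hη' : cs.length (y * cs.simple i) = η.length := by rw [hp]; exact hη
        have hlt' : cs.length (x * cs.simple i) < cs.length (y * cs.simple i) := by
          rw [hxi', hη']
          omega
        have h1 : cs.ReflectionLT (x * cs.simple i) (y * cs.simple i) := by
          refine ⟨cs.simple i * t * (cs.simple i)⁻¹, ht.conj _, ?_, hlt'⟩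
          rw [hy]
          simp [mul_assoc]
        exact (Relation.ReflTransGen.single h1).trans
          (Relation.ReflTransGen.single (reflectionLT_mul_simple' (by omega)))
      · have : j = η.length := by omega
        subst this
        rw [List.eraseIdx_append_of_length_le le_rfl] at he
        simp only [Nat.sub_self, List.eraseIdx_cons_zero, List.append_nil] at he
        rw [he, ← hp]
        simp only [simple_mul_simple_cancel_right]
        exact Relation.ReflTransGen.refl
  · left
    exact (Relation.ReflTransGen.single (reflectionLT_mul_simple' (by omega))).trans
      (Relation.ReflTransGen.single hxy)

theorem ReflectionLE.mul_simple {x y : W} (h : cs.ReflectionLE x y) (i : B) :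
    cs.ReflectionLE (x * cs.simple i) y ∨ cs.ReflectionLE (x * cs.simple i) (y * cs.simple i) := by
  induction h with
  | refl => exact Or.inr Relation.ReflTransGen.refl
  | tail _ hyz ih =>
    rcases ih with ih | ih
    · exact Or.inl (ih.tail hyz)
    · rcases hyz.mul_simple i with h | h
      · exact Or.inl (ih.trans h)
      · exact Or.inr (ih.trans h)

theorem reflectionLE_of_sublist {ω σ : List B} (hω : cs.IsReduced ω) (h : σ.Sublist ω) :
    cs.ReflectionLE (cs.wordProd σ) (cs.wordProd ω) := by
  induction ω using List.reverseRecOn generalizing σ with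
  | nil =>
    rw [List.sublist_nil.1 h]
    exact Relation.ReflTransGen.refl
  | append_singleton ω i ih =>
    have hr : cs.IsReduced ω := by
      have := hω.take ω.length
      simpa using this
    have hup : cs.ReflectionLE (cs.wordProd ω) (cs.wordProd (ω ++ [i])) := by
      refine Relation.ReflTransGen.single ?_
      rw [wordProd_append, wordProd_singleton]
      refine reflectionLT_mul_simple ?_
      have h1 := hω.eq
      rw [wordProd_append, wordProd_singleton, List.length_append, List.length_singleton] at h1
      have h2 := hr.eq
      omega
    obtain ⟨σ₁, σ₂, rfl, h1, h2⟩ := List.sublist_append_iff.1 h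
    rcases List.sublist_singleton.1 h2 with rfl | rfl
    · rw [List.append_nil]
      exact (ih hr h1).trans hup
    · rw [wordProd_append, wordProd_singleton]
      rcases (ih hr h1).mul_simple i with h | h
      · exact h.trans hup
      · rw [← wordProd_singleton, ← wordProd_append, ← wordProd_append] at h
        rwa [← wordProd_singleton, ← wordProd_append]

theorem ReflectionLT.bruhatLE {x y : W} (h : cs.ReflectionLT x y) : cs.BruhatLE x y := by
  intro ω _ hp
  obtain ⟨t, ht, hy, hlt⟩ := h
  have hx : x = y * t := by rw [hy, mul_assoc, ht.mul_self, mul_one]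
  obtain ⟨j, -, he⟩ := IsRightInversion.exists_eraseIdx cs (ω := ω) (t := t)
    ⟨ht, by rw [hp, ← hx]; exact hlt⟩
  obtain ⟨η, hs, hr, hη⟩ := cs.exists_isReduced_sublist (ω.eraseIdx j)
  refine ⟨η, hs.trans (List.eraseIdx_sublist ω j), hr, ?_⟩
  rw [hη, ← he, hp, ← hx]

theorem ReflectionLE.bruhatLE {x y : W} (h : cs.ReflectionLE x y) : cs.BruhatLE x y := by
  induction h with
  | refl => exact BruhatLE.refl cs x
  | tail _ h ih => exact ih.trans h.bruhatLE

/-! ### Bruhat order: subwords and lifting -/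

/-- Passing through the reflection order replaces "every reduced word" by "some reduced word"; the
subword itself may be non-reduced. -/
theorem bruhatLE_of_sublist {ω σ : List B} (hω : cs.IsReduced ω) (h : σ.Sublist ω) :
    cs.BruhatLE (cs.wordProd σ) (cs.wordProd ω) :=
  (reflectionLE_of_sublist hω h).bruhatLE

theorem one_bruhatLE (w : W) : cs.BruhatLE 1 w := by
  obtain ⟨ω, hω, rfl⟩ := cs.exists_isReduced w
  simpa using bruhatLE_of_sublist hω (List.nil_sublist ω)

theorem bruhatLE_mul_simple {x : W} {i : B} (h : cs.length x < cs.length (x * cs.simple i)) :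
    cs.BruhatLE x (x * cs.simple i) :=
  (reflectionLT_mul_simple h).bruhatLE

theorem mul_simple_bruhatLE {x : W} {i : B} (h : cs.length (x * cs.simple i) < cs.length x) :
    cs.BruhatLE (x * cs.simple i) x :=
  (reflectionLT_mul_simple' h).bruhatLE

/-- In a reduced word of `w` ending in `s`, the subword for `v` either omits or uses that last
letter. The lifting properties below are its special cases or consequences. -/
theorem BruhatLE.le_mul_simple_or {v w : W} {i : B} (h : cs.BruhatLE v w)
    (hw : cs.length (w * cs.simple i) < cs.length w) :
    cs.BruhatLE v (w * cs.simple i) ∨ cs.BruhatLE (v * cs.simple i) (w * cs.simple i) := by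
  obtain ⟨ω, hω, hp⟩ := cs.exists_isReduced (w * cs.simple i)
  have hw' : w = cs.wordProd ω * cs.simple i := by rw [← hp]; simp
  have hω' : cs.IsReduced (ω ++ [i]) := IsReduced.concat cs hω (by rw [← hw', ← hp]; exact hw)
  obtain ⟨σ, hs, -, hv⟩ := h (ω ++ [i]) hω' (by rw [wordProd_append, wordProd_singleton, hw'])
  obtain ⟨σ₁, σ₂, rfl, h1, h2⟩ := List.sublist_append_iff.1 hs
  rcases List.sublist_singleton.1 h2 with rfl | rfl
  · left
    rw [hp, ← hv, List.append_nil]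
    exact bruhatLE_of_sublist hω h1
  · right
    rw [hp, ← hv, wordProd_append, wordProd_singleton, simple_mul_simple_cancel_right]
    exact bruhatLE_of_sublist hω h1

theorem BruhatLE.mul_simple_le_mul_simple {v w : W} {i : B} (h : cs.BruhatLE v w)
    (hw : cs.length (w * cs.simple i) < cs.length w)
    (hv : cs.length (v * cs.simple i) < cs.length v) :
    cs.BruhatLE (v * cs.simple i) (w * cs.simple i) := by
  rcases h.le_mul_simple_or hw with h | h
  · exact (mul_simple_bruhatLE hv).trans h
  · exact h

theorem BruhatLE.le_mul_simple {v w : W} {i : B} (h : cs.BruhatLE v w)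
    (hw : cs.length (w * cs.simple i) < cs.length w)
    (hv : cs.length v < cs.length (v * cs.simple i)) :
    cs.BruhatLE v (w * cs.simple i) := by
  rcases h.le_mul_simple_or hw with h | h
  · exact h
  · exact (bruhatLE_mul_simple hv).trans h

theorem BruhatLE.mul_simple_le {v w : W} {i : B} (h : cs.BruhatLE v w)
    (hw : cs.length (w * cs.simple i) < cs.length w) :
    cs.BruhatLE (v * cs.simple i) w := by
  rcases cs.length_mul_simple v i with hv | hv
  · have h' := h.le_mul_simple hw (by omega)
    obtain ⟨ω, hω, hp⟩ := cs.exists_isReduced (w * cs.simple i)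
    have hw' : w = cs.wordProd ω * cs.simple i := by rw [← hp]; simp
    have hω' : cs.IsReduced (ω ++ [i]) := IsReduced.concat cs hω (by rw [← hw', ← hp]; exact hw)
    obtain ⟨σ, hs, -, rfl⟩ := h' ω hω hp.symm
    rw [hw', ← wordProd_singleton, ← wordProd_append, ← wordProd_append]
    exact bruhatLE_of_sublist hω' (hs.append (List.Sublist.refl _))
  · exact (mul_simple_bruhatLE (by omega)).trans h

end CoxeterSystem

/-! ### Bruhat order as an Eulerian poset -/

namespace CoxeterSystem

variable {B W : Type*} [Group W] {M : CoxeterMatrix B}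

/-- A Coxeter group, to be ordered by Bruhat order. -/
def Bruhat (_ : CoxeterSystem M W) : Type _ := W

variable {cs : CoxeterSystem M W}

/-- A group element as an element of the poset of Bruhat order. -/
def toBruhat (cs : CoxeterSystem M W) (w : W) : cs.Bruhat := w

/-- The group element underlying an element of the poset of Bruhat order. -/
def Bruhat.val (x : cs.Bruhat) : W := x

instance : PartialOrder cs.Bruhat where
  le x y := cs.BruhatLE x.val y.val
  le_refl x := show cs.BruhatLE x.val x.val from BruhatLE.refl cs _
  le_trans _ _ _ h h' := BruhatLE.trans h h'
  le_antisymm x y h h' := show x.val = y.val from BruhatLE.antisymm h h'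

theorem toBruhat_inj {x y : W} : cs.toBruhat x = cs.toBruhat y ↔ x = y := Iff.rfl

noncomputable instance : LocallyFiniteOrder cs.Bruhat :=
  LocallyFiniteOrder.ofFiniteIcc fun u w =>
    Set.finite_coe_iff.mp (inferInstanceAs (Finite (cs.BruhatInterval u.val w.val)))

/-- The rank function of Bruhat order. -/
noncomputable def Bruhat.rank (x : cs.Bruhat) : ℕ := cs.length x.val

theorem rank_toBruhat (w : W) : (cs.toBruhat w).rank = cs.length w := rfl

theorem Bruhat.rank_strictMono : StrictMono (Bruhat.rank : cs.Bruhat → ℕ) := by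
  intro x y h
  refine lt_of_le_of_ne (BruhatLE.length_le h.le) fun hl => h.not_ge ?_
  have hle : cs.BruhatLE x.val y.val := h.le
  obtain ⟨ω, hω, hw⟩ := cs.exists_isReduced y.val
  obtain ⟨ω', s, r, hw'⟩ := hle ω hω hw.symm
  have : ω' = ω := by
    refine s.eq_of_length ?_
    rw [← hω.eq, ← r.eq, ← hw, hw']
    exact hl
  rw [this, ← hw] at hw'
  exact (le_of_eq hw' : y ≤ x)

theorem exists_mul_simple_lt {w : W} (h : w ≠ 1) :
    ∃ i, cs.length (w * cs.simple i) < cs.length w :=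
  cs.exists_rightDescent_of_ne_one h

/-- Take a right descent `s` of `x`. If `us > u`, lifting gives `u ≤ xs`. Otherwise induction
supplies a coatom `y` of `[us, xs]`, and either `ys` or `xs` works. -/
theorem BruhatLE.exists_cover {u x : W} (h : cs.BruhatLE u x) (hne : u ≠ x) :
    ∃ y, cs.BruhatLE u y ∧ cs.BruhatLE y x ∧ cs.length x = cs.length y + 1 := by
  induction hn : cs.length x using Nat.strong_induction_on generalizing u x with
  | _ n ih =>
  subst hn
  have hx : x ≠ 1 := by
    rintro rfl
    exact hne (h.antisymm (one_bruhatLE u))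
  obtain ⟨i, hi⟩ := exists_mul_simple_lt (cs := cs) hx
  have hi' : cs.length x = cs.length (x * cs.simple i) + 1 := by
    rcases cs.length_mul_simple x i with h | h <;> omega
  rcases cs.length_mul_simple u i with hu | hu
  · exact ⟨x * cs.simple i, h.le_mul_simple hi (by omega), mul_simple_bruhatLE hi, hi'⟩
  · have hle := h.mul_simple_le_mul_simple hi (by omega)
    obtain ⟨y, huy, hyx, hl⟩ := ih _ hi hle (by simpa using hne) rfl
    rcases cs.length_mul_simple y i with hy | hy
    · refine ⟨y * cs.simple i, ?_, ?_, by omega⟩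
      -- From `us ≤ y < ys` and the descent `s` of `ys` follows `u = (us)s ≤ ys`.
      · have h1 := (huy.trans (bruhatLE_mul_simple (i := i) (by omega))).mul_simple_le
          (i := i) (by rw [simple_mul_simple_cancel_right]; omega)
        simpa using h1
      · exact (hyx.trans (mul_simple_bruhatLE hi)).mul_simple_le hi
    · refine ⟨x * cs.simple i, ?_, mul_simple_bruhatLE hi, hi'⟩
      have h1 := huy.mul_simple_le (i := i) (by omega)
      rw [simple_mul_simple_cancel_right] at h1
      exact h1.trans hyx

theorem neg_one_pow_length_mul_simple (x : W) (i : B) :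
    (-1 : ℤ) ^ cs.length (x * cs.simple i) = -(-1) ^ cs.length x := by
  rcases cs.length_mul_simple x i with h | h
  · rw [h, pow_succ]
    ring
  · rw [← h, pow_succ]
    ring

/-- Every interval in Bruhat order with at least two elements has as many elements of even length
as of odd length. -/
theorem sum_Icc_neg_one_pow_rank {u w : cs.Bruhat} (h : u < w) :
    ∑ x ∈ Finset.Icc u w, (-1 : ℤ) ^ x.rank = 0 := by
  classical
  induction hn : w.rank using Nat.strong_induction_on generalizing u w with
  | _ n ih =>
  subst hn
  have hw : w.val ≠ 1 := by
    intro h1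
    exact h.not_ge (by change cs.BruhatLE w.val u.val; rw [h1]; exact one_bruhatLE _)
  obtain ⟨i, hi⟩ := exists_mul_simple_lt (cs := cs) hw
  -- When `vs > v`, lifting makes `[v, w]` stable under `x ↦ xs`, an involution without fixed points
  -- that changes the parity of the length.
  have closed : ∀ v : cs.Bruhat, cs.length v.val < cs.length (v.val * cs.simple i) →
      ∑ x ∈ Finset.Icc v w, (-1 : ℤ) ^ x.rank = 0 := by
    intro v hv
    refine Finset.sum_involution (fun x _ => cs.toBruhat (x.val * cs.simple i)) ?_ ?_ ?_ ?_
    · intro x _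
      change (-1 : ℤ) ^ cs.length x.val + (-1) ^ cs.length (x.val * cs.simple i) = 0
      rw [neg_one_pow_length_mul_simple]
      ring
    · intro x _ _ he
      have : x.val * cs.simple i = x.val := he
      exact cs.length_mul_simple_ne x.val i (by rw [this])
    · intro x hx
      rw [Finset.mem_Icc] at hx ⊢
      have h1 : cs.BruhatLE v.val x.val := hx.1
      have h2 : cs.BruhatLE x.val w.val := hx.2
      refine ⟨?_, h2.mul_simple_le hi⟩
      change cs.BruhatLE v.val (x.val * cs.simple i)
      rcases cs.length_mul_simple x.val i with hl | hl
      · exact h1.trans (bruhatLE_mul_simple (by omega))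
      · exact h1.le_mul_simple (by omega) hv
    · intro x _
      change (x.val * cs.simple i) * cs.simple i = x.val
      simp
  rcases cs.length_mul_simple u.val i with hu | hu
  · exact closed u (by omega)
  set u' := cs.toBruhat (u.val * cs.simple i) with hu'
  set w' := cs.toBruhat (w.val * cs.simple i) with hw'
  have huu : u' ≤ u :=
    show cs.BruhatLE (u.val * cs.simple i) u.val from mul_simple_bruhatLE (by omega)
  have hww : w' ≤ w :=
    show cs.BruhatLE (w.val * cs.simple i) w.val from mul_simple_bruhatLE hi
  have hsub : Finset.Icc u w ⊆ Finset.Icc u' w := Finset.Icc_subset_Icc_left huu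
  have hsub' : Finset.Icc u w' ⊆ Finset.Icc u' w' := Finset.Icc_subset_Icc_left huu
  -- For `us < u`, an element `x ≥ us` that is not above `u` must satisfy `xs > x`; so if it is
  -- below `w`, it is already below `ws`.
  have hdiff : Finset.Icc u' w \ Finset.Icc u w = Finset.Icc u' w' \ Finset.Icc u w' := by
    ext x
    simp only [Finset.mem_sdiff, Finset.mem_Icc, not_and]
    constructor
    · rintro ⟨⟨h1, h2⟩, h3⟩
      have h4 : ¬ u ≤ x := fun h4 => h3 h4 h2
      refine ⟨⟨h1, ?_⟩, fun h5 => absurd h5 h4⟩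
      have h2' : cs.BruhatLE x.val w.val := h2
      refine h2'.le_mul_simple hi ?_
      rcases cs.length_mul_simple x.val i with hl | hl
      · omega
      · have h6 := BruhatLE.mul_simple_le (i := i) (show cs.BruhatLE u'.val x.val from h1)
          (by omega)
        rw [show u'.val * cs.simple i = u.val from simple_mul_simple_cancel_right cs i] at h6
        exact absurd h6 h4
    · rintro ⟨⟨h1, h2⟩, h3⟩
      have h4 : ¬ u ≤ x := fun h4 => h3 h4 h2
      exact ⟨⟨h1, h2.trans hww⟩, fun h5 => absurd h5 h4⟩
  have hrank : w'.rank < w.rank := hi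
  have hlt : u' < w' := by
    refine lt_of_le_of_ne ?_ ?_
    · exact BruhatLE.mul_simple_le_mul_simple (show cs.BruhatLE u.val w.val from h.le) hi (by omega)
    · intro he
      have : u.val * cs.simple i = w.val * cs.simple i := he
      exact h.ne (show u.val = w.val from mul_right_cancel this)
  have hcl : ∑ x ∈ Finset.Icc u' w, (-1 : ℤ) ^ x.rank = 0 := by
    refine closed u' ?_
    change cs.length (u.val * cs.simple i) < cs.length (u.val * cs.simple i * cs.simple i)
    rw [simple_mul_simple_cancel_right]
    omega
  have h1 := Finset.sum_sdiff (f := fun x : cs.Bruhat => (-1 : ℤ) ^ x.rank) hsub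
  have h2 := Finset.sum_sdiff (f := fun x : cs.Bruhat => (-1 : ℤ) ^ x.rank) hsub'
  rw [hdiff] at h1
  rw [ih _ hrank hlt rfl] at h2
  have h3 : ∑ x ∈ Finset.Icc u w', (-1 : ℤ) ^ x.rank = 0 := by
    by_cases huw : u ≤ w'
    · refine ih _ hrank (lt_of_le_of_ne huw ?_) rfl
      intro he
      have : u.val = w.val * cs.simple i := he
      rw [this, simple_mul_simple_cancel_right] at hu
      omega
    · rw [Finset.Icc_eq_empty huw, Finset.sum_empty]
  linarith

end CoxeterSystem

/-! ### Words in the letters `c, d` and in the letters `a, b` -/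

section Letters

variable {R : Type*} [CommRing R] {α : Type*}

theorem coeff_of_mul_of_mul (x : α) (f : MonoidAlgebra R (FreeMonoid α)) (m : FreeMonoid α) :
    (MonoidAlgebra.of R (FreeMonoid α) (FreeMonoid.of x) * f).coeff (FreeMonoid.of x * m) =
      f.coeff m := by
  rw [MonoidAlgebra.of_apply, MonoidAlgebra.coeff_single_mul_eq_mul_coeff m, one_mul]
  intro m' _
  exact mul_right_inj _

theorem coeff_of_mul_of_mul_ne {x y : α} (h : x ≠ y) (f : MonoidAlgebra R (FreeMonoid α))
    (m : FreeMonoid α) :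
    (MonoidAlgebra.of R (FreeMonoid α) (FreeMonoid.of x) * f).coeff (FreeMonoid.of y * m) = 0 := by
  rw [MonoidAlgebra.of_apply, MonoidAlgebra.coeff_single_mul_of_forall_mul_ne]
  intro d hd
  exact h (List.cons.inj (congrArg FreeMonoid.toList hd)).1

theorem coeff_of_mul_one (x : α) (f : MonoidAlgebra R (FreeMonoid α)) :
    (MonoidAlgebra.of R (FreeMonoid α) (FreeMonoid.of x) * f).coeff 1 = 0 := by
  rw [MonoidAlgebra.of_apply, MonoidAlgebra.coeff_single_mul_of_forall_mul_ne]
  intro d hd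
  exact List.cons_ne_nil _ _ (congrArg FreeMonoid.toList hd)

theorem coeff_algebraMap_one (r : R) :
    (algebraMap R (MonoidAlgebra R (FreeMonoid α)) r).coeff 1 = r := by
  simp [MonoidAlgebra.coe_algebraMap]

theorem coeff_algebraMap_of_mul (r : R) (x : α) (m : FreeMonoid α) :
    (algebraMap R (MonoidAlgebra R (FreeMonoid α)) r).coeff (FreeMonoid.of x * m) = 0 := by
  simp [MonoidAlgebra.coe_algebraMap]

end Letters

/-! ### Recovering cd-coefficients from ab-coefficients -/

namespace CDPoly

variable {R : Type*} [CommRing R]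

/-- The variable `c` or `d` of `R⟨c, d⟩`. -/
noncomputable def var (R : Type*) [CommRing R] (x : CDLetter) : CDPoly R :=
  MonoidAlgebra.of R (FreeMonoid CDLetter) (FreeMonoid.of x)

theorem toAB_var (x : CDLetter) : toAB R (var R x) = x.toAB R := by
  simp [toAB, var]

theorem coeff_var_mul_self (x : CDLetter) (f : CDPoly R) (m : FreeMonoid CDLetter) :
    (var R x * f).coeff (FreeMonoid.of x * m) = f.coeff m :=
  coeff_of_mul_of_mul x f m

theorem coeff_var_mul_ne {x y : CDLetter} (h : x ≠ y) (f : CDPoly R) (m : FreeMonoid CDLetter) :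
    (var R x * f).coeff (FreeMonoid.of y * m) = 0 :=
  coeff_of_mul_of_mul_ne h f m

theorem coeff_var_mul_one (x : CDLetter) (f : CDPoly R) : (var R x * f).coeff 1 = 0 :=
  coeff_of_mul_one x f

/-- Linear equations between cd-polynomials may be checked on `1`, `c * Φ` and `d * Φ`. -/
theorem letter_induction {motive : CDPoly R → Prop} (Φ : CDPoly R) (one : motive 1)
    (var_mul : ∀ x Φ, motive Φ → motive (var R x * Φ))
    (add : ∀ Φ Ψ, motive Φ → motive Ψ → motive (Φ + Ψ))
    (smul : ∀ (r : R) Φ, motive Φ → motive (r • Φ)) : motive Φ := by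
  refine MonoidAlgebra.induction_on Φ (fun m => ?_) add smul
  induction m using FreeMonoid.inductionOn' with
  | one => exact one
  | of_mul x m ih =>
    rw [map_mul]
    exact var_mul x _ ih

theorem exists_eq_letters (Φ : CDPoly R) :
    ∃ (r : R) (X Y : CDPoly R), Φ = algebraMap R _ r + var R .c * X + var R .d * Y := by
  induction Φ using letter_induction with
  | one => exact ⟨1, 0, 0, by rw [map_one, mul_zero, mul_zero, add_zero, add_zero]⟩
  | var_mul x Φ _ =>
    cases x
    · exact ⟨0, Φ, 0, by simp⟩
    · exact ⟨0, 0, Φ, by simp⟩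
  | add Φ Ψ h h' =>
    obtain ⟨r, X, Y, rfl⟩ := h
    obtain ⟨r', X', Y', rfl⟩ := h'
    exact ⟨r + r', X + X', Y + Y', by rw [map_add, mul_add, mul_add]; abel⟩
  | smul s Φ h =>
    obtain ⟨r, X, Y, rfl⟩ := h
    exact ⟨s * r, s • X, s • Y, by
      rw [smul_add, smul_add, mul_smul_comm, mul_smul_comm, map_mul, ← Algebra.smul_def]⟩

section Coefficients

variable (r : R) (X Y : CDPoly R)

theorem coeff_letters_one :
    (algebraMap R (CDPoly R) r + var R .c * X + var R .d * Y).coeff 1 = r := by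
  simp only [MonoidAlgebra.coeff_add, Finsupp.add_apply, coeff_algebraMap_one, coeff_var_mul_one,
    add_zero]

theorem coeff_letters_c_mul (m : FreeMonoid CDLetter) :
    (algebraMap R (CDPoly R) r + var R .c * X + var R .d * Y).coeff (FreeMonoid.of .c * m) =
      X.coeff m := by
  simp only [MonoidAlgebra.coeff_add, Finsupp.add_apply, coeff_algebraMap_of_mul,
    coeff_var_mul_self, zero_add]
  rw [coeff_var_mul_ne (by simp), add_zero]

theorem coeff_letters_d_mul (m : FreeMonoid CDLetter) :
    (algebraMap R (CDPoly R) r + var R .c * X + var R .d * Y).coeff (FreeMonoid.of .d * m) =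
      Y.coeff m := by
  simp only [MonoidAlgebra.coeff_add, Finsupp.add_apply, coeff_algebraMap_of_mul,
    coeff_var_mul_self, zero_add]
  rw [coeff_var_mul_ne (by simp), zero_add]

/-- Sorting by the first letter `a` or `b` makes the substitution recursive in the parts `X` and
`Y`. -/
theorem toAB_letters :
    toAB R (algebraMap R (CDPoly R) r + var R .c * X + var R .d * Y) =
      algebraMap R _ r + ABPoly.var R .a * (toAB R X + ABPoly.var R .b * toAB R Y) +
        ABPoly.var R .b * (toAB R X + ABPoly.var R .a * toAB R Y) := by
  simp only [map_add, map_mul, toAB_var, CDLetter.toAB, AlgHom.commutes]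
  noncomm_ring

theorem coeff_toAB_letters_one :
    (toAB R (algebraMap R (CDPoly R) r + var R .c * X + var R .d * Y)).coeff 1 = r := by
  rw [toAB_letters]
  simp only [MonoidAlgebra.coeff_add, Finsupp.add_apply, coeff_algebraMap_one, ABPoly.var,
    coeff_of_mul_one, add_zero]

theorem coeff_toAB_letters_a_mul (m : FreeMonoid ABLetter) :
    (toAB R (algebraMap R (CDPoly R) r + var R .c * X + var R .d * Y)).coeff
        (FreeMonoid.of .a * m) =
      (toAB R X).coeff m + (ABPoly.var R .b * toAB R Y).coeff m := by
  rw [toAB_letters, MonoidAlgebra.coeff_add, MonoidAlgebra.coeff_add, Finsupp.add_apply,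
    Finsupp.add_apply, coeff_algebraMap_of_mul, zero_add]
  simp only [ABPoly.var]
  rw [coeff_of_mul_of_mul, coeff_of_mul_of_mul_ne (by simp), add_zero]
  rfl

theorem coeff_toAB_letters_b_mul (m : FreeMonoid ABLetter) :
    (toAB R (algebraMap R (CDPoly R) r + var R .c * X + var R .d * Y)).coeff
        (FreeMonoid.of .b * m) =
      (toAB R X).coeff m + (ABPoly.var R .a * toAB R Y).coeff m := by
  rw [toAB_letters, MonoidAlgebra.coeff_add, MonoidAlgebra.coeff_add, Finsupp.add_apply,
    Finsupp.add_apply, coeff_algebraMap_of_mul, zero_add]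
  simp only [ABPoly.var]
  rw [coeff_of_mul_of_mul, coeff_of_mul_of_mul_ne (by simp), zero_add]
  rfl

end Coefficients

theorem wordDeg_of_mul (x : CDLetter) (m : FreeMonoid CDLetter) :
    CDLetter.wordDeg (FreeMonoid.of x * m) = x.deg + CDLetter.wordDeg m := by
  simp [CDLetter.wordDeg]

theorem wordDeg_one : CDLetter.wordDeg 1 = 0 := rfl

/-- Degree by degree, additive conditions on the coefficients of the expansion of a cd-polynomial
in `a` and `b` hold for the coefficients of the cd-polynomial as well. -/
theorem coeff_mem_of_coeff_toAB_mem (S : ℕ → AddSubgroup R) (Φ : CDPoly R)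
    (h : ∀ v : FreeMonoid ABLetter, (toAB R Φ).coeff v ∈ S v.length) (m : FreeMonoid CDLetter) :
    Φ.coeff m ∈ S (CDLetter.wordDeg m) := by
  induction m using FreeMonoid.inductionOn' generalizing Φ S with
  | one =>
    obtain ⟨r, X, Y, rfl⟩ := exists_eq_letters Φ
    have := h 1
    rw [coeff_toAB_letters_one] at this
    rw [coeff_letters_one]
    exact this
  | of_mul x m ih =>
    obtain ⟨r, X, Y, rfl⟩ := exists_eq_letters Φ
    -- The coefficient of `abv` is that of `bv` in `X` plus that of `v` in `Y`; the coefficient of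
    -- `bbv` has only the first summand. Their difference isolates `Y`.
    have hY : ∀ v : FreeMonoid ABLetter, (toAB R Y).coeff v ∈ S (2 + v.length) := by
      intro v
      have ha := h (FreeMonoid.of .a * (FreeMonoid.of .b * v))
      have hb := h (FreeMonoid.of .b * (FreeMonoid.of .b * v))
      rw [coeff_toAB_letters_a_mul] at ha
      rw [coeff_toAB_letters_b_mul] at hb
      simp only [ABPoly.var] at ha hb
      rw [coeff_of_mul_of_mul] at ha
      rw [coeff_of_mul_of_mul_ne (by simp), add_zero] at hb
      simp only [FreeMonoid.length_mul, FreeMonoid.length_of, ← add_assoc] at ha hb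
      simpa using sub_mem ha hb
    cases x
    · rw [coeff_letters_c_mul, wordDeg_of_mul]
      refine ih (fun k => S (1 + k)) X fun v => ?_
      have ha := h (FreeMonoid.of .a * v)
      rw [coeff_toAB_letters_a_mul, FreeMonoid.length_mul, FreeMonoid.length_of] at ha
      -- With `Y` under control, its contribution to words starting with `a` can be subtracted,
      -- leaving `X`.
      have hb : (ABPoly.var R .b * toAB R Y).coeff v ∈ S (1 + v.length) := by
        induction v using FreeMonoid.casesOn with
        | one => rw [ABPoly.var, coeff_of_mul_one]; exact zero_mem _
        | of_mul y v =>
          cases y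
          · rw [ABPoly.var, coeff_of_mul_of_mul_ne (by simp)]
            exact zero_mem _
          · rw [ABPoly.var, coeff_of_mul_of_mul]
            have := hY v
            simpa [← add_assoc] using this
      simpa using sub_mem ha hb
    · rw [coeff_letters_d_mul, wordDeg_of_mul]
      exact ih (fun k => S (2 + k)) Y hY

theorem toAB_injective : Function.Injective (toAB R) := by
  rw [injective_iff_map_eq_zero]
  intro Φ h
  ext m
  simpa using coeff_mem_of_coeff_toAB_mem (fun _ => ⊥) Φ (by simp [h]) m

/-- Every word in the expansion of a monomial containing `d` has a letter `b`, so only `c ^ n`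
produces `a ^ n`. -/
theorem coeff_toAB_a_pow (n : ℕ) (Φ : CDPoly R) :
    (toAB R Φ).coeff (FreeMonoid.of .a ^ n) = Φ.coeff (FreeMonoid.of .c ^ n) := by
  induction n generalizing Φ with
  | zero =>
    obtain ⟨r, X, Y, rfl⟩ := exists_eq_letters Φ
    rw [pow_zero, pow_zero, coeff_toAB_letters_one, coeff_letters_one]
  | succ n ih =>
    obtain ⟨r, X, Y, rfl⟩ := exists_eq_letters Φ
    rw [pow_succ', pow_succ', coeff_toAB_letters_a_mul, coeff_letters_c_mul, ih]
    cases n with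
    | zero => simp [ABPoly.var]
    | succ n => rw [pow_succ' (FreeMonoid.of ABLetter.a), ABPoly.var,
        coeff_of_mul_of_mul_ne (by simp), add_zero]

/-! ### Homogeneous cd-polynomials -/

/-- The cd-polynomials all of whose monomials have degree `n`. -/
def homogeneous (R : Type*) [CommRing R] (n : ℕ) : Submodule R (CDPoly R) where
  carrier := {p | ∀ m, CDLetter.wordDeg m ≠ n → p.coeff m = 0}
  add_mem' {p q} hp hq m hm := by simp [hp m hm, hq m hm]
  zero_mem' := by simp
  smul_mem' r p hp m hm := by simp [hp m hm]

theorem mem_homogeneous {n : ℕ} {p : CDPoly R} :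
    p ∈ homogeneous R n ↔ ∀ m, CDLetter.wordDeg m ≠ n → p.coeff m = 0 := Iff.rfl

theorem mem_monic {n : ℕ} {p : CDPoly R} :
    p ∈ monic R n ↔ p ∈ homogeneous R n ∧ p.coeff (FreeMonoid.of .c ^ n) = 1 := by
  simp only [monic, Set.mem_ofPred_eq, mem_homogeneous, Finsupp.mem_support_iff]
  refine and_congr_left fun _ => forall_congr' fun m => ?_
  tauto

theorem algebraMap_mem_homogeneous (r : R) : algebraMap R (CDPoly R) r ∈ homogeneous R 0 := by
  intro m
  induction m using FreeMonoid.casesOn with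
  | one => intro h; exact absurd rfl h
  | of_mul x m => intro _; exact coeff_algebraMap_of_mul r x m

theorem var_mul_mem_homogeneous {n : ℕ} (x : CDLetter) {p : CDPoly R} (hp : p ∈ homogeneous R n) :
    var R x * p ∈ homogeneous R (x.deg + n) := by
  intro m
  induction m using FreeMonoid.casesOn with
  | one => intro _; exact coeff_var_mul_one x p
  | of_mul y m =>
    intro h
    by_cases hxy : x = y
    · subst hxy
      rw [coeff_var_mul_self]
      refine hp m ?_
      rw [wordDeg_of_mul] at h
      omega
    · exact coeff_var_mul_ne hxy p m

theorem mem_homogeneous_zero_iff {p : CDPoly R} :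
    p ∈ homogeneous R 0 ↔ ∃ r, p = algebraMap R _ r := by
  constructor
  · intro h
    obtain ⟨r, X, Y, rfl⟩ := exists_eq_letters p
    refine ⟨r, ?_⟩
    have hX : X = 0 := by
      ext m
      rw [← coeff_letters_c_mul r X Y]
      exact h _ (by simp [wordDeg_of_mul, CDLetter.deg])
    have hY : Y = 0 := by
      ext m
      rw [← coeff_letters_d_mul r X Y]
      exact h _ (by simp [wordDeg_of_mul, CDLetter.deg])
    simp [hX, hY]
  · rintro ⟨r, rfl⟩
    exact algebraMap_mem_homogeneous r

theorem exists_of_mem_homogeneous_one {p : CDPoly R} (h : p ∈ homogeneous R 1) :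
    ∃ r, p = var R .c * algebraMap R _ r := by
  obtain ⟨r, X, Y, rfl⟩ := exists_eq_letters p
  have hr : r = 0 := by
    rw [← coeff_letters_one r X Y]
    exact h _ (by simp [wordDeg_one])
  have hX : X ∈ homogeneous R 0 := by
    intro m hm
    rw [← coeff_letters_c_mul r X Y]
    exact h _ (by rw [wordDeg_of_mul]; simp [CDLetter.deg, hm])
  have hY : Y = 0 := by
    ext m
    rw [← coeff_letters_d_mul r X Y]
    exact h _ (by simp [wordDeg_of_mul, CDLetter.deg]; omega)
  obtain ⟨s, rfl⟩ := mem_homogeneous_zero_iff.1 hX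
  exact ⟨s, by simp [hr, hY]⟩

theorem exists_of_mem_homogeneous_add_two {n : ℕ} {p : CDPoly R} (h : p ∈ homogeneous R (n + 2)) :
    ∃ X ∈ homogeneous R (n + 1), ∃ Y ∈ homogeneous R n, p = var R .c * X + var R .d * Y := by
  obtain ⟨r, X, Y, rfl⟩ := exists_eq_letters p
  have hr : r = 0 := by
    rw [← coeff_letters_one r X Y]
    exact h _ (by simp [wordDeg_one])
  refine ⟨X, ?_, Y, ?_, by simp [hr]⟩
  · intro m hm
    rw [← coeff_letters_c_mul r X Y]
    exact h _ (by rw [wordDeg_of_mul]; simp only [CDLetter.deg]; omega)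
  · intro m hm
    rw [← coeff_letters_d_mul r X Y]
    exact h _ (by rw [wordDeg_of_mul]; simp only [CDLetter.deg]; omega)

end CDPoly

/-! ### Change of coefficients -/

section ChangeOfCoefficients

variable {R S : Type*} [CommRing R] [CommRing S] (f : R →+* S)

theorem mapRingHom_var {α : Type*} (x : α) :
    MonoidAlgebra.mapRingHom (FreeMonoid α) f (MonoidAlgebra.of R _ (FreeMonoid.of x)) =
      MonoidAlgebra.of S _ (FreeMonoid.of x) := by
  simp

theorem ABPoly.mapRingHom_var (x : ABLetter) :
    MonoidAlgebra.mapRingHom _ f (ABPoly.var R x) = ABPoly.var S x :=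
  _root_.mapRingHom_var f x

theorem CDPoly.mapRingHom_var (x : CDLetter) :
    MonoidAlgebra.mapRingHom _ f (CDPoly.var R x) = CDPoly.var S x :=
  _root_.mapRingHom_var f x

theorem CDPoly.toAB_mapRingHom (Φ : CDPoly R) :
    CDPoly.toAB S (MonoidAlgebra.mapRingHom _ f Φ) =
      MonoidAlgebra.mapRingHom _ f (CDPoly.toAB R Φ) := by
  induction Φ using CDPoly.letter_induction with
  | one => simp only [map_one]
  | var_mul x Φ h =>
    rw [map_mul, map_mul, map_mul, map_mul, h, CDPoly.mapRingHom_var, CDPoly.toAB_var,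
      CDPoly.toAB_var]
    cases x <;> simp only [CDLetter.toAB, map_add, map_mul, ABPoly.mapRingHom_var]
  | add Φ Ψ h h' => rw [map_add, map_add, map_add, map_add, h, h']
  | smul r Φ h =>
    rw [Algebra.smul_def, map_mul, map_mul, map_mul, map_mul, h]
    congr 1
    simp [MonoidAlgebra.coe_algebraMap, CDPoly.toAB, MonoidAlgebra.lift_single,
      Algebra.smul_def]

/-- A polynomial in `a, b` with integer coefficients that can be written in terms of `c, d` with
rational coefficients can be written so with integer coefficients. -/
theorem CDPoly.mem_range_toAB_int {p : ABPoly ℤ}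
    (h : MonoidAlgebra.mapRingHom _ (Int.castRingHom ℚ) p ∈ (CDPoly.toAB ℚ).range) :
    p ∈ (CDPoly.toAB ℤ).range := by
  obtain ⟨Φ, hΦ⟩ := h
  have hint : ∀ m, Φ.coeff m ∈ (Int.castAddHom ℚ).range := by
    -- The additive condition transferred here is integrality, the same in every degree.
    refine CDPoly.coeff_mem_of_coeff_toAB_mem (fun _ => (Int.castAddHom ℚ).range) Φ ?_
    intro v
    change (CDPoly.toAB ℚ Φ) = _ at hΦ
    rw [hΦ]
    exact ⟨p.coeff v, by simp⟩
  have hmem : Φ ∈ Set.range (MonoidAlgebra.map (Int.castAddHom ℚ)) := by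
    rw [MonoidAlgebra.range_map]
    exact hint
  obtain ⟨Φ', rfl⟩ := hmem
  refine ⟨Φ', ?_⟩
  refine MonoidAlgebra.map_injective (Int.castAddHom ℚ) Int.cast_injective ?_
  exact (CDPoly.toAB_mapRingHom (Int.castRingHom ℚ) Φ').symm.trans hΦ

theorem CDPoly.mapRingHom_mem_range_toAB {p : ABPoly R} (h : p ∈ (CDPoly.toAB R).range) :
    MonoidAlgebra.mapRingHom _ f p ∈ (CDPoly.toAB S).range := by
  obtain ⟨Φ, rfl⟩ := h
  exact ⟨MonoidAlgebra.mapRingHom _ f Φ, CDPoly.toAB_mapRingHom f Φ⟩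

end ChangeOfCoefficients

/-! ### The pyramid operation -/

/-- Exchange of `a` and `b`. -/
def ABLetter.swap : ABLetter → ABLetter
  | .a => .b
  | .b => .a

namespace ABPoly

variable (R : Type*) [CommRing R]

/-- The pyramid operation on a word in `a, b`. -/
noncomputable def pyrWord : List ABLetter → ABPoly R
  | [] => var R .a + var R .b
  | x :: l => var R x * pyrWord l +
      var R x.swap * MonoidAlgebra.of R _ (FreeMonoid.ofList (x :: l))

/-- The pyramid operation on polynomials in `a, b`. -/
noncomputable def pyr : ABPoly R →ₗ[R] ABPoly R :=
  Finsupp.linearCombination R (fun w : FreeMonoid ABLetter => pyrWord R w.toList) ∘ₗ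
    (MonoidAlgebra.coeffLinearEquiv R).toLinearMap

variable {R}

theorem pyr_of (w : FreeMonoid ABLetter) :
    pyr R (MonoidAlgebra.of R _ w) = pyrWord R w.toList := by
  simp [pyr, MonoidAlgebra.coeffLinearEquiv]

theorem pyr_one : pyr R 1 = var R .a + var R .b := by
  rw [← map_one (MonoidAlgebra.of R (FreeMonoid ABLetter)), pyr_of]
  rfl

/-- On a word, `pyr` inserts before one letter its exchanged letter, or appends `a + b`, and sums
over all choices; here the first letter is singled out. -/
theorem pyr_var_mul (x : ABLetter) (f : ABPoly R) :
    pyr R (var R x * f) = var R x * pyr R f + var R x.swap * (var R x * f) := by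
  induction f using MonoidAlgebra.induction_on with
  | of w =>
    rw [pyr_of, var, ← map_mul, pyr_of]
    rfl
  | add f g hf hg => simp only [mul_add, map_add, hf, hg]; abel
  | smul r f hf => simp only [mul_smul_comm, map_smul, hf, smul_add]

/-- The difference `a - b`. -/
noncomputable def e (R : Type*) [CommRing R] : ABPoly R := var R .a - var R .b

/-- The operator `f ↦ pyr f - b f` commutes with left multiplication by `e = a - b`. -/
theorem pyr_e_pow_mul (k : ℕ) (f : ABPoly R) :
    pyr R (e R ^ k * f) = var R .b * (e R ^ k * f) + e R ^ k * (pyr R f - var R .b * f) := by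
  induction k with
  | zero => simp
  | succ k ih =>
    rw [pow_succ', mul_assoc]
    have : ∀ g, pyr R (e R * g) =
        var R .b * (e R * g) + e R * (pyr R g - var R .b * g) := by
      intro g
      rw [e, sub_mul, map_sub, pyr_var_mul, pyr_var_mul]
      simp only [ABLetter.swap]
      noncomm_ring
    rw [this, ih]
    noncomm_ring

theorem pyr_e_pow (k : ℕ) :
    pyr R (e R ^ k) = e R ^ (k + 1) + e R ^ k * var R .b + var R .b * e R ^ k := by
  have := pyr_e_pow_mul (R := R) k 1
  rw [mul_one, pyr_one] at this
  rw [this, pow_succ, e]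
  noncomm_ring

/-- In the product with a two-element chain, the three summands record chains that start with the
raised bottom element, with a raised interior element, or with an unraised interior element. -/
theorem pyr_e_pow_mul_b_mul (k : ℕ) (f : ABPoly R) :
    pyr R (e R ^ k * var R .b * f) =
      var R .b * (e R ^ k * var R .b * f) + e R ^ (k + 1) * var R .b * f +
        e R ^ k * var R .b * pyr R f := by
  rw [mul_assoc, pyr_e_pow_mul, pyr_var_mul, pow_succ, e]
  simp only [ABLetter.swap]
  noncomm_ring

/-- This is why only even powers of `a - b` may survive in the ab-index. -/
theorem e_sq : e R ^ 2 = CDPoly.toAB R (CDPoly.var R .c ^ 2 - 2 * CDPoly.var R .d) := by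
  rw [map_sub, map_pow, map_mul, CDPoly.toAB_var, CDPoly.toAB_var, map_ofNat, CDLetter.toAB,
    CDLetter.toAB, e]
  noncomm_ring

end ABPoly

/-! ### The pyramid operation in `c, d` and the bijection `(X, Y) ↦ pyr X + dY` -/

namespace CDPoly

variable (R : Type*) [CommRing R]

/-- The pyramid operation on a word in `c, d`. -/
noncomputable def pyrWord : List CDLetter → CDPoly R
  | [] => var R .c
  | .c :: l => var R .c * pyrWord l + var R .d * MonoidAlgebra.of R _ (FreeMonoid.ofList l)
  | .d :: l => var R .d * pyrWord l +
      var R .c * MonoidAlgebra.of R _ (FreeMonoid.ofList (.d :: l))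

/-- The pyramid operation on polynomials in `c, d`. -/
noncomputable def pyr : CDPoly R →ₗ[R] CDPoly R :=
  Finsupp.linearCombination R (fun w : FreeMonoid CDLetter => pyrWord R w.toList) ∘ₗ
    (MonoidAlgebra.coeffLinearEquiv R).toLinearMap

variable {R}

theorem pyr_of (w : FreeMonoid CDLetter) :
    pyr R (MonoidAlgebra.of R _ w) = pyrWord R w.toList := by
  simp [pyr, MonoidAlgebra.coeffLinearEquiv]

theorem pyr_one : pyr R 1 = var R .c := by
  rw [← map_one (MonoidAlgebra.of R (FreeMonoid CDLetter)), pyr_of]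
  rfl

theorem pyr_algebraMap (r : R) : pyr R (algebraMap R _ r) = var R .c * algebraMap R _ r := by
  rw [Algebra.algebraMap_eq_smul_one, map_smul, pyr_one, mul_smul_comm, mul_one]

theorem pyr_c_mul (f : CDPoly R) :
    pyr R (var R .c * f) = var R .c * pyr R f + var R .d * f := by
  induction f using MonoidAlgebra.induction_on with
  | of w =>
    rw [pyr_of, var, ← map_mul, pyr_of]
    rfl
  | add f g hf hg => simp only [mul_add, map_add, hf, hg]; abel
  | smul r f hf => simp only [mul_smul_comm, map_smul, hf, smul_add]

theorem pyr_d_mul (f : CDPoly R) :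
    pyr R (var R .d * f) = var R .d * pyr R f + var R .c * (var R .d * f) := by
  induction f using MonoidAlgebra.induction_on with
  | of w =>
    rw [pyr_of, var, ← map_mul, pyr_of]
    rfl
  | add f g hf hg => simp only [mul_add, map_add, hf, hg]; abel
  | smul r f hf => simp only [mul_smul_comm, map_smul, hf, smul_add]

theorem toAB_pyr (Φ : CDPoly R) : toAB R (pyr R Φ) = ABPoly.pyr R (toAB R Φ) := by
  induction Φ using letter_induction with
  | one => rw [pyr_one, map_one, ABPoly.pyr_one, toAB_var]; rfl
  | var_mul x Φ h =>
    cases x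
    · rw [pyr_c_mul, map_add, map_mul, map_mul, map_mul, h, toAB_var, toAB_var]
      simp only [CDLetter.toAB, add_mul, map_add, ABPoly.pyr_var_mul, mul_assoc, ABLetter.swap]
      abel
    · rw [pyr_d_mul, map_add, map_mul, map_mul, map_mul, h, toAB_var, toAB_var]
      simp only [CDLetter.toAB, add_mul, mul_add, map_add, ABPoly.pyr_var_mul, mul_assoc,
        ABLetter.swap]
      abel
  | add Φ Ψ h h' => simp only [map_add, h, h']
  | smul r Φ h => simp only [map_smul, h]

/-- The `c`-part contains `pyr X + dY` again. This self-similarity drives the inductions for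
injectivity and surjectivity. -/
theorem pyr_letters (r : R) (X Y : CDPoly R) :
    pyr R (algebraMap R _ r + var R .c * X + var R .d * Y) =
      algebraMap R _ 0 + var R .c * (algebraMap R _ r + (pyr R X + var R .d * Y)) +
        var R .d * (X + pyr R Y) := by
  rw [map_add, map_add, pyr_algebraMap, pyr_c_mul, pyr_d_mul, map_zero]
  noncomm_ring

theorem coeff_pyr_one (X : CDPoly R) : (pyr R X).coeff 1 = 0 := by
  obtain ⟨r, X, Y, rfl⟩ := exists_eq_letters X
  rw [pyr_letters, coeff_letters_one]

theorem letters_inj {r r' : R} {X X' Y Y' : CDPoly R}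
    (h : algebraMap R (CDPoly R) r + var R .c * X + var R .d * Y =
      algebraMap R (CDPoly R) r' + var R .c * X' + var R .d * Y') :
    r = r' ∧ X = X' ∧ Y = Y' := by
  refine ⟨?_, ?_, ?_⟩
  · rw [← coeff_letters_one r X Y, h, coeff_letters_one]
  · ext m
    rw [← coeff_letters_c_mul r X Y, h, coeff_letters_c_mul]
  · ext m
    rw [← coeff_letters_d_mul r X Y, h, coeff_letters_d_mul]

/-- Split `X = r + cX₁ + dX₂`. The `c`-part `r + pyr X₁ + dX₂` is an instance of lower degree once
its constant term gives `r = 0`; then the `d`-part reduces to `Y`. -/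
theorem eq_zero_of_pyr_add_d_mul_eq_zero {X Y : CDPoly R} (h : pyr R X + var R .d * Y = 0) :
    X = 0 ∧ Y = 0 := by
  -- No homogeneity is assumed, so the induction runs on a strict bound for the degrees occurring in
  -- `X`.
  have bound : ∃ N, ∀ m, N ≤ CDLetter.wordDeg m → X.coeff m = 0 := by
    refine ⟨X.coeff.support.sup CDLetter.wordDeg + 1, fun m hm => ?_⟩
    by_contra h
    have := Finset.le_sup (f := CDLetter.wordDeg) (Finsupp.mem_support_iff.2 h)
    omega
  obtain ⟨N, hN⟩ := bound
  induction N generalizing X Y with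
  | zero =>
    have hX : X = 0 := by
      ext m
      exact hN m (Nat.zero_le _)
    subst hX
    refine ⟨rfl, ?_⟩
    ext m
    rw [map_zero, zero_add] at h
    rw [← coeff_var_mul_self .d, h]
    rfl
  | succ N ih =>
    obtain ⟨r, X₁, X₂, rfl⟩ := exists_eq_letters X
    have h' : algebraMap R _ 0 + var R .c * (algebraMap R _ r + (pyr R X₁ + var R .d * X₂)) +
        var R .d * (X₁ + pyr R X₂ + Y) =
          algebraMap R (CDPoly R) 0 + var R .c * 0 + var R .d * 0 := by
      rw [pyr_letters] at h
      rw [mul_add (var R .d), ← add_assoc, h]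
      simp
    obtain ⟨-, h1, h2⟩ := letters_inj h'
    have hr : r = 0 := by
      have h3 := congrArg (fun p : CDPoly R => p.coeff 1) h1
      simp only [MonoidAlgebra.coeff_add, Finsupp.add_apply, coeff_algebraMap_one, coeff_pyr_one,
        coeff_var_mul_one, add_zero] at h3
      exact h3
    subst hr
    rw [map_zero, zero_add] at h1
    obtain ⟨rfl, rfl⟩ := ih h1 fun m hm => by
      rw [← coeff_letters_c_mul 0 X₁ X₂]
      refine hN _ ?_
      rw [wordDeg_of_mul]
      simp only [CDLetter.deg]
      omega
    refine ⟨by simp, ?_⟩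
    simpa using h2

theorem pyr_mem_homogeneous {n : ℕ} {X : CDPoly R} (h : X ∈ homogeneous R n) :
    pyr R X ∈ homogeneous R (n + 1) := by
  induction n using Nat.twoStepInduction generalizing X with
  | zero =>
    obtain ⟨r, rfl⟩ := mem_homogeneous_zero_iff.1 h
    rw [pyr_algebraMap]
    exact var_mul_mem_homogeneous .c h
  | one =>
    obtain ⟨r, rfl⟩ := exists_of_mem_homogeneous_one h
    rw [pyr_c_mul, pyr_algebraMap]
    have h0 := algebraMap_mem_homogeneous r
    exact add_mem (var_mul_mem_homogeneous .c (var_mul_mem_homogeneous .c h0))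
      (var_mul_mem_homogeneous .d h0)
  | more n ih1 ih2 =>
    obtain ⟨X, hX, Y, hY, rfl⟩ := exists_of_mem_homogeneous_add_two h
    rw [map_add, pyr_c_mul, pyr_d_mul]
    have h1 := var_mul_mem_homogeneous .c (ih2 hX)
    have h2 := var_mul_mem_homogeneous .d hX
    have h3 := var_mul_mem_homogeneous .d (ih1 hY)
    have h4 := var_mul_mem_homogeneous .c (var_mul_mem_homogeneous .d hY)
    simp only [CDLetter.deg] at h1 h2 h3 h4
    rw [show 1 + (n + 1 + 1) = n + 2 + 1 by ring] at h1
    rw [show 2 + (n + 1) = n + 2 + 1 by ring] at h2 h3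
    rw [show 1 + (2 + n) = n + 2 + 1 by ring] at h4
    exact add_mem (add_mem h1 h2) (add_mem h3 h4)

/-- For `Z = cZ₁ + dZ₂`, solve `Z₁ = pyr X₁ + dX₂` in lower degree, take `X = cX₁ + dX₂`, and let
`Y` correct the `d`-part. -/
theorem exists_pyr_add_d_mul_eq {n : ℕ} {Z : CDPoly R} (h : Z ∈ homogeneous R (n + 2)) :
    ∃ X ∈ homogeneous R (n + 1), ∃ Y ∈ homogeneous R n, pyr R X + var R .d * Y = Z := by
  induction n generalizing Z with
  | zero =>
    obtain ⟨Z₁, h1, Z₂, h2, rfl⟩ := exists_of_mem_homogeneous_add_two h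
    obtain ⟨r, rfl⟩ := exists_of_mem_homogeneous_one h1
    refine ⟨_, h1, Z₂ - algebraMap R _ r, sub_mem h2 (algebraMap_mem_homogeneous r), ?_⟩
    rw [pyr_c_mul, pyr_algebraMap]
    noncomm_ring
  | succ n ih =>
    obtain ⟨Z₁, h1, Z₂, h2, rfl⟩ := exists_of_mem_homogeneous_add_two h
    obtain ⟨X₁, hX₁, X₂, hX₂, rfl⟩ := ih h1
    refine ⟨var R .c * X₁ + var R .d * X₂, ?_, Z₂ - X₁ - pyr R X₂,
      sub_mem (sub_mem h2 hX₁) (pyr_mem_homogeneous hX₂), ?_⟩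
    · have h3 := var_mul_mem_homogeneous .c hX₁
      have h4 := var_mul_mem_homogeneous .d hX₂
      simp only [CDLetter.deg] at h3 h4
      rw [show 1 + (n + 1) = n + 1 + 1 by ring] at h3
      rw [show 2 + n = n + 1 + 1 by ring] at h4
      exact add_mem h3 h4
    · rw [map_add, pyr_c_mul, pyr_d_mul]
      noncomm_ring

end CDPoly

/-! ### The ab-index of the intervals of a ranked poset, by recursion -/

section Recursion

variable {X : Type*} [PartialOrder X] [LocallyFiniteOrder X]

theorem card_Ioo_lt_of_mem_left {x y z : X} (h : z ∈ Finset.Ioo x y) :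
    (Finset.Ioo z y).card < (Finset.Ioo x y).card := by
  refine Finset.card_lt_card (Finset.ssubset_iff_subset_ne.2 ⟨?_, fun he => ?_⟩)
  · exact Finset.Ioo_subset_Ioo_left (Finset.mem_Ioo.1 h).1.le
  · rw [← he] at h
    exact lt_irrefl _ (Finset.mem_Ioo.1 h).1

theorem card_Ioo_lt_of_mem_right {x y z : X} (h : z ∈ Finset.Ioo x y) :
    (Finset.Ioo x z).card < (Finset.Ioo x y).card := by
  refine Finset.card_lt_card (Finset.ssubset_iff_subset_ne.2 ⟨?_, fun he => ?_⟩)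
  · exact Finset.Ioo_subset_Ioo_right (Finset.mem_Ioo.1 h).2.le
  · rw [← he] at h
    exact lt_irrefl _ (Finset.mem_Ioo.1 h).2

open ABPoly

/-- The ab-index of the interval `[x, y]`, for `x < y`, with respect to the rank function `ρ`, by
recursion on the smallest element of a chain. -/
noncomputable def psi (R : Type*) [CommRing R] (ρ : X → ℕ) (x y : X) : ABPoly R :=
  e R ^ (ρ y - ρ x - 1) + ∑ z ∈ (Finset.Ioo x y).attach,
    e R ^ (ρ z.1 - ρ x - 1) * var R .b * psi R ρ z.1 y
termination_by (Finset.Ioo x y).card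
decreasing_by exact card_Ioo_lt_of_mem_left z.2

variable {R : Type*} [CommRing R] {ρ : X → ℕ}

theorem psi_eq (x y : X) : psi R ρ x y = e R ^ (ρ y - ρ x - 1) + ∑ z ∈ Finset.Ioo x y,
    e R ^ (ρ z - ρ x - 1) * var R .b * psi R ρ z y := by
  rw [psi, Finset.sum_attach (Finset.Ioo x y)
    (fun z => e R ^ (ρ z - ρ x - 1) * var R .b * psi R ρ z y)]

theorem mapRingHom_psi {S : Type*} [CommRing S] (f : R →+* S) (x y : X) :
    MonoidAlgebra.mapRingHom _ f (psi R ρ x y) = psi S ρ x y := by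
  induction hn : (Finset.Ioo x y).card using Nat.strong_induction_on generalizing x with
  | _ n ih =>
  subst hn
  have he : MonoidAlgebra.mapRingHom _ f (e R) = e S := by
    rw [e, map_sub, ABPoly.mapRingHom_var, ABPoly.mapRingHom_var, e]
  rw [psi_eq, psi_eq, map_add, map_pow, he, map_sum]
  congr 1
  refine Finset.sum_congr rfl fun z hz => ?_
  rw [map_mul, map_mul, map_pow, he, ABPoly.mapRingHom_var,
    ih _ (card_Ioo_lt_of_mem_left hz) z rfl]

/-- The rational numbers `κ(x, y)` such that `κ (1 + ζ) = 2 (ζ - 1)` in the incidence algebra. -/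
noncomputable def kappa (x y : X) : ℚ :=
  1 - 1 / 2 * ∑ z ∈ (Finset.Ioo x y).attach, kappa x z.1
termination_by (Finset.Ioo x y).card
decreasing_by exact card_Ioo_lt_of_mem_right z.2

theorem kappa_eq (x y : X) : kappa x y = 1 - 1 / 2 * ∑ z ∈ Finset.Ioo x y, kappa x z := by
  rw [kappa, Finset.sum_attach (Finset.Ioo x y) (fun z => kappa x z)]

/-- Substitute `b = (c - e)/2` and expand each product of `e` with an ab-index once more by the
recursion. The weights `κ` are chosen so that the remaining terms containing `b` cancel. -/
theorem psi_eq_kappa (hρ : StrictMono ρ) (x y : X) :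
    psi ℚ ρ x y = kappa x y • e ℚ ^ (ρ y - ρ x - 1) + ∑ z ∈ Finset.Ioo x y,
      kappa x z • (e ℚ ^ (ρ z - ρ x - 1) * ((1 / 2 : ℚ) • CDLetter.toAB ℚ .c) * psi ℚ ρ z y) := by
  have hswap : ∑ z ∈ Finset.Ioo x y, ∑ w ∈ Finset.Ioo x z,
      kappa x w • (e ℚ ^ (ρ z - ρ x - 1) * var ℚ .b * psi ℚ ρ z y) =
      ∑ w ∈ Finset.Ioo x y, ∑ z ∈ Finset.Ioo w y,
      kappa x w • (e ℚ ^ (ρ z - ρ x - 1) * var ℚ .b * psi ℚ ρ z y) := by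
    refine Finset.sum_comm' fun z w => ?_
    simp only [Finset.mem_Ioo]
    constructor
    · rintro ⟨⟨h1, h2⟩, h3, h4⟩
      exact ⟨⟨h4, h2⟩, h3, h4.trans h2⟩
    · rintro ⟨⟨h1, h2⟩, h3, h4⟩
      exact ⟨⟨h3.trans h1, h2⟩, h3, h1⟩
  have hc : (1 / 2 : ℚ) • CDLetter.toAB ℚ .c = (1 / 2 : ℚ) • e ℚ + var ℚ .b := by
    have h2 : var ℚ .b = (1 / 2 : ℚ) • var ℚ .b + (1 / 2 : ℚ) • var ℚ .b := by
      rw [← add_smul]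
      norm_num
    conv_rhs => rw [h2]
    rw [CDLetter.toAB, e, smul_add, smul_sub]
    abel
  have hE : ∀ z (p : ABPoly ℚ), p = kappa x z • p +
      -- This is the defining recursion of `κ(x, z)` multiplied by `p`; it distributes the original
      -- terms over the resummed ones.
      (1 / 2 : ℚ) • ∑ w ∈ Finset.Ioo x z, kappa x w • p := by
    intro z p
    rw [← Finset.sum_smul, smul_smul, ← add_smul]
    conv_lhs => rw [← one_smul ℚ p]
    congr 1
    rw [kappa_eq x z]
    ring
  have hrec : ∀ w ∈ Finset.Ioo x y, e ℚ ^ (ρ w - ρ x - 1) * e ℚ * psi ℚ ρ w y =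
      e ℚ ^ (ρ y - ρ x - 1) + ∑ z ∈ Finset.Ioo w y,
        e ℚ ^ (ρ z - ρ x - 1) * var ℚ .b * psi ℚ ρ z y := by
    intro w hw
    rw [Finset.mem_Ioo] at hw
    have h1 := hρ hw.1
    rw [psi_eq w y, mul_add, ← pow_succ, ← pow_add, Finset.mul_sum]
    congr 1
    · congr 1
      have h2 := hρ hw.2
      omega
    · refine Finset.sum_congr rfl fun z hz => ?_
      have h2 := hρ (Finset.mem_Ioo.1 hz).1
      rw [← mul_assoc, ← mul_assoc, ← pow_add]
      congr 3
      omega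
  have hsum : ∀ z, kappa x z •
        (e ℚ ^ (ρ z - ρ x - 1) * ((1 / 2 : ℚ) • CDLetter.toAB ℚ .c) * psi ℚ ρ z y) =
      (1 / 2 : ℚ) • (kappa x z • (e ℚ ^ (ρ z - ρ x - 1) * e ℚ * psi ℚ ρ z y)) +
        kappa x z • (e ℚ ^ (ρ z - ρ x - 1) * var ℚ .b * psi ℚ ρ z y) := by
    intro z
    rw [hc, mul_add, add_mul, smul_add, mul_smul_comm, smul_mul_assoc, smul_comm]
  have h1 : ∑ z ∈ Finset.Ioo x y, kappa x z • (e ℚ ^ (ρ z - ρ x - 1) * e ℚ * psi ℚ ρ z y) =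
      ∑ z ∈ Finset.Ioo x y, kappa x z • e ℚ ^ (ρ y - ρ x - 1) +
        ∑ w ∈ Finset.Ioo x y, ∑ z ∈ Finset.Ioo w y,
          kappa x w • (e ℚ ^ (ρ z - ρ x - 1) * var ℚ .b * psi ℚ ρ z y) := by
    rw [← Finset.sum_add_distrib]
    refine Finset.sum_congr rfl fun w hw => ?_
    rw [hrec w hw, smul_add, Finset.smul_sum]
  have h2 : ∑ z ∈ Finset.Ioo x y, e ℚ ^ (ρ z - ρ x - 1) * var ℚ .b * psi ℚ ρ z y =
      ∑ z ∈ Finset.Ioo x y, kappa x z • (e ℚ ^ (ρ z - ρ x - 1) * var ℚ .b * psi ℚ ρ z y) +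
        (1 / 2 : ℚ) • ∑ z ∈ Finset.Ioo x y, ∑ w ∈ Finset.Ioo x z,
          kappa x w • (e ℚ ^ (ρ z - ρ x - 1) * var ℚ .b * psi ℚ ρ z y) := by
    rw [Finset.smul_sum, ← Finset.sum_add_distrib]
    exact Finset.sum_congr rfl fun z _ => hE z _
  rw [Finset.sum_congr rfl fun z _ => hsum z, Finset.sum_add_distrib, ← Finset.smul_sum, h1,
    psi_eq x y, h2, hswap]
  conv_lhs => rw [hE y (e ℚ ^ (ρ y - ρ x - 1))]
  rw [smul_add]
  abel

theorem neg_one_pow_sub_mul {m n k : ℕ} (h : m ≤ n) (h' : n ≤ k) :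
    (-1 : ℚ) ^ (n - m) * (-1) ^ (k - n) = (-1) ^ (k - m) := by
  rw [← pow_add]
  congr 1
  omega

/-- In an Eulerian poset, `κ(x, y)` vanishes for intervals of even rank. -/
theorem kappa_eq_zero (hρ : StrictMono ρ)
    (hE : ∀ x y : X, x < y → ∑ z ∈ Finset.Icc x y, (-1 : ℤ) ^ ρ z = 0) {x y : X} (hxy : x < y)
    (heven : Even (ρ y - ρ x)) : kappa x y = 0 := by
  classical
  let Z : IncidenceAlgebra ℚ X := ⟨fun x y => if x < y then 1 else 0,
    fun x y h => if_neg fun h' => h h'.le⟩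
  let Z' : IncidenceAlgebra ℚ X := ⟨fun x y => if x < y then (-1) ^ (ρ y - ρ x) else 0,
    fun x y h => if_neg fun h' => h h'.le⟩
  let K : IncidenceAlgebra ℚ X := ⟨fun x y => if x < y then kappa x y else 0,
    fun x y h => if_neg fun h' => h h'.le⟩
  have sum_Icc : ∀ {x y : X} (_ : x < y) (f : X → ℚ),
      ∑ z ∈ Finset.Icc x y, f z = f x + f y + ∑ z ∈ Finset.Ioo x y, f z := by
    intro x y h f
    rw [← Finset.Ico_insert_right h.le, Finset.sum_insert Finset.right_notMem_Ico,
      ← Finset.Ioo_insert_left h, Finset.sum_insert Finset.left_notMem_Ioo]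
    ring
  have conv : ∀ (F G : IncidenceAlgebra ℚ X) (f g : X → X → ℚ),
      (∀ x y, F x y = if x < y then f x y else 0) → (∀ x y, G x y = if x < y then g x y else 0) →
      ∀ {x y : X}, x < y → (F * G) x y = ∑ z ∈ Finset.Ioo x y, f x z * g z y := by
    intro F G f g hF hG x y h
    rw [IncidenceAlgebra.mul_apply, sum_Icc h, hF x x, hG y y, if_neg (lt_irrefl _),
      if_neg (lt_irrefl _), zero_mul, mul_zero, zero_add, zero_add]
    refine Finset.sum_congr rfl fun z hz => ?_
    rw [hF, hG, if_pos (Finset.mem_Ioo.1 hz).1, if_pos (Finset.mem_Ioo.1 hz).2]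
  have convxx : ∀ (F G : IncidenceAlgebra ℚ X) (x : X), F x x = 0 → (F * G) x x = 0 := by
    intro F G x h
    rw [IncidenceAlgebra.mul_apply, Finset.Icc_self, Finset.sum_singleton, h, zero_mul]
  have hZ : ∀ x y, Z x y = if x < y then (1 : X → X → ℚ) x y else 0 := fun _ _ => rfl
  have hZ' : ∀ x y, Z' x y = if x < y then (fun x y => (-1 : ℚ) ^ (ρ y - ρ x)) x y else 0 :=
    fun _ _ => rfl
  have hK : ∀ x y, K x y = if x < y then kappa x y else 0 := fun _ _ => rfl
  -- Here `1 + Z` is the zeta function, and the identity says `K = 2Z/(2 + Z)`.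
  have hKZ : K + (1 / 2 : ℚ) • (K * Z) = Z := by
    ext x y h
    rcases h.eq_or_lt with rfl | h
    · rw [IncidenceAlgebra.add_apply, IncidenceAlgebra.constSMul_apply, convxx _ _ _ (by simp [hK])]
      simp [hK, hZ]
    · rw [IncidenceAlgebra.add_apply, IncidenceAlgebra.constSMul_apply, conv K Z _ _ hK hZ h, hK,
        hZ, if_pos h, if_pos h, kappa_eq]
      simp
  -- The Eulerian condition: `(1 + Z)(1 + Z') = 1`, so the sign-twisted zeta function is a right
  -- inverse of zeta.
  have hZZ : Z + Z' + Z * Z' = 0 := by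
    ext x y h
    rcases h.eq_or_lt with rfl | h
    · rw [IncidenceAlgebra.add_apply, IncidenceAlgebra.add_apply, convxx _ _ _ (by simp [hZ])]
      simp [hZ, hZ']
    · rw [IncidenceAlgebra.add_apply, IncidenceAlgebra.add_apply, conv Z Z' _ _ hZ hZ' h, hZ, hZ',
        if_pos h, if_pos h]
      have h0 : ∑ z ∈ Finset.Icc x y, (-1 : ℚ) ^ ρ z = 0 := by exact_mod_cast hE x y h
      have h1 : ∑ z ∈ Finset.Icc x y, (-1 : ℚ) ^ (ρ y - ρ z) = 0 := by
        have : ∀ z ∈ Finset.Icc x y, (-1 : ℚ) ^ (ρ y - ρ z) = (-1) ^ ρ y * (-1) ^ ρ z := by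
          intro z hz
          have hle := hρ.monotone (Finset.mem_Icc.1 hz).2
          rw [← pow_add, show ρ y + ρ z = (ρ y - ρ z) + 2 * ρ z by omega, pow_add, pow_mul]
          simp
        rw [Finset.sum_congr rfl this, ← Finset.mul_sum, h0, mul_zero]
      rw [sum_Icc h, Nat.sub_self, pow_zero] at h1
      simp only [Pi.one_apply, one_mul, IncidenceAlgebra.zero_apply]
      linarith
  -- Multiplying by `1 + Z'` shows that `-K` satisfies the equation of `K` with zeta replaced by its
  -- inverse.
  have hKZ' : K + (1 / 2 : ℚ) • (K * Z') = -Z' := by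
    have h1 : (K + (1 / 2 : ℚ) • (K * Z)) * (1 + Z') = Z * (1 + Z') := by rw [hKZ]
    have h2 : Z * (1 + Z') = -Z' := by
      rw [mul_add, mul_one, eq_neg_iff_add_eq_zero, ← hZZ]
      abel
    have h3 : (K + (1 / 2 : ℚ) • (K * Z)) * (1 + Z') =
        K + K * Z' + (1 / 2 : ℚ) • (K * (Z * (1 + Z'))) := by
      rw [add_mul, mul_add, mul_one, smul_mul_assoc, mul_assoc]
    rw [← h2, ← h1, h3, h2, mul_neg, smul_neg, add_assoc]
    congr 1
    rw [← sub_eq_add_neg, eq_sub_iff_add_eq, ← add_smul]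
    norm_num
  have hbar : ∀ {x y : X}, x < y → (-1) ^ (ρ y - ρ x) * kappa x y + 1 / 2 *
      ∑ z ∈ Finset.Ioo x y, ((-1) ^ (ρ z - ρ x) * kappa x z) * (-1) ^ (ρ y - ρ z) =
        (-1) ^ (ρ y - ρ x) := by
    intro x y h
    have : ∀ z ∈ Finset.Ioo x y, ((-1) ^ (ρ z - ρ x) * kappa x z) * (-1) ^ (ρ y - ρ z) =
        (-1) ^ (ρ y - ρ x) * kappa x z := by
      intro z hz
      rw [Finset.mem_Ioo] at hz
      rw [mul_right_comm, neg_one_pow_sub_mul (hρ hz.1).le (hρ hz.2).le]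
    rw [Finset.sum_congr rfl this, ← Finset.mul_sum, kappa_eq x y]
    ring
  have hsum : ∀ {x y : X}, x < y → kappa x y + 1 / 2 *
      ∑ z ∈ Finset.Ioo x y, kappa x z * (-1) ^ (ρ y - ρ z) = -(-1) ^ (ρ y - ρ x) := by
    intro x y h
    have := congrArg (fun F : IncidenceAlgebra ℚ X => F x y) hKZ'
    simp only [IncidenceAlgebra.add_apply, IncidenceAlgebra.constSMul_apply,
      IncidenceAlgebra.neg_apply, conv K Z' _ _ hK hZ' h] at this
    rw [hK, hZ', if_pos h, if_pos h, smul_eq_mul] at this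
    exact this
  -- The sign twist of `K` also satisfies the equation of `-K`. Their difference solves a
  -- homogeneous recursion, hence is zero.
  have hodd : ∀ n, ∀ {x y : X}, x < y → (Finset.Ioo x y).card = n →
      (-1) ^ (ρ y - ρ x) * kappa x y + kappa x y = 0 := by
    intro n
    induction n using Nat.strong_induction_on with
    | _ n ih =>
    rintro x y h rfl
    have h1 := hbar h
    have h2 := hsum h
    have h3 : ∑ z ∈ Finset.Ioo x y, ((-1) ^ (ρ z - ρ x) * kappa x z) * (-1) ^ (ρ y - ρ z) +
        ∑ z ∈ Finset.Ioo x y, kappa x z * (-1) ^ (ρ y - ρ z) = 0 := by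
      rw [← Finset.sum_add_distrib]
      refine Finset.sum_eq_zero fun z hz => ?_
      rw [← add_mul, ih _ (card_Ioo_lt_of_mem_right hz) (Finset.mem_Ioo.1 hz).1 rfl, zero_mul]
    linarith
  have := hodd _ hxy rfl
  rw [heven.neg_one_pow] at this
  linarith

/-- Each term carries `κ e^(r - 1)` for some rank `r`: for even `r` the weight vanishes, for odd `r`
the power is one of `c² - 2d`. The halves force the argument over `ℚ`; it descends to `ℤ` and then
maps to `R`. -/
theorem psi_mem_range_toAB (R : Type*) [CommRing R] (hρ : StrictMono ρ)
    (hE : ∀ x y : X, x < y → ∑ z ∈ Finset.Icc x y, (-1 : ℤ) ^ ρ z = 0) {x y : X} (hxy : x < y) :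
    psi R ρ x y ∈ (CDPoly.toAB R).range := by
  have hterm : ∀ {x y : X}, x < y →
      kappa x y • e ℚ ^ (ρ y - ρ x - 1) ∈ (CDPoly.toAB ℚ).range := by
    intro x y h
    rcases Nat.even_or_odd (ρ y - ρ x) with h' | h'
    · rw [kappa_eq_zero hρ hE h h', zero_smul]
      exact zero_mem _
    · obtain ⟨k, hk⟩ := h'
      rw [show ρ y - ρ x - 1 = 2 * k by omega, pow_mul, e_sq]
      exact Subalgebra.smul_mem _ (pow_mem (AlgHom.mem_range_self _ _) k) _
  have hrat : psi ℚ ρ x y ∈ (CDPoly.toAB ℚ).range := by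
    induction hn : (Finset.Ioo x y).card using Nat.strong_induction_on generalizing x with
    | _ n ih =>
    subst hn
    rw [psi_eq_kappa hρ]
    refine add_mem (hterm hxy) (sum_mem fun z hz => ?_)
    have hz' := Finset.mem_Ioo.1 hz
    rw [mul_assoc, ← smul_mul_assoc]
    refine mul_mem (hterm hz'.1) (mul_mem ?_ (ih _ (card_Ioo_lt_of_mem_left hz) hz'.2 rfl))
    have hc : CDLetter.toAB ℚ .c ∈ (CDPoly.toAB ℚ).range := ⟨_, CDPoly.toAB_var .c⟩
    exact Subalgebra.smul_mem _ hc _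
  rw [← mapRingHom_psi (Int.castRingHom ℚ)] at hrat
  rw [← mapRingHom_psi (Int.castRingHom R)]
  exact CDPoly.mapRingHom_mem_range_toAB _ (CDPoly.mem_range_toAB_int hrat)

end Recursion

/-! ### Isomorphic intervals, pyramids and zippers -/

section Operations

open ABPoly

variable {R : Type*} [CommRing R]
variable {X : Type*} [PartialOrder X] {ρ : X → ℕ}

/-- The rank function of the product of a poset with a chain of two elements. -/
def rankBool (ρ : X → ℕ) (p : X × Bool) : ℕ := ρ p.1 + p.2.toNat

theorem rankBool_strictMono (hρ : StrictMono ρ) : StrictMono (rankBool ρ) := by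
  rintro ⟨x, i⟩ ⟨y, j⟩ h
  simp only [rankBool]
  rw [Prod.mk_lt_mk] at h
  rcases h with ⟨h1, h2⟩ | ⟨h1, h2⟩
  · have h3 := hρ h1
    have h4 : i.toNat ≤ j.toNat := Bool.toNat_le_toNat h2
    omega
  · have h3 := hρ.monotone h1
    have h4 : i.toNat < j.toNat := by revert h2; cases i <;> cases j <;> simp
    omega

variable [LocallyFiniteOrder X]
variable {Y : Type*} [PartialOrder Y] [LocallyFiniteOrder Y] {σ : Y → ℕ}

/-- The recursion sees only the order and rank differences inside the interval. Thus `φ` need be an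
isomorphism only there, and ranks may shift by `k`. -/
theorem psi_map (φ : X → Y) (k : ℕ) {x y : X} (hxy : x ≤ y)
    (hle : ∀ z ∈ Finset.Icc x y, ∀ z' ∈ Finset.Icc x y, φ z ≤ φ z' ↔ z ≤ z')
    (hsurj : ∀ v ∈ Finset.Icc (φ x) (φ y), ∃ z ∈ Finset.Icc x y, φ z = v)
    (hrank : ∀ z ∈ Finset.Icc x y, σ (φ z) = ρ z + k) :
    psi R σ (φ x) (φ y) = psi R ρ x y := by
  classical
  induction hn : (Finset.Ioo x y).card using Nat.strong_induction_on generalizing x with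
  | _ n ih =>
  subst hn
  have hx : x ∈ Finset.Icc x y := Finset.left_mem_Icc.2 hxy
  have hy : y ∈ Finset.Icc x y := Finset.right_mem_Icc.2 hxy
  have hlt : ∀ z ∈ Finset.Icc x y, ∀ z' ∈ Finset.Icc x y, φ z < φ z' ↔ z < z' := by
    intro z hz z' hz'
    rw [lt_iff_le_not_ge, lt_iff_le_not_ge, hle z hz z' hz', hle z' hz' z hz]
  have himage : Finset.Ioo (φ x) (φ y) = (Finset.Ioo x y).image φ := by
    ext v
    rw [Finset.mem_image]
    constructor
    · intro hv
      obtain ⟨z, hz, rfl⟩ := hsurj v (Finset.Ioo_subset_Icc_self hv)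
      rw [Finset.mem_Ioo, hlt x hx z hz, hlt z hz y hy] at hv
      exact ⟨z, Finset.mem_Ioo.2 hv, rfl⟩
    · rintro ⟨z, hz, rfl⟩
      have hz' := Finset.Ioo_subset_Icc_self hz
      rw [Finset.mem_Ioo, hlt x hx z hz', hlt z hz' y hy]
      exact Finset.mem_Ioo.1 hz
  rw [psi_eq, psi_eq, himage, Finset.sum_image]
  · rw [hrank x hx, hrank y hy]
    congr 1
    · congr 1
      omega
    · refine Finset.sum_congr rfl fun z hz => ?_
      have hz' := Finset.Ioo_subset_Icc_self hz
      have hz'' := Finset.mem_Icc.1 hz'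
      have hsub : Finset.Icc z y ⊆ Finset.Icc x y := Finset.Icc_subset_Icc_left hz''.1
      rw [hrank z hz', ih _ (card_Ioo_lt_of_mem_left hz) hz''.2
        (fun a ha b hb => hle a (hsub ha) b (hsub hb)) ?_ (fun a ha => hrank a (hsub ha)) rfl]
      · congr 3
        omega
      · intro v hv
        rw [Finset.mem_Icc] at hv
        obtain ⟨a, ha, rfl⟩ := hsurj v
          (Finset.mem_Icc.2 ⟨((hle x hx z hz').2 hz''.1).trans hv.1, hv.2⟩)
        refine ⟨a, Finset.mem_Icc.2 ⟨(hle z hz' a ha).1 hv.1, (Finset.mem_Icc.1 ha).2⟩, rfl⟩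
  · intro a ha b hb hab
    have ha' := Finset.Ioo_subset_Icc_self ha
    have hb' := Finset.Ioo_subset_Icc_self hb
    exact le_antisymm ((hle a ha' b hb').1 hab.le) ((hle b hb' a ha').1 hab.ge)

variable [LocallyFiniteOrder (X × Bool)]

theorem psi_true_true {x y : X} (hxy : x ≤ y) :
    psi R (rankBool ρ) (x, true) (y, true) = psi R ρ x y := by
  refine psi_map (fun z => (z, true)) 1 hxy ?_ ?_ ?_
  · intro z _ z' _
    simp
  · rintro ⟨v, i⟩ hv
    simp only [Finset.mem_Icc, Prod.mk_le_mk] at hv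
    refine ⟨v, Finset.mem_Icc.2 ⟨hv.1.1, hv.2.1⟩, Prod.ext rfl ?_⟩
    exact (Bool.eq_true_of_true_le hv.1.2).symm
  · intro z _
    simp [rankBool]

/-- The ab-index of the product with a chain of two elements. -/
theorem psi_false_true (hρ : StrictMono ρ) {x y : X} (hxy : x < y) :
    psi R (rankBool ρ) (x, false) (y, true) = pyr R (psi R ρ x y) := by
  classical
  induction hn : (Finset.Ioo x y).card using Nat.strong_induction_on generalizing x with
  | _ n ih =>
  subst hn
  have hxy' := hρ hxy
  have himage : Finset.Ioo ((x, false) : X × Bool) (y, true) =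
      insert (y, false) (insert (x, true) ((Finset.Ioo x y).image (fun z => (z, true)) ∪
        (Finset.Ioo x y).image (fun z => (z, false)))) := by
    ext ⟨z, i⟩
    simp only [Finset.mem_Ioo, Prod.mk_lt_mk, Finset.mem_insert, Finset.mem_union,
      Finset.mem_image, Prod.mk.injEq]
    cases i
    · simp only [Bool.false_lt_true, le_refl, and_true, and_false, lt_self_iff_false, or_false,
        false_or, exists_eq_right, reduceCtorEq, exists_false]
      constructor
      · rintro ⟨h1, h2⟩
        rcases h2 with ⟨h2, -⟩ | h2
        · exact Or.inr ⟨h1, h2⟩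
        · rcases h2.eq_or_lt with rfl | h2
          · exact Or.inl rfl
          · exact Or.inr ⟨h1, h2⟩
      · rintro (rfl | ⟨h1, h2⟩)
        · exact ⟨hxy, Or.inr le_rfl⟩
        · exact ⟨h1, Or.inr h2.le⟩
    · simp only [Bool.false_lt_true, le_refl, and_true, and_false, lt_self_iff_false, or_false,
        false_or, exists_eq_right, reduceCtorEq, exists_false]
      constructor
      · rintro ⟨h1, h2⟩
        rcases h1 with ⟨h1, -⟩ | h1
        · exact Or.inr ⟨h1, h2⟩
        · rcases h1.eq_or_lt with rfl | h1
          · exact Or.inl rfl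
          · exact Or.inr ⟨h1, h2⟩
      · rintro (rfl | ⟨h1, h2⟩)
        · exact ⟨Or.inr le_rfl, hxy⟩
        · exact ⟨Or.inr h1.le, h2⟩
  have hyy : psi R (rankBool ρ) (y, false) (y, true) = 1 := by
    have : Finset.Ioo ((y, false) : X × Bool) (y, true) = ∅ := by
      ext ⟨z, i⟩
      simp only [Finset.mem_Ioo, Prod.mk_lt_mk, Finset.notMem_empty, iff_false]
      rintro ⟨h1, h2⟩
      cases i
      · simp only [le_refl, and_true, lt_self_iff_false, and_false, or_false,
          Bool.false_lt_true] at h1 h2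
        rcases h2 with h2 | h2
        · exact lt_asymm h1 h2.1
        · exact h1.not_ge h2
      · simp only [le_refl, and_true, lt_self_iff_false, and_false, or_false,
          Bool.false_lt_true] at h1 h2
        rcases h1 with h1 | h1
        · exact lt_asymm h1.1 h2
        · exact h2.not_ge h1
    rw [psi_eq, this, Finset.sum_empty, add_zero]
    simp [rankBool]
  rw [psi_eq, himage, Finset.sum_insert, Finset.sum_insert, Finset.sum_union, Finset.sum_image,
    Finset.sum_image, hyy, psi_true_true hxy.le]
  · simp only [rankBool, Bool.toNat_false, Bool.toNat_true, add_zero]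
    -- The four kinds of first chain element, and the empty chain, match the summands of the pyramid
    -- formulas for `e^k` and `e^k b f`.
    rw [psi_eq x y, map_add, map_sum, pyr_e_pow]
    have h1 : ∑ z ∈ Finset.Ioo x y, e R ^ (ρ z + 1 - ρ x - 1) * var R .b *
        psi R (rankBool ρ) (z, true) (y, true) =
        ∑ z ∈ Finset.Ioo x y, e R ^ (ρ z - ρ x - 1 + 1) * var R .b * psi R ρ z y := by
      refine Finset.sum_congr rfl fun z hz => ?_
      rw [Finset.mem_Ioo] at hz
      have := hρ hz.1
      rw [psi_true_true hz.2.le, show ρ z + 1 - ρ x - 1 = ρ z - ρ x - 1 + 1 by omega]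
    have h2 : ∑ z ∈ Finset.Ioo x y, e R ^ (ρ z - ρ x - 1) * var R .b *
        psi R (rankBool ρ) (z, false) (y, true) =
        ∑ z ∈ Finset.Ioo x y, e R ^ (ρ z - ρ x - 1) * var R .b * pyr R (psi R ρ z y) := by
      refine Finset.sum_congr rfl fun z hz => ?_
      rw [ih _ (card_Ioo_lt_of_mem_left hz) (Finset.mem_Ioo.1 hz).2 rfl]
    simp only [pyr_e_pow_mul_b_mul]
    rw [h1, h2, Finset.sum_add_distrib, Finset.sum_add_distrib, ← Finset.mul_sum,
      show ρ y + 1 - ρ x - 1 = ρ y - ρ x - 1 + 1 by omega,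
      show ρ x + 1 - ρ x - 1 = 0 by omega, pow_zero, one_mul, mul_one, mul_add]
    abel
  · intro a _ b _ h
    exact (Prod.mk.inj h).1
  · intro a _ b _ h
    exact (Prod.mk.inj h).1
  · rw [Finset.disjoint_left]
    intro p hp hp'
    obtain ⟨a, -, rfl⟩ := Finset.mem_image.1 hp
    obtain ⟨b, -, hb⟩ := Finset.mem_image.1 hp'
    simp at hb
  · simp
  · simp [hxy.ne']

end Operations

/-! ### Zipping two atoms and their join -/

section Zipper

open ABPoly

variable {R : Type*} [CommRing R]
variable {X : Type*} [PartialOrder X] [LocallyFiniteOrder X] {ρ : X → ℕ}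
variable {Y : Type*} [PartialOrder Y] [LocallyFiniteOrder Y] {σ : Y → ℕ}

/-- Zipping: identifying the elements `x`, `y` of rank `1` above `o` with their join `z`, which
covers only `x` and `y`, lowers the ab-index of `[o, t]` by `d` times the ab-index of `[z, t]`. -/
theorem psi_zip (φ : X → Y) {o x y z t : X} {s : Y} {A : Finset X}
    (hA : ∀ a, a ∈ A ↔ (o < a ∧ a < t) ∧ a ≠ x ∧ a ≠ y ∧ a ≠ z) (hxy : x ≠ y)
    (hox : o < x) (hoy : o < y) (hxz : x < z) (hyz : y < z) (hzt : z < t)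
    (hz : ∀ a, x < a → y < a → z ≤ a)
    (hox' : ρ x = ρ o + 1) (hoy' : ρ y = ρ o + 1) (hoz' : ρ z = ρ o + 2) (hρ : StrictMono ρ)
    (hinj : Set.InjOn φ A) (hs : ∀ a ∈ A, φ a ≠ s)
    (hIoo : ∀ v, φ o < v ∧ v < φ t ↔ v = s ∨ ∃ a ∈ A, φ a = v)
    (hIoos : ∀ v, s < v ∧ v < φ t ↔ ∃ a ∈ A, (x < a ∨ y < a) ∧ φ a = v)
    (hpsi : ∀ a ∈ A, psi R σ (φ a) (φ t) = psi R ρ a t)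
    (hσA : ∀ a ∈ A, σ (φ a) = ρ a) (hσo : σ (φ o) = ρ o) (hσt : σ (φ t) = ρ t)
    (hσs : σ s = ρ o + 1) :
    psi R σ (φ o) (φ t) = psi R ρ o t - CDLetter.toAB R .d * psi R ρ z t := by
  classical
  have hρt := hρ hzt
  have hxA : x ∉ A := fun h => ((hA x).1 h).2.1 rfl
  have hyA : y ∉ A := fun h => ((hA y).1 h).2.2.1 rfl
  have hzA : z ∉ A := fun h => ((hA z).1 h).2.2.2 rfl
  have hxy' : ¬ x < y := fun h => by have := hρ h; omega
  have hyx' : ¬ y < x := fun h => by have := hρ h; omega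
  have hIo : Finset.Ioo o t = insert x (insert y (insert z A)) := by
    ext a
    simp only [Finset.mem_Ioo, Finset.mem_insert, hA]
    constructor
    · intro h
      tauto
    · rintro (rfl | rfl | rfl | h)
      · exact ⟨hox, hxz.trans hzt⟩
      · exact ⟨hoy, hyz.trans hzt⟩
      · exact ⟨hox.trans hxz, hzt⟩
      · exact h.1
  have hIx : Finset.Ioo x t = insert z (A.filter (x < ·)) := by
    ext a
    simp only [Finset.mem_Ioo, Finset.mem_insert, Finset.mem_filter, hA]
    constructor
    · rintro ⟨h1, h2⟩
      by_cases ha : a = z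
      · exact Or.inl ha
      · refine Or.inr ⟨⟨⟨hox.trans h1, h2⟩, h1.ne', ?_, ha⟩, h1⟩
        rintro rfl
        exact hxy' h1
    · rintro (rfl | h)
      · exact ⟨hxz, hzt⟩
      · exact ⟨h.2, h.1.1.2⟩
  have hIy : Finset.Ioo y t = insert z (A.filter (y < ·)) := by
    ext a
    simp only [Finset.mem_Ioo, Finset.mem_insert, Finset.mem_filter, hA]
    constructor
    · rintro ⟨h1, h2⟩
      by_cases ha : a = z
      · exact Or.inl ha
      · refine Or.inr ⟨⟨⟨hoy.trans h1, h2⟩, ?_, h1.ne', ha⟩, h1⟩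
        rintro rfl
        exact hyx' h1
    · rintro (rfl | h)
      · exact ⟨hyz, hzt⟩
      · exact ⟨h.2, h.1.1.2⟩
  have hIz : Finset.Ioo z t = A.filter (x < ·) ∩ A.filter (y < ·) := by
    ext a
    simp only [Finset.mem_Ioo, Finset.mem_inter, Finset.mem_filter, hA]
    constructor
    · rintro ⟨h1, h2⟩
      have h3 := hxz.trans h1
      have h4 := hyz.trans h1
      have h5 : (o < a ∧ a < t) ∧ a ≠ x ∧ a ≠ y ∧ a ≠ z :=
        ⟨⟨hox.trans h3, h2⟩, h3.ne', h4.ne', h1.ne'⟩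
      exact ⟨⟨h5, h3⟩, h5, h4⟩
    · rintro ⟨⟨h1, h2⟩, -, h3⟩
      exact ⟨lt_of_le_of_ne (hz a h2 h3) h1.2.2.2.symm, h1.1.2⟩
  have hJo : Finset.Ioo (φ o) (φ t) = insert s (A.image φ) := by
    ext v
    simp only [Finset.mem_Ioo, Finset.mem_insert, Finset.mem_image, hIoo]
  have hJs : Finset.Ioo s (φ t) = (A.filter (x < ·) ∪ A.filter (y < ·)).image φ := by
    ext v
    rw [Finset.mem_Ioo, hIoos, Finset.mem_image]
    refine exists_congr fun a => ?_
    rw [Finset.mem_union, Finset.mem_filter, Finset.mem_filter]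
    tauto
  have hAρ : ∀ a ∈ A, ρ o < ρ a := fun a ha => hρ ((hA a).1 ha).1.1
  -- The contribution of `a` as least chain element: `k = 0` for chains above `o`, `k = 1` for
  -- chains above an element one rank higher, that is `x`, `y` or `s`.
  set g : ℕ → X → ABPoly R := fun k a => e R ^ (ρ a - ρ o - 1 - k) * var R .b * psi R ρ a t with hg
  have eo : psi R ρ o t = e R ^ (ρ t - ρ o - 1) + (var R .b * psi R ρ x t +
      (var R .b * psi R ρ y t + (e R * var R .b * psi R ρ z t + ∑ a ∈ A, g 0 a))) := by
    rw [psi_eq o t, hIo, Finset.sum_insert (by simp [hxy, hxz.ne, hxA]),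
      Finset.sum_insert (by simp [hyz.ne, hyA]), Finset.sum_insert hzA, hox', hoy', hoz',
      show ρ o + 1 - ρ o - 1 = 0 by omega, show ρ o + 2 - ρ o - 1 = 1 by omega, pow_zero, one_mul,
      pow_one]
    rfl
  have ex : psi R ρ x t = e R ^ (ρ t - ρ o - 2) + (var R .b * psi R ρ z t +
      ∑ a ∈ A.filter (x < ·), g 1 a) := by
    rw [psi_eq x t, hIx, Finset.sum_insert (by simp [hzA]), hox', hoz',
      show ρ o + 2 - (ρ o + 1) - 1 = 0 by omega, pow_zero, one_mul]
    congr 2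
  have ey : psi R ρ y t = e R ^ (ρ t - ρ o - 2) + (var R .b * psi R ρ z t +
      ∑ a ∈ A.filter (y < ·), g 1 a) := by
    rw [psi_eq y t, hIy, Finset.sum_insert (by simp [hzA]), hoy', hoz',
      show ρ o + 2 - (ρ o + 1) - 1 = 0 by omega, pow_zero, one_mul]
    congr 2
  -- The factor `e` shifts the recursion at `z` down to the level of `x` and `y`; the elements above
  -- `z` are those above both.
  have ez : e R * psi R ρ z t = e R ^ (ρ t - ρ o - 2) +
      ∑ a ∈ A.filter (x < ·) ∩ A.filter (y < ·), g 1 a := by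
    rw [psi_eq z t, ← hIz, mul_add, Finset.mul_sum, ← pow_succ', hoz']
    congr 1
    · congr 1
      omega
    · refine Finset.sum_congr rfl fun a ha => ?_
      have := hρ (Finset.mem_Ioo.1 ha).1
      simp only [hg]
      rw [← mul_assoc, ← mul_assoc, ← pow_succ']
      congr 3
      omega
  have fo : psi R σ (φ o) (φ t) = e R ^ (ρ t - ρ o - 1) + (var R .b * psi R σ s (φ t) +
      ∑ a ∈ A, g 0 a) := by
    rw [psi_eq (φ o) (φ t), hJo, Finset.sum_insert (by simpa using hs), Finset.sum_image hinj, hσs,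
      hσo, hσt, show ρ o + 1 - ρ o - 1 = 0 by omega, pow_zero, one_mul]
    congr 2
    refine Finset.sum_congr rfl fun a ha => ?_
    rw [hσA a ha, hpsi a ha]
    rfl
  have fs : psi R σ s (φ t) = e R ^ (ρ t - ρ o - 2) +
      ∑ a ∈ A.filter (x < ·) ∪ A.filter (y < ·), g 1 a := by
    have hsub : A.filter (x < ·) ∪ A.filter (y < ·) ⊆ A :=
      Finset.union_subset (Finset.filter_subset _ _) (Finset.filter_subset _ _)
    rw [psi_eq s (φ t), hJs, Finset.sum_image (hinj.mono hsub), hσs, hσt]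
    congr 1
    refine Finset.sum_congr rfl fun a ha => ?_
    rw [hσA a (hsub ha), hpsi a (hsub ha)]
    rfl
  -- In the zipped poset `s` lies below everything above `x` or `y`. Inclusion–exclusion leaves the
  -- sum over the intersection, which is expressed by `e` times the ab-index of `[z, t]`.
  have hun := Finset.sum_union_inter (s₁ := A.filter (x < ·)) (s₂ := A.filter (y < ·)) (f := g 1)
  have hd : CDLetter.toAB R .d = e R * var R .b + var R .b * e R + 2 * (var R .b * var R .b) := by
    rw [CDLetter.toAB, e]
    noncomm_ring
  rw [fo, eo, fs, ex, ey, hd, eq_sub_of_add_eq hun, eq_sub_of_add_eq' ez.symm]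
  noncomm_ring

end Zipper

/-! ### The ab-index as a sum over chains -/

section Weights

variable (R : Type*) [CommRing R]

open ABPoly

open Classical in
/-- The word with letter `b` in the positions that satisfy `p` and `a - b` elsewhere. -/
noncomputable def chainWeight {ι : Type*} (l : List ι) (p : ι → Prop) : ABPoly R :=
  (l.map fun i => if p i then var R .b else e R).prod

variable {R}

theorem chainWeight_congr {ι : Type*} {l : List ι} {p q : ι → Prop} (h : ∀ i ∈ l, p i ↔ q i) :
    chainWeight R l p = chainWeight R l q := by
  rw [chainWeight, chainWeight]
  congr 1
  refine List.map_congr_left fun i hi => ?_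
  by_cases hq : q i
  · rw [if_pos hq, if_pos ((h i hi).2 hq)]
  · rw [if_neg hq, if_neg fun hp => hq ((h i hi).1 hp)]

theorem chainWeight_map {ι κ : Type*} (l : List ι) (f : ι → κ) (p : κ → Prop) :
    chainWeight R (l.map f) p = chainWeight R l (fun i => p (f i)) := by
  simp [chainWeight, Function.comp_def]

theorem chainWeight_eq_pow {ι : Type*} {l : List ι} {p : ι → Prop} (h : ∀ i ∈ l, ¬ p i) :
    chainWeight R l p = e R ^ l.length := by
  rw [chainWeight, List.map_congr_left fun i hi => if_neg (h i hi)]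
  simp

theorem chainWeight_range {k n : ℕ} {p : ℕ → Prop} (h : ∀ i < k, ¬ p i) (hk : p k) :
    chainWeight R (List.range (k + (n + 1))) p =
      e R ^ k * var R .b * chainWeight R (List.range n) (fun i => p (k + (i + 1))) := by
  rw [List.range_add, List.range_succ_eq_map, chainWeight, List.map_append, List.prod_append]
  change chainWeight R (List.range k) p * _ = _
  rw [chainWeight_eq_pow (fun i hi => h i (List.mem_range.1 hi)), List.length_range]
  simp [hk, chainWeight, Function.comp_def, mul_assoc]

/-- Expand the factors `a - b` outside `T`; `U` is the set of positions where `-b` is chosen. -/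
theorem chainWeight_eq_sum {l : List ℕ} (hl : l.Nodup) (T : Finset ℕ) :
    chainWeight R l (· ∈ T) = ∑ U ∈ (l.toFinset \ T).powerset, (-1 : R) ^ U.card •
      MonoidAlgebra.of R (FreeMonoid ABLetter) (FreeMonoid.ofList
        (l.map fun i => if i ∈ T ∪ U then ABLetter.b else ABLetter.a)) := by
  induction l with
  | nil => simp [chainWeight, MonoidAlgebra.one_def]
  | cons i l ih =>
    obtain ⟨hi, hl⟩ := List.nodup_cons.1 hl
    have hstep : chainWeight R (i :: l) (· ∈ T) =
        (if i ∈ T then var R .b else e R) * chainWeight R l (· ∈ T) := by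
      rw [chainWeight, chainWeight, List.map_cons, List.prod_cons]
      congr
    rw [hstep, ih hl, List.toFinset_cons]
    by_cases hT : i ∈ T
    · rw [if_pos hT, Finset.insert_sdiff_of_mem _ hT, Finset.mul_sum]
      refine Finset.sum_congr rfl fun U _ => ?_
      rw [List.map_cons, if_pos (Finset.mem_union_left _ hT), FreeMonoid.ofList_cons, map_mul,
        mul_smul_comm]
      rfl
    · rw [if_neg hT, Finset.insert_sdiff_of_notMem _ hT,
        Finset.sum_powerset_insert (by simp [hi]), e, sub_mul, Finset.mul_sum, Finset.mul_sum,
        sub_eq_add_neg, ← Finset.sum_neg_distrib]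
      congr 1
      · refine Finset.sum_congr rfl fun U hU => ?_
        have hiU : i ∉ T ∪ U := by
          intro h
          rcases Finset.mem_union.1 h with h | h
          · exact hT h
          · exact hi (List.mem_toFinset.1 (Finset.mem_sdiff.1 (Finset.mem_powerset.1 hU h)).1)
        rw [List.map_cons, if_neg hiU, FreeMonoid.ofList_cons, map_mul, mul_smul_comm]
        rfl
      · refine Finset.sum_congr rfl fun U hU => ?_
        have hiU : i ∉ U := fun h =>
          hi (List.mem_toFinset.1 (Finset.mem_sdiff.1 (Finset.mem_powerset.1 hU h)).1)
        have hmap : (l.map fun j => if j ∈ T ∪ insert i U then ABLetter.b else ABLetter.a) =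
            l.map fun j => if j ∈ T ∪ U then ABLetter.b else ABLetter.a := by
          refine List.map_congr_left fun j hj => if_congr ?_ rfl rfl
          have : j ≠ i := by
            rintro rfl
            exact hi hj
          simp [this]
        rw [List.map_cons, if_pos (by simp), FreeMonoid.ofList_cons, map_mul, hmap,
          Finset.card_insert_of_notMem hiU, pow_succ, mul_neg_one, neg_smul, mul_smul_comm]
        rfl

/-- Exchange the two sums: the sets `S ⊇ T` correspond to `U = S \ T`, so the alternating signs turn
each `a` into `a - b`. -/
theorem abIndex_eq_sum_flagF (P : Type*) [PartialOrder P] [Finite P] (n : ℕ) :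
    abIndex R P n = ∑ T ∈ (Finset.Icc 1 n).powerset,
      (flagF P T : R) • chainWeight R (List.range' 1 n) (· ∈ T) := by
  have hN : (List.range' 1 n).toFinset = Finset.Icc 1 n := by
    ext i
    simp only [List.mem_toFinset, List.mem_range'_1, Finset.mem_Icc]
    omega
  have h1 : abIndex R P n = ∑ S ∈ (Finset.Icc 1 n).powerset, ∑ T ∈ S.powerset,
      (flagF P T : R) • ((-1 : R) ^ (S \ T).card •
        MonoidAlgebra.of R _ (abMonomial n S)) := by
    refine Finset.sum_congr rfl fun S _ => ?_
    rw [flagH, MonoidAlgebra.of_apply]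
    simp only [smul_smul]
    rw [← Finset.sum_smul, MonoidAlgebra.smul_single, smul_eq_mul, mul_one]
    congr 1
    push_cast
    exact Finset.sum_congr rfl fun T _ => mul_comm _ _
  rw [h1, Finset.sum_comm' (t' := (Finset.Icc 1 n).powerset)
    (s' := fun T => (Finset.Icc 1 n).powerset.filter (T ⊆ ·))]
  · refine Finset.sum_congr rfl fun T hT => ?_
    rw [Finset.mem_powerset] at hT
    rw [← Finset.smul_sum, chainWeight_eq_sum List.nodup_range', hN]
    congr 1
    refine Finset.sum_bij' (fun S _ => S \ T) (fun U _ => T ∪ U) ?_ ?_ ?_ ?_ ?_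
    · intro S hS
      rw [Finset.mem_filter, Finset.mem_powerset] at hS
      exact Finset.mem_powerset.2 (Finset.sdiff_subset_sdiff hS.1 le_rfl)
    · intro U hU
      rw [Finset.mem_powerset] at hU
      rw [Finset.mem_filter, Finset.mem_powerset]
      exact ⟨Finset.union_subset hT (hU.trans Finset.sdiff_subset), Finset.subset_union_left⟩
    · intro S hS
      exact Finset.union_sdiff_of_subset (Finset.mem_filter.1 hS).2
    · intro U hU
      rw [Finset.mem_powerset] at hU
      rw [Finset.union_sdiff_left]
      exact Finset.sdiff_eq_self_of_disjoint
        (Finset.disjoint_of_subset_left hU Finset.sdiff_disjoint)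
    · intro S hS
      rw [Finset.union_sdiff_of_subset (Finset.mem_filter.1 hS).2]
      rfl
  · intro S T
    simp only [Finset.mem_powerset, Finset.mem_filter]
    constructor
    · rintro ⟨h1, h2⟩
      exact ⟨⟨h1, h2⟩, h2.trans h1⟩
    · rintro ⟨⟨h1, h2⟩, -⟩
      exact ⟨h1, h2⟩

end Weights

/-! ### From flag counts to the recursion -/

section Chains

open ABPoly

variable {R : Type*} [CommRing R]
variable {X : Type*} [PartialOrder X] [LocallyFiniteOrder X] {ρ : X → ℕ}

open Classical in
/-- The chains in the open interval `(x, y)`. -/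
noncomputable def chainsIoo (x y : X) : Finset (Finset X) :=
  (Finset.Ioo x y).powerset.filter fun C => IsChain (· ≤ ·) (C : Set X)

theorem mem_chainsIoo {x y : X} {C : Finset X} :
    C ∈ chainsIoo x y ↔ C ⊆ Finset.Ioo x y ∧ IsChain (· ≤ ·) (C : Set X) := by
  classical
  rw [chainsIoo, Finset.mem_filter, Finset.mem_powerset]

/-- A nonempty finite chain is its least element together with a chain above it. -/
theorem chainsIoo_eq [DecidableEq X] (x y : X) : chainsIoo x y =
    insert ∅ ((Finset.Ioo x y).biUnion fun z => (chainsIoo z y).image (insert z)) := by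
  ext C
  rw [Finset.mem_insert, Finset.mem_biUnion, mem_chainsIoo]
  constructor
  · rintro ⟨hC, hchain⟩
    rcases C.eq_empty_or_nonempty with rfl | hne
    · exact Or.inl rfl
    · right
      obtain ⟨z, hz⟩ := C.exists_minimal hne
      refine ⟨z, hC hz.1, Finset.mem_image.2 ⟨C.erase z, ?_, Finset.insert_erase hz.1⟩⟩
      rw [mem_chainsIoo]
      refine ⟨fun a ha => ?_, hchain.mono (by simp)⟩
      obtain ⟨hne', haC⟩ := Finset.mem_erase.1 ha
      refine Finset.mem_Ioo.2 ⟨lt_of_le_of_ne ?_ hne'.symm, (Finset.mem_Ioo.1 (hC haC)).2⟩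
      rcases hchain hz.1 haC hne'.symm with h | h
      · exact h
      · exact hz.2 haC h
  · rintro (rfl | ⟨z, hz, hC⟩)
    · exact ⟨Finset.empty_subset _, by simp⟩
    · obtain ⟨D, hD, rfl⟩ := Finset.mem_image.1 hC
      obtain ⟨hD, hchain⟩ := mem_chainsIoo.1 hD
      refine ⟨Finset.insert_subset hz (hD.trans
        (Finset.Ioo_subset_Ioo_left (Finset.mem_Ioo.1 hz).1.le)), ?_⟩
      rw [Finset.coe_insert]
      exact hchain.insert fun b hb _ => Or.inl (Finset.mem_Ioo.1 (hD hb)).1.le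

theorem sum_chainsIoo {M : Type*} [AddCommMonoid M] [DecidableEq X] (x y : X)
    (F : Finset X → M) : ∑ C ∈ chainsIoo x y, F C =
      F ∅ + ∑ z ∈ Finset.Ioo x y, ∑ C ∈ chainsIoo z y, F (insert z C) := by
  have hlt : ∀ {z C}, C ∈ chainsIoo z y → ∀ a ∈ C, z < a := fun hC a ha =>
    (Finset.mem_Ioo.1 ((mem_chainsIoo.1 hC).1 ha)).1
  rw [chainsIoo_eq, Finset.sum_insert, Finset.sum_biUnion]
  · congr 1
    refine Finset.sum_congr rfl fun z _ => ?_
    rw [Finset.sum_image]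
    · intro C hC D hD h
      have h1 : z ∉ C := fun h => lt_irrefl _ (hlt hC z h)
      have h2 : z ∉ D := fun h => lt_irrefl _ (hlt hD z h)
      rw [← Finset.erase_insert h1, ← Finset.erase_insert h2, h]
  · intro z _ z' _ hne
    rw [Function.onFun, Finset.disjoint_left]
    intro C hC hC'
    obtain ⟨D, hD, rfl⟩ := Finset.mem_image.1 hC
    obtain ⟨D', hD', h⟩ := Finset.mem_image.1 hC'
    have h1 : z ∈ insert z' D' := h ▸ Finset.mem_insert_self z D
    have h2 : z' ∈ insert z D := h ▸ Finset.mem_insert_self z' D'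
    rcases Finset.mem_insert.1 h1 with h1 | h1
    · exact hne h1
    rcases Finset.mem_insert.1 h2 with h2 | h2
    · exact hne h2.symm
    exact lt_asymm (hlt hD' z h1) (hlt hD z' h2)
  · simp

/-- The ab-index as a sum over chains. -/
theorem sum_chainsIoo_chainWeight (hρ : StrictMono ρ) {x y : X} (hxy : x < y) :
    ∑ C ∈ chainsIoo x y, chainWeight R (List.range (ρ y - ρ x - 1))
      (fun i => ∃ c ∈ C, ρ c = ρ x + 1 + i) = psi R ρ x y := by
  classical
  induction hn : (Finset.Ioo x y).card using Nat.strong_induction_on generalizing x with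
  | _ n ih =>
  subst hn
  rw [sum_chainsIoo, psi_eq]
  congr 1
  · rw [chainWeight_eq_pow (by simp), List.length_range]
  · refine Finset.sum_congr rfl fun z hz => ?_
    have hz' := Finset.mem_Ioo.1 hz
    have h1 := hρ hz'.1
    have h2 := hρ hz'.2
    rw [← ih _ (card_Ioo_lt_of_mem_left hz) hz'.2 rfl, Finset.mul_sum]
    refine Finset.sum_congr rfl fun C hC => ?_
    have hlt : ∀ c ∈ C, ρ z < ρ c := fun c hc =>
      hρ (Finset.mem_Ioo.1 ((mem_chainsIoo.1 hC).1 hc)).1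
    rw [show ρ y - ρ x - 1 = (ρ z - ρ x - 1) + ((ρ y - ρ z - 1) + 1) by omega, chainWeight_range]
    · congr 1
      refine chainWeight_congr fun i _ => ?_
      constructor
      · rintro ⟨c, hc, hci⟩
        rcases Finset.mem_insert.1 hc with rfl | hc
        · omega
        · exact ⟨c, hc, by omega⟩
      · rintro ⟨c, hc, hci⟩
        exact ⟨c, Finset.mem_insert_of_mem hc, by omega⟩
    · rintro i hi ⟨c, hc, hci⟩
      rcases Finset.mem_insert.1 hc with rfl | hc
      · omega
      · have := hlt c hc
        omega
    · exact ⟨z, Finset.mem_insert_self _ _, by omega⟩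

/-- The ab-index of a poset that is embedded as the interval `[x, y]`. -/
theorem abIndex_eq_psi {P : Type*} [PartialOrder P] [Finite P] (φ : P → X) {x y : X} (hxy : x < y)
    (hρ : StrictMono ρ) (hle : ∀ p q, φ p ≤ φ q ↔ p ≤ q) (hrange : Set.range φ = Set.Icc x y)
    (hrank : ∀ p, ρ (φ p) = ρ x + posetRank p) {n : ℕ} (hn : ρ y = ρ x + (n + 1)) :
    abIndex R P n = psi R ρ x y := by
  classical
  have hφ : Function.Injective φ := fun p q h => le_antisymm ((hle p q).1 h.le) ((hle q p).1 h.ge)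
  -- Ranks in `{1, …, n}` exclude the least and the greatest element, so these chains correspond
  -- under `φ` to chains in the open interval.
  have hflag : ∀ T ∈ (Finset.Icc 1 n).powerset, flagF P T =
      ((chainsIoo x y).filter fun C => C.image (fun c => ρ c - ρ x) = T).card := by
    intro T hT
    rw [Finset.mem_powerset] at hT
    rw [flagF, ← Set.ncard_coe_finset]
    refine Set.ncard_congr (fun C _ => (Set.toFinite (φ '' C)).toFinset) ?_ ?_ ?_
    · rintro C ⟨hC, hCT⟩
      rw [Finset.mem_coe, Finset.mem_filter, mem_chainsIoo]
      have hrk : ∀ p ∈ C, posetRank p ∈ T := by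
        intro p hp
        have : posetRank p ∈ posetRank '' C := ⟨p, hp, rfl⟩
        rwa [hCT] at this
      refine ⟨⟨?_, ?_⟩, ?_⟩
      · intro v hv
        obtain ⟨p, hp, rfl⟩ := (Set.Finite.mem_toFinset _).1 hv
        have h1 := Finset.mem_Icc.1 (hT (hrk p hp))
        have h2 : φ p ∈ Set.Icc x y := hrange ▸ Set.mem_range_self p
        have h3 := hrank p
        refine Finset.mem_Ioo.2 ⟨lt_of_le_of_ne h2.1 ?_, lt_of_le_of_ne h2.2 ?_⟩
        · intro h
          rw [← h] at h3
          omega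
        · intro h
          rw [h] at h3
          omega
      · rw [Set.Finite.coe_toFinset]
        rintro _ ⟨p, hp, rfl⟩ _ ⟨q, hq, rfl⟩ hne
        change φ p ≤ φ q ∨ φ q ≤ φ p
        rw [hle, hle]
        exact hC hp hq fun h => hne (h ▸ rfl)
      · ext i
        rw [← Finset.mem_coe (s := T), ← hCT]
        simp only [Finset.mem_image, Set.Finite.mem_toFinset, Set.mem_image,
          exists_exists_and_eq_and, hrank, Nat.add_sub_cancel_left]
    · intro C D _ _ h
      have h' : φ '' C = φ '' D := by simpa using h
      exact hφ.image_injective h'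
    · intro D hD
      rw [Finset.mem_coe, Finset.mem_filter, mem_chainsIoo] at hD
      obtain ⟨⟨hD, hchain⟩, himage⟩ := hD
      have hDr : (D : Set X) ⊆ Set.range φ := by
        intro v hv
        rw [hrange]
        exact ⟨(Finset.mem_Ioo.1 (hD hv)).1.le, (Finset.mem_Ioo.1 (hD hv)).2.le⟩
      have hpre : φ '' (φ ⁻¹' D) = D := Set.image_preimage_eq_of_subset hDr
      refine ⟨φ ⁻¹' D, ⟨?_, ?_⟩, ?_⟩
      · intro p hp q hq hne
        change p ≤ q ∨ q ≤ p
        rw [← hle, ← hle]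
        exact hchain hp hq (hφ.ne hne)
      · rw [← himage, Finset.coe_image]
        conv_rhs => rw [← hpre, Set.image_image]
        refine Set.image_congr fun p _ => ?_
        rw [hrank, Nat.add_sub_cancel_left]
      · ext v
        rw [Set.Finite.mem_toFinset, hpre, Finset.mem_coe]
  have hmaps : ∀ C ∈ chainsIoo x y, C.image (fun c => ρ c - ρ x) ∈ (Finset.Icc 1 n).powerset := by
    intro C hC
    rw [Finset.mem_powerset]
    intro i hi
    obtain ⟨c, hc, rfl⟩ := Finset.mem_image.1 hi
    have hc' := Finset.mem_Ioo.1 ((mem_chainsIoo.1 hC).1 hc)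
    have h1 := hρ hc'.1
    have h2 := hρ hc'.2
    rw [Finset.mem_Icc]
    omega
  -- Group the chains by their rank sets: the weight of a chain depends on nothing else.
  rw [abIndex_eq_sum_flagF, ← sum_chainsIoo_chainWeight hρ hxy,
    ← Finset.sum_fiberwise_of_maps_to hmaps]
  refine Finset.sum_congr rfl fun T hT => ?_
  rw [hflag T hT, Nat.cast_smul_eq_nsmul, ← Finset.sum_const]
  refine Finset.sum_congr rfl fun C hC => ?_
  obtain ⟨hC', rfl⟩ := Finset.mem_filter.1 hC
  rw [List.range'_eq_map_range, chainWeight_map, show ρ y - ρ x - 1 = n by omega]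
  refine chainWeight_congr fun i _ => ?_
  rw [Finset.mem_image]
  refine exists_congr fun c => and_congr_right fun hc => ?_
  have := hρ (Finset.mem_Ioo.1 ((mem_chainsIoo.1 hC').1 hc)).1
  omega

end Chains

/-! ### Bruhat intervals are graded by length -/

namespace CoxeterSystem

variable {B W : Type*} [Group W] {M : CoxeterMatrix B} {cs : CoxeterSystem M W}

/-- Strict monotonicity of length bounds the height above; `exists_cover` descends by steps of
length one and bounds it below. -/
theorem height_bruhatInterval {u w : W} (p : cs.BruhatInterval u w) :
    Order.height p = ((cs.length p.1 - cs.length u : ℕ) : ℕ∞) := by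
  induction hn : cs.length p.1 using Nat.strong_induction_on generalizing p with
  | _ n ih =>
  subst hn
  have hmono : ∀ q, q < p → cs.length q.1 < cs.length p.1 := by
    intro q hq
    have hq' : cs.toBruhat q.1 < cs.toBruhat p.1 :=
      lt_of_le_of_ne hq.le fun h => hq.ne (Subtype.ext h)
    exact Bruhat.rank_strictMono hq'
  refine le_antisymm ?_ ?_
  · rw [Order.height_le_coe_iff]
    intro q hq
    have h1 := hmono q hq
    have h2 := q.2.1.length_le
    rw [ih _ h1 q rfl, Nat.cast_lt]
    omega
  · by_cases hp : u = p.1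
    · simp [← hp]
    · obtain ⟨y, huy, hyp, hl⟩ := p.2.1.exists_cover hp
      let q : cs.BruhatInterval u w := ⟨y, huy, hyp.trans p.2.2⟩
      have hqp : q < p := by
        refine lt_of_le_of_ne hyp fun h => ?_
        have : y = p.1 := congrArg Subtype.val h
        rw [this] at hl
        omega
      have h1 := Order.height_add_one_le hqp
      rw [ih _ (by change cs.length y < _; omega) q rfl] at h1
      refine le_trans ?_ h1
      change _ ≤ ((cs.length y - cs.length u : ℕ) : ℕ∞) + 1
      norm_cast
      have := huy.length_le
      omega

theorem abIndex_bruhatInterval (R : Type*) [CommRing R] {u w : W} {n : ℕ} (h : cs.BruhatLE u w)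
    (hl : cs.length w = cs.length u + (n + 1)) :
    abIndex R (cs.BruhatInterval u w) n =
      psi R Bruhat.rank (cs.toBruhat u) (cs.toBruhat w) := by
  have hlt : cs.toBruhat u < cs.toBruhat w := by
    refine lt_of_le_of_ne h fun he => ?_
    have : u = w := he
    rw [this] at hl
    omega
  refine abIndex_eq_psi (fun p => cs.toBruhat p.1) hlt Bruhat.rank_strictMono
    (fun p q => Iff.rfl) ?_ ?_ hl
  · ext v
    constructor
    · rintro ⟨p, rfl⟩
      exact p.2
    · intro hv
      exact ⟨⟨v.val, hv⟩, rfl⟩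
  · intro p
    have := p.2.1.length_le
    rw [posetRank, height_bruhatInterval, ENat.toNat_natCast, rank_toBruhat, rank_toBruhat]
    omega

end CoxeterSystem

/-! ### The cd-index of a Bruhat interval -/

theorem abIndex_coeff_eq_zero (R : Type*) [CommRing R] (P : Type*) [PartialOrder P] [Finite P]
    {n : ℕ} {v : FreeMonoid ABLetter} (hv : v.length ≠ n) : (abIndex R P n).coeff v = 0 := by
  rw [abIndex, MonoidAlgebra.coeff_sum, Finsupp.finsetSum_apply]
  refine Finset.sum_eq_zero fun S _ => ?_
  rw [MonoidAlgebra.coeff_single, Finsupp.single_eq_of_ne]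
  rintro rfl
  exact hv (by simp [abMonomial, FreeMonoid.length])

theorem flagF_empty (P : Type*) [PartialOrder P] [Finite P] : flagF P ∅ = 1 := by
  rw [flagF, Set.ncard_eq_one]
  refine ⟨∅, ?_⟩
  ext C
  simp only [Finset.coe_empty, Set.image_eq_empty, Set.mem_singleton_iff]
  exact ⟨fun h => h.2, fun h => ⟨by rw [h]; exact IsChain.empty, h⟩⟩

theorem abMonomial_empty (n : ℕ) : abMonomial n ∅ = FreeMonoid.of .a ^ n := by
  have : ∀ (l : List ℕ), FreeMonoid.ofList (l.map fun _ => ABLetter.a) =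
      FreeMonoid.of .a ^ l.length := by
    intro l
    induction l with
    | nil => rfl
    | cons i l ih => rw [List.map_cons, FreeMonoid.ofList_cons, ih, List.length_cons, pow_succ']
  simpa [abMonomial] using this (List.range' 1 n)

theorem abIndex_coeff_a_pow (R : Type*) [CommRing R] (P : Type*) [PartialOrder P] [Finite P]
    (n : ℕ) : (abIndex R P n).coeff (FreeMonoid.of .a ^ n) = 1 := by
  rw [abIndex, MonoidAlgebra.coeff_sum, Finsupp.finsetSum_apply, Finset.sum_eq_single ∅]
  · rw [abMonomial_empty, MonoidAlgebra.coeff_single, Finsupp.single_eq_same, flagH,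
      Finset.powerset_empty, Finset.sum_singleton, flagF_empty]
    simp
  · intro S hS hne
    rw [MonoidAlgebra.coeff_single, Finsupp.single_eq_of_ne]
    rw [← abMonomial_empty]
    intro h
    obtain ⟨i, hi⟩ := Finset.nonempty_iff_ne_empty.2 hne
    have hmem := Finset.mem_Icc.1 (Finset.mem_powerset.1 hS hi)
    have h' : ∀ j ∈ List.range' 1 n, (if j ∈ (∅ : Finset ℕ) then ABLetter.b else ABLetter.a) =
        if j ∈ S then ABLetter.b else ABLetter.a := List.map_inj_left.1 h
    have := h' i (by rw [List.mem_range'_1]; omega)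
    simp [hi] at this
  · intro h
    exact absurd (Finset.empty_mem_powerset _) h

theorem IsCDIndex.unique {R : Type*} [CommRing R] {P : Type*} [PartialOrder P] [Finite P] {n : ℕ}
    {Φ Φ' : CDPoly R} (h : IsCDIndex P n Φ) (h' : IsCDIndex P n Φ') : Φ = Φ' :=
  CDPoly.toAB_injective (h.trans h'.symm)

/-- Vanishing of ab-coefficients outside degree `n` transfers to cd-coefficients. The coefficient of
`c ^ n` is that of `a ^ n`, which counts the empty chain. -/
theorem IsCDIndex.mem_monic {R : Type*} [CommRing R] {P : Type*} [PartialOrder P] [Finite P]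
    {n : ℕ} {Φ : CDPoly R} (h : IsCDIndex P n Φ) : Φ ∈ CDPoly.monic R n := by
  rw [CDPoly.mem_monic]
  constructor
  · intro m hm
    have := CDPoly.coeff_mem_of_coeff_toAB_mem (fun k => if k = n then ⊤ else ⊥) Φ (fun v => ?_) m
    · simpa [hm] using this
    · by_cases hv : v.length = n
      · simp [hv]
      · rw [if_neg hv, show CDPoly.toAB R Φ = _ from h, abIndex_coeff_eq_zero R P hv]
        exact zero_mem _
  · rw [← CDPoly.coeff_toAB_a_pow, show CDPoly.toAB R Φ = _ from h, abIndex_coeff_a_pow]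

namespace CoxeterSystem

variable {B W : Type*} [Group W] {M : CoxeterMatrix B} {cs : CoxeterSystem M W}
variable (R : Type*) [CommRing R] {u w : W} {n : ℕ}

theorem isCDIndex_cdIndex (h : cs.BruhatLE u w) (hl : cs.length w = cs.length u + (n + 1)) :
    IsCDIndex (cs.BruhatInterval u w) n (cdIndex R (cs.BruhatInterval u w) n) := by
  have hlt : cs.toBruhat u < cs.toBruhat w := by
    refine lt_of_le_of_ne h fun he => ?_
    have : u = w := he
    rw [this] at hl
    omega
  have hex : ∃ Φ : CDPoly R, IsCDIndex (cs.BruhatInterval u w) n Φ := by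
    obtain ⟨Φ, hΦ⟩ := psi_mem_range_toAB R Bruhat.rank_strictMono
      (fun x y => sum_Icc_neg_one_pow_rank) hlt
    exact ⟨Φ, hΦ.trans (abIndex_bruhatInterval R h hl).symm⟩
  rw [cdIndex, dif_pos hex]
  exact hex.choose_spec

theorem toAB_cdIndex (h : cs.BruhatLE u w) (hl : cs.length w = cs.length u + (n + 1)) :
    CDPoly.toAB R (cdIndex R (cs.BruhatInterval u w) n) =
      psi R Bruhat.rank (cs.toBruhat u) (cs.toBruhat w) :=
  (isCDIndex_cdIndex R h hl).trans (abIndex_bruhatInterval R h hl)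

end CoxeterSystem

/-! ### The Coxeter system whose graph is complete with all labels `3` -/

namespace CompleteThree

open CoxeterSystem

theorem matrix_apply (i j : ℕ) : completeThree i j = if i = j then 1 else 3 := rfl

/-- The product of two generators is sent either to the identity or to a three-cycle, and all
off-diagonal labels are `3`. -/
theorem isLiftable_swap (k : ℕ) : completeThree.IsLiftable
    (fun i => if i = k then Equiv.swap (1 : Fin 3) 2 else Equiv.swap 0 1) := by
  intro i j
  rw [matrix_apply]
  by_cases hij : i = j
  · subst hij
    by_cases h1 : i = k <;> simp [h1]
  · rw [if_neg hij]
    by_cases h1 : i = k <;> by_cases h2 : j = k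
    · exact absurd (h1.trans h2.symm) hij
    all_goals
      simp only [h1, h2, if_true, if_false]
      decide

/-- The homomorphism to the symmetric group on three letters that sends one generator to `(1 2)` and
all others to `(0 1)`. -/
noncomputable def toPerm (k : ℕ) : completeThree.Group →* Equiv.Perm (Fin 3) :=
  completeThreeSystem.lift ⟨_, isLiftable_swap k⟩

theorem toPerm_simple (k i : ℕ) :
    toPerm k (completeThreeSystem.simple i) =
      if i = k then Equiv.swap (1 : Fin 3) 2 else Equiv.swap 0 1 :=
  completeThreeSystem.lift_apply_simple _ i

/-- The subgroup generated by all generators but one. -/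
def avoiding (k : ℕ) : Subgroup completeThree.Group where
  carrier := {w | ∃ ω : List ℕ, k ∉ ω ∧ completeThreeSystem.wordProd ω = w}
  one_mem' := ⟨[], by simp, by simp⟩
  mul_mem' := by
    rintro _ _ ⟨ω, hω, rfl⟩ ⟨η, hη, rfl⟩
    exact ⟨ω ++ η, by simp [hω, hη], wordProd_append _ _ _⟩
  inv_mem' := by
    rintro _ ⟨ω, hω, rfl⟩
    exact ⟨ω.reverse, by simpa using hω, wordProd_reverse _ _⟩

variable {k : ℕ} {q q' : completeThree.Group}

theorem wordProd_mem_avoiding {ω : List ℕ} (h : k ∉ ω) :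
    completeThreeSystem.wordProd ω ∈ avoiding k :=
  ⟨ω, h, rfl⟩

/-- Deletion only removes letters, so a reduced word can be found inside any word without `k`. -/
theorem exists_isReduced_of_mem_avoiding (h : q ∈ avoiding k) :
    ∃ ω : List ℕ, k ∉ ω ∧ completeThreeSystem.IsReduced ω ∧ completeThreeSystem.wordProd ω = q := by
  obtain ⟨ω, hω, rfl⟩ := h
  obtain ⟨η, hs, hr, hp⟩ := completeThreeSystem.exists_isReduced_sublist ω
  exact ⟨η, fun h => hω (hs.subset h), hr, hp⟩

theorem mem_avoiding_of_le (h : q' ∈ avoiding k)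
    (hle : completeThreeSystem.BruhatLE q q') : q ∈ avoiding k := by
  obtain ⟨ω, hω, hr, hp⟩ := exists_isReduced_of_mem_avoiding h
  obtain ⟨η, hs, -, rfl⟩ := hle ω hr hp
  exact wordProd_mem_avoiding fun h => hω (hs.subset h)

theorem toPerm_apply_two (h : q ∈ avoiding k) : toPerm k q 2 = 2 := by
  obtain ⟨ω, hω, rfl⟩ := h
  induction ω with
  | nil => simp
  | cons i ω ih =>
    rw [List.mem_cons, not_or] at hω
    rw [wordProd_cons, map_mul, Equiv.Perm.mul_apply, ih hω.2, toPerm_simple,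
      if_neg (Ne.symm hω.1)]
    decide

theorem simple_notMem_avoiding (k : ℕ) : completeThreeSystem.simple k ∉ avoiding k := by
  intro h
  have := toPerm_apply_two h
  rw [toPerm_simple, if_pos rfl] at this
  exact absurd this (by decide)

/-- The image of the subgroup in `S₃` fixes `2`, whereas this conjugate sends `2` to `0`. With label
`2` it would equal `s_j`, and the statement would fail. -/
theorem simple_mul_simple_mul_simple_notMem {j : ℕ} (hj : j ≠ k) :
    completeThreeSystem.simple k * completeThreeSystem.simple j * completeThreeSystem.simple k
      ∉ avoiding k := by
  intro h
  have := toPerm_apply_two h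
  rw [map_mul, map_mul, toPerm_simple, toPerm_simple, if_pos rfl, if_neg hj] at this
  exact absurd this (by decide)

theorem length_mul_simple_of_mem (h : q ∈ avoiding k) :
    completeThreeSystem.length (q * completeThreeSystem.simple k) =
      completeThreeSystem.length q + 1 := by
  rcases completeThreeSystem.length_mul_simple q k with h' | h'
  · exact h'
  · obtain ⟨ω, hω, hr, rfl⟩ := exists_isReduced_of_mem_avoiding h
    obtain ⟨j, -, he⟩ := completeThreeSystem.exists_eraseIdx_of_isRightDescent (ω := ω) (i := k)
      (by rw [IsRightDescent]; omega)
    have h1 : completeThreeSystem.wordProd (ω.eraseIdx j) ∈ avoiding k :=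
      wordProd_mem_avoiding fun h => hω ((List.eraseIdx_sublist ω j).subset h)
    rw [← he, Subgroup.mul_mem_cancel_left _ h] at h1
    exact absurd h1 (simple_notMem_avoiding k)

theorem length_simple_mul_of_mem (h : q ∈ avoiding k) :
    completeThreeSystem.length (completeThreeSystem.simple k * q) =
      completeThreeSystem.length q + 1 := by
  have := length_mul_simple_of_mem (inv_mem h)
  rwa [← completeThreeSystem.length_inv, mul_inv_rev, inv_inv, inv_simple,
    completeThreeSystem.length_inv] at this

/-- Let `q' = s_k q s_k`, and let a reduced word of `q ≠ 1` end in `j`. Then `j` is a descent of `q'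
s_k = s_k q`. Exchange puts `s_k s_j s_k` or `s_k` into the subgroup, according to whether the
erased letter belongs to `q'` or is the final `k`; both are excluded. -/
theorem eq_one_of_conj_mem (h : q ∈ avoiding k)
    (h' : completeThreeSystem.simple k * q * completeThreeSystem.simple k ∈ avoiding k) :
    q = 1 := by
  by_contra hq
  set q' := completeThreeSystem.simple k * q * completeThreeSystem.simple k with hq'
  have hsq : q' * completeThreeSystem.simple k = completeThreeSystem.simple k * q := by simp [hq']
  have hlen : completeThreeSystem.length (completeThreeSystem.simple k * q) =
      completeThreeSystem.length q + 1 := length_simple_mul_of_mem h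
  obtain ⟨ω, hω, hr, rfl⟩ := exists_isReduced_of_mem_avoiding h
  obtain ⟨η, hη, hrη, hpη⟩ := exists_isReduced_of_mem_avoiding h'
  rcases List.eq_nil_or_concat' ω with rfl | ⟨ω, j, rfl⟩
  · exact hq (by simp)
  have hjk : j ≠ k := by
    rintro rfl
    exact hω (by simp)
  have hj : completeThreeSystem.simple j ∈ avoiding k := by
    simpa using wordProd_mem_avoiding (k := k) (ω := [j]) (by simpa using hjk.symm)
  have hdesc : completeThreeSystem.IsRightDescent (completeThreeSystem.wordProd (η ++ [k])) j := by
    rw [IsRightDescent, wordProd_append, wordProd_singleton, hpη, hsq, hlen, hr.eq,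
      wordProd_append, wordProd_singleton, ← mul_assoc, simple_mul_simple_cancel_right]
    have h1 := completeThreeSystem.length_mul_le (completeThreeSystem.simple k)
      (completeThreeSystem.wordProd ω)
    have h2 := completeThreeSystem.length_wordProd_le ω
    rw [length_simple] at h1
    simp
    omega
  obtain ⟨i, hi, he⟩ := completeThreeSystem.exists_eraseIdx_of_isRightDescent hdesc
  rw [List.length_append, List.length_singleton] at hi
  rw [wordProd_append, wordProd_singleton, hpη] at he
  rcases Nat.lt_or_ge i η.length with hi' | hi'
  · rw [List.eraseIdx_append_of_lt_length hi', wordProd_append, wordProd_singleton] at he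
    have h1 : completeThreeSystem.wordProd (η.eraseIdx i) ∈ avoiding k :=
      wordProd_mem_avoiding fun h => hη ((List.eraseIdx_sublist η i).subset h)
    have h2 : q' * (completeThreeSystem.simple k * completeThreeSystem.simple j *
        completeThreeSystem.simple k) = completeThreeSystem.wordProd (η.eraseIdx i) := by
      rw [← mul_assoc, ← mul_assoc, he]
      simp
    rw [← h2, Subgroup.mul_mem_cancel_left _ h'] at h1
    exact simple_mul_simple_mul_simple_notMem hjk h1
  · have : i = η.length := by omega
    subst this
    rw [List.eraseIdx_append_of_length_le le_rfl] at he
    simp only [Nat.sub_self, List.eraseIdx_cons_zero, List.append_nil, hpη] at he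
    have h1 : q' * completeThreeSystem.simple k * completeThreeSystem.simple j ∈ avoiding k := by
      rw [he]
      exact h'
    rw [Subgroup.mul_mem_cancel_right _ hj, Subgroup.mul_mem_cancel_left _ h'] at h1
    exact simple_notMem_avoiding k h1

theorem length_conj (h : q ∈ avoiding k) (hq : q ≠ 1) :
    completeThreeSystem.length (completeThreeSystem.simple k * q * completeThreeSystem.simple k) =
      completeThreeSystem.length q + 2 := by
  have h1 := length_simple_mul_of_mem h
  rcases completeThreeSystem.length_mul_simple (completeThreeSystem.simple k * q) k with h' | h'
  · omega
  · obtain ⟨ω, hω, hr, rfl⟩ := exists_isReduced_of_mem_avoiding h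
    obtain ⟨j, hj, he⟩ := completeThreeSystem.exists_eraseIdx_of_isRightDescent
      (ω := k :: ω) (i := k)
      (by rw [IsRightDescent, wordProd_cons]; omega)
    rw [wordProd_cons] at he
    cases j with
    | zero =>
      rw [List.eraseIdx_cons_zero] at he
      exact absurd (eq_one_of_conj_mem h (by rw [he]; exact h)) hq
    | succ j =>
      rw [List.eraseIdx_cons_succ, wordProd_cons, mul_assoc, mul_right_inj] at he
      have h2 : completeThreeSystem.wordProd (ω.eraseIdx j) ∈ avoiding k :=
        wordProd_mem_avoiding fun h => hω ((List.eraseIdx_sublist ω j).subset h)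
      rw [← he, Subgroup.mul_mem_cancel_left _ h] at h2
      exact absurd h2 (simple_notMem_avoiding k)

/-! ### Elements with one generator on the left or on the right -/

/-- The element `q`, multiplied with the generator `k` on the left if `i` and on the right if
`j`. -/
noncomputable def sandwich (k : ℕ) (i j : Bool) (q : completeThree.Group) : completeThree.Group :=
  (if i then completeThreeSystem.simple k else 1) * q *
    (if j then completeThreeSystem.simple k else 1)

theorem sandwich_sandwich (i j i' j' : Bool) (q : completeThree.Group) :
    sandwich k i j (sandwich k i' j' q) = sandwich k (i ^^ i') (j ^^ j') q := by
  cases i <;> cases j <;> cases i' <;> cases j' <;> simp [sandwich, mul_assoc]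

theorem sandwich_false_false (q : completeThree.Group) : sandwich k false false q = q := by
  simp [sandwich]

/-- Moving all outer generators to one side makes `q'` equal to `q`, a one-sided multiple of it, or
its conjugate by `s_k`. Only for `q = 1` do left and right factors coincide, hence the condition `i
= i'` in that case. -/
theorem sandwich_injective {i j i' j' : Bool} (hq : q ∈ avoiding k) (hq' : q' ∈ avoiding k)
    (h1 : q ≠ 1 ∨ i = i') (h : sandwich k i j q = sandwich k i' j' q') :
    q = q' ∧ i = i' ∧ j = j' := by
  have h2 := congrArg (sandwich k i' j') h
  rw [sandwich_sandwich, sandwich_sandwich, Bool.xor_self, Bool.xor_self,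
    sandwich_false_false] at h2
  have h3 : (i' ^^ i) = false ∧ (j' ^^ j) = false := by
    rw [← h2] at hq'
    cases hi : (i' ^^ i) <;> cases hj : (j' ^^ j) <;> simp only [hi, hj, sandwich] at hq'
    · simp
    · simp only [Bool.false_eq_true, if_false, if_true, one_mul] at hq'
      rw [Subgroup.mul_mem_cancel_left _ hq] at hq'
      exact absurd hq' (simple_notMem_avoiding k)
    · simp only [Bool.false_eq_true, if_false, if_true, mul_one] at hq'
      rw [Subgroup.mul_mem_cancel_right _ hq] at hq'
      exact absurd hq' (simple_notMem_avoiding k)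
    · simp only [if_true] at hq'
      rcases h1 with h1 | h1
      · exact absurd (eq_one_of_conj_mem hq hq') h1
      · simp [h1] at hi
  rw [h3.1, h3.2, sandwich_false_false] at h2
  refine ⟨h2, ?_, ?_⟩
  · exact (by simpa using h3.1 : i' = i).symm
  · exact (by simpa using h3.2 : j' = j).symm

/-- The word of `sandwich`. -/
def sandwichWord (k : ℕ) (i j : Bool) (ω : List ℕ) : List ℕ :=
  (if i then [k] else []) ++ (ω ++ if j then [k] else [])

theorem wordProd_sandwichWord (i j : Bool) (ω : List ℕ) :
    completeThreeSystem.wordProd (sandwichWord k i j ω) =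
      sandwich k i j (completeThreeSystem.wordProd ω) := by
  cases i <;> cases j <;> simp [sandwich, sandwichWord, wordProd_append, wordProd_cons, mul_assoc]

theorem length_sandwich {i j : Bool} (hq : q ∈ avoiding k) (h : q ≠ 1 ∨ i = false ∨ j = false) :
    completeThreeSystem.length (sandwich k i j q) =
      completeThreeSystem.length q + j.toNat + i.toNat := by
  cases i <;> cases j
  · simp [sandwich]
  · simpa [sandwich] using length_mul_simple_of_mem hq
  · simpa [sandwich] using length_simple_mul_of_mem hq
  · simpa [sandwich] using length_conj hq (by simpa using h)

theorem isReduced_sandwichWord {i j : Bool} {ω : List ℕ} (hω : k ∉ ω)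
    (hr : completeThreeSystem.IsReduced ω)
    (h : completeThreeSystem.wordProd ω ≠ 1 ∨ i = false ∨ j = false) :
    completeThreeSystem.IsReduced (sandwichWord k i j ω) := by
  rw [CoxeterSystem.IsReduced, wordProd_sandwichWord,
    length_sandwich (wordProd_mem_avoiding hω) h, hr.eq]
  cases i <;> cases j <;> simp [sandwichWord]

/-- A subword of the reduced word with outer letters `k` splits into its outer and middle parts. The
side condition excludes `s_k · 1 · s_k`, whose word is not reduced. -/
theorem bruhatLE_sandwich_iff {i j : Bool} (hq : q ∈ avoiding k)
    (h : q ≠ 1 ∨ i = false ∨ j = false) {v : completeThree.Group} :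
    completeThreeSystem.BruhatLE v (sandwich k i j q) ↔
      ∃ i' j' q', i' ≤ i ∧ j' ≤ j ∧ completeThreeSystem.BruhatLE q' q ∧
        v = sandwich k i' j' q' := by
  obtain ⟨ω, hω, hr, rfl⟩ := exists_isReduced_of_mem_avoiding hq
  have hred := isReduced_sandwichWord hω hr h
  constructor
  · intro hv
    obtain ⟨η, hs, hrη, rfl⟩ := hv _ hred (wordProd_sandwichWord i j ω)
    obtain ⟨η₁, η', rfl, hs1, hs'⟩ := List.sublist_append_iff.1 hs
    obtain ⟨η₂, η₃, rfl, hs2, hs3⟩ := List.sublist_append_iff.1 hs'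
    have hsub : ∀ (b : Bool) (l : List ℕ), l.Sublist (if b then [k] else []) →
        ∃ b' ≤ b, l = if b' then [k] else [] := by
      intro b l hl
      cases b
      · exact ⟨false, le_rfl, by simpa using hl⟩
      · rcases List.sublist_singleton.1 hl with rfl | rfl
        · exact ⟨false, by simp, rfl⟩
        · exact ⟨true, le_rfl, rfl⟩
    obtain ⟨i', hi', rfl⟩ := hsub i η₁ hs1
    obtain ⟨j', hj', rfl⟩ := hsub j η₃ hs3
    exact ⟨i', j', completeThreeSystem.wordProd η₂, hi', hj', bruhatLE_of_sublist hr hs2,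
      wordProd_sandwichWord i' j' η₂⟩
  · rintro ⟨i', j', q', hi', hj', hq', rfl⟩
    obtain ⟨η, hs, -, rfl⟩ := hq' ω hr rfl
    rw [← wordProd_sandwichWord, ← wordProd_sandwichWord]
    refine bruhatLE_of_sublist hred ?_
    have hsub : ∀ b' b : Bool, b' ≤ b →
        (if b' then [k] else [] : List ℕ).Sublist (if b then [k] else []) := by
      intro b' b hb
      cases b' <;> cases b <;> first | exact absurd hb (by decide) | simp
    exact (hsub _ _ hi').append (hs.append (hsub _ _ hj'))

end CompleteThree

/-! ### The ab-indices of lower intervals below sandwiches -/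

namespace CompleteThree

open CoxeterSystem

variable {k : ℕ} {q q' w : completeThree.Group}

theorem sandwich_one (k : ℕ) (i j : Bool) : sandwich k i j 1 = sandwich k false (i ^^ j) 1 := by
  cases i <;> cases j <;> simp [sandwich]

theorem sandwich_le_sandwich_iff {i j i' j' : Bool} (hq : q ∈ avoiding k) (hq' : q' ∈ avoiding k)
    (h : q ≠ 1 ∨ i = false ∧ i' = false) (h' : q' ≠ 1 ∨ i' = false ∨ j' = false) :
    completeThreeSystem.BruhatLE (sandwich k i j q) (sandwich k i' j' q') ↔
      i ≤ i' ∧ j ≤ j' ∧ completeThreeSystem.BruhatLE q q' := by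
  rw [bruhatLE_sandwich_iff hq' h']
  constructor
  · rintro ⟨i₁, j₁, q₁, hi, hj, hle, he⟩
    obtain ⟨rfl, rfl, rfl⟩ := sandwich_injective hq (mem_avoiding_of_le hq' hle)
      (h.imp_right fun h => by rw [h.1]; exact (Bool.eq_false_of_le_false (h.2 ▸ hi)).symm) he
    exact ⟨hi, hj, hle⟩
  · rintro ⟨hi, hj, hle⟩
    exact ⟨i, j, q, hi, hj, hle, rfl⟩

variable (R : Type*) [CommRing R]

/-- The lower interval is the product of `[1, w]` with a two-element chain that records the presence
of the last letter. -/
theorem psi_mul_simple (hw : w ∈ avoiding k) (hw1 : w ≠ 1) :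
    psi R Bruhat.rank (completeThreeSystem.toBruhat 1)
        (completeThreeSystem.toBruhat (w * completeThreeSystem.simple k)) =
      ABPoly.pyr R (psi R Bruhat.rank (completeThreeSystem.toBruhat 1)
        (completeThreeSystem.toBruhat w)) := by
  classical
  let _ : LocallyFiniteOrder Bool := Fintype.toLocallyFiniteOrder
  have h1w : completeThreeSystem.toBruhat 1 < completeThreeSystem.toBruhat w :=
    lt_of_le_of_ne (one_bruhatLE w) fun h => hw1 (toBruhat_inj.1 h).symm
  let φ : completeThreeSystem.Bruhat × Bool → completeThreeSystem.Bruhat :=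
    fun p => completeThreeSystem.toBruhat (sandwich k false p.2 p.1.val)
  have hφ1 : φ (completeThreeSystem.toBruhat 1, false) = completeThreeSystem.toBruhat 1 :=
    sandwich_false_false 1
  have hφw : φ (completeThreeSystem.toBruhat w, true) =
      completeThreeSystem.toBruhat (w * completeThreeSystem.simple k) := by
    simp only [φ, sandwich, Bool.false_eq_true, if_false, if_true, one_mul]
    rfl
  have hmem : ∀ z ∈ Finset.Icc (completeThreeSystem.toBruhat 1, false)
      (completeThreeSystem.toBruhat w, true), z.1.val ∈ avoiding k := fun z hz =>
    mem_avoiding_of_le hw (Finset.mem_Icc.1 hz).2.1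
  rw [← psi_false_true Bruhat.rank_strictMono h1w, ← hφ1, ← hφw]
  refine psi_map φ 0 ⟨h1w.le, Bool.false_le _⟩ ?_ ?_ ?_
  · intro z hz z' hz'
    refine (sandwich_le_sandwich_iff (hmem z hz) (hmem z' hz') (Or.inr ⟨rfl, rfl⟩)
      (Or.inr (Or.inl rfl))).trans ⟨fun h => ⟨h.2.2, h.2.1⟩, fun h => ⟨le_rfl, h.2, h.1⟩⟩
  · intro v hv
    obtain ⟨i, j, q, hi, hj, hq, he⟩ := (bruhatLE_sandwich_iff hw (Or.inr (Or.inl rfl))).1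
      (Finset.mem_Icc.1 hv).2
    refine ⟨(completeThreeSystem.toBruhat q, j),
      Finset.mem_Icc.2 ⟨⟨one_bruhatLE q, Bool.false_le _⟩, hq, hj⟩, ?_⟩
    rw [Bool.eq_false_of_le_false hi] at he
    exact he.symm
  · intro z hz
    exact length_sandwich (hmem z hz) (Or.inr (Or.inl rfl))

/-- In `[1, w]` times two two-element chains, the map to the Bruhat interval identifies `s_k · 1`
with `1 · s_k` and has to drop `s_k · 1 · s_k`, which is their join. This is a zip, and the interval
above that join is a copy of `[1, w]`. -/
theorem psi_simple_mul_mul_simple (hw : w ∈ avoiding k) (hw1 : w ≠ 1) :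
    psi R Bruhat.rank (completeThreeSystem.toBruhat 1) (completeThreeSystem.toBruhat
        (completeThreeSystem.simple k * w * completeThreeSystem.simple k)) =
      ABPoly.pyr R (ABPoly.pyr R (psi R Bruhat.rank (completeThreeSystem.toBruhat 1)
        (completeThreeSystem.toBruhat w))) -
      CDLetter.toAB R .d * psi R Bruhat.rank (completeThreeSystem.toBruhat 1)
        (completeThreeSystem.toBruhat w) := by
  classical
  let _ : LocallyFiniteOrder Bool := Fintype.toLocallyFiniteOrder
  let e : completeThreeSystem.Bruhat := completeThreeSystem.toBruhat 1
  let w' : completeThreeSystem.Bruhat := completeThreeSystem.toBruhat w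
  have h1w : e < w' :=
    lt_of_le_of_ne (one_bruhatLE w) fun h => hw1 (toBruhat_inj.1 h).symm
  have hbot : ∀ v : completeThreeSystem.Bruhat, e ≤ v := fun v => one_bruhatLE v.val
  let φ : (completeThreeSystem.Bruhat × Bool) × Bool → completeThreeSystem.Bruhat :=
    fun p => completeThreeSystem.toBruhat (sandwich k p.2 p.1.2 p.1.1.val)
  let s : completeThreeSystem.Bruhat := completeThreeSystem.toBruhat (sandwich k false true 1)
  have hφo : φ ((e, false), false) = e := sandwich_false_false 1
  have hφt : φ ((w', true), true) = completeThreeSystem.toBruhat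
      (completeThreeSystem.simple k * w * completeThreeSystem.simple k) := rfl
  have h1mem : (1 : completeThree.Group) ∈ avoiding k := one_mem _
  -- the elements of the product poset on which `φ` is an isomorphism
  have hsurj : ∀ v, v ≤ φ ((w', true), true) → (∃ j, v =
      completeThreeSystem.toBruhat (sandwich k false j 1)) ∨
      ∃ a : (completeThreeSystem.Bruhat × Bool) × Bool, a ≤ ((w', true), true) ∧ a.1.1 ≠ e ∧
        φ a = v := by
    intro v hv
    obtain ⟨i, j, q, -, -, hq, he⟩ := (bruhatLE_sandwich_iff hw (Or.inl hw1)).1 hv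
    by_cases hq1 : q = 1
    · rw [hq1, sandwich_one] at he
      exact Or.inl ⟨_, he⟩
    · exact Or.inr ⟨((completeThreeSystem.toBruhat q, j), i),
        ⟨⟨hq, Bool.le_true _⟩, Bool.le_true _⟩, fun h => hq1 (toBruhat_inj.1 h), he.symm⟩
  have hmem : ∀ a : (completeThreeSystem.Bruhat × Bool) × Bool, a ≤ ((w', true), true) →
      a.1.1.val ∈ avoiding k := fun a ha => mem_avoiding_of_le hw ha.1.1
  have hle : ∀ a a' : (completeThreeSystem.Bruhat × Bool) × Bool, a ≤ ((w', true), true) →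
      a.1.1 ≠ e → a' ≤ ((w', true), true) → a'.1.1 ≠ e → (φ a ≤ φ a' ↔ a ≤ a') := by
    intro a a' ha hae ha' hae'
    exact (sandwich_le_sandwich_iff (hmem a ha) (hmem a' ha') (Or.inl hae) (Or.inl hae')).trans
      ⟨fun h => ⟨⟨h.2.2, h.2.1⟩, h.1⟩, fun h => ⟨h.2, h.1.2, h.1.1⟩⟩
  have hinj : ∀ a a' : (completeThreeSystem.Bruhat × Bool) × Bool, a ≤ ((w', true), true) →
      a.1.1 ≠ e → a' ≤ ((w', true), true) → a'.1.1 ≠ e → φ a = φ a' → a = a' := by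
    intro a a' ha hae ha' hae' h
    exact le_antisymm ((hle a a' ha hae ha' hae').1 h.le) ((hle a' a ha' hae' ha hae).1 h.ge)
  have hne : ∀ (a : (completeThreeSystem.Bruhat × Bool) × Bool) (j : Bool),
      a ≤ ((w', true), true) → a.1.1 ≠ e →
      φ a ≠ completeThreeSystem.toBruhat (sandwich k false j 1) := by
    intro a j ha hae h
    exact hae (sandwich_injective (hmem a ha) h1mem (Or.inl hae) h).1
  have hnle : ∀ (a : (completeThreeSystem.Bruhat × Bool) × Bool) (j : Bool),
      a ≤ ((w', true), true) → a.1.1 ≠ e →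
      ¬ φ a ≤ completeThreeSystem.toBruhat (sandwich k false j 1) := by
    intro a j ha hae h
    have h' := (sandwich_le_sandwich_iff (hmem a ha) h1mem (Or.inl hae) (Or.inr (Or.inl rfl))).1 h
    exact hae (le_antisymm h'.2.2 (hbot _))
  have hrank : ∀ a : (completeThreeSystem.Bruhat × Bool) × Bool, a ≤ ((w', true), true) →
      a.1.1 ≠ e → (φ a).rank = rankBool (rankBool Bruhat.rank) a := fun a ha hae =>
    length_sandwich (hmem a ha) (Or.inl hae)
  have hse : s ≠ e := by
    intro h
    have := (sandwich_injective h1mem h1mem (Or.inr rfl)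
      ((toBruhat_inj.1 h).trans (sandwich_false_false (k := k) 1).symm)).2.2
    simp at this
  -- The zipped atom `s_k` lies below exactly the elements having an outer factor on at least one
  -- side.
  have hss : ∀ a : (completeThreeSystem.Bruhat × Bool) × Bool, a ≤ ((w', true), true) →
      a.1.1 ≠ e → (s ≤ φ a ↔ a.1.2 = true ∨ a.2 = true) := by
    intro a ha hae
    refine (bruhatLE_sandwich_iff (hmem a ha) (Or.inl hae)).trans ⟨?_, ?_⟩
    · rintro ⟨i, j, q, hi, hj, hq, he⟩
      by_contra hcon
      rw [not_or, Bool.not_eq_true, Bool.not_eq_true] at hcon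
      rw [hcon.2] at hi
      rw [hcon.1] at hj
      rw [Bool.eq_false_of_le_false hi, Bool.eq_false_of_le_false hj] at he
      have := (sandwich_injective h1mem (mem_avoiding_of_le (hmem a ha) hq) (Or.inr rfl) he).2.2
      simp at this
    · rintro (h | h)
      · exact ⟨false, true, 1, Bool.false_le _, h.ge, one_bruhatLE _, rfl⟩
      · exact ⟨true, false, 1, h.ge, Bool.false_le _, one_bruhatLE _,
          (sandwich_one k true false).symm⟩
  have hte : ((w', true), true).1.1 ≠ e := h1w.ne'
  let A := (Finset.Ioo ((e, false), false) ((w', true), true)).filter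
    fun a => a ≠ ((e, true), false) ∧ a ≠ ((e, false), true) ∧ a ≠ ((e, true), true)
  have hA : ∀ a, a ∈ A ↔ (((e, false), false) < a ∧ a < ((w', true), true)) ∧
      a ≠ ((e, true), false) ∧ a ≠ ((e, false), true) ∧ a ≠ ((e, true), true) := by
    intro a
    rw [Finset.mem_filter, Finset.mem_Ioo]
  have hA' : ∀ a, a ∈ A ↔ a ≤ ((w', true), true) ∧ a ≠ ((w', true), true) ∧ a.1.1 ≠ e := by
    intro a
    rw [hA]
    constructor
    · rintro ⟨⟨h1, h2⟩, h3, h4, h5⟩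
      refine ⟨h2.le, h2.ne, ?_⟩
      obtain ⟨⟨q, j⟩, i⟩ := a
      rintro rfl
      cases i <;> cases j
      · exact h1.ne rfl
      · exact h3 rfl
      · exact h4 rfl
      · exact h5 rfl
    · rintro ⟨h1, h2, h3⟩
      refine ⟨⟨lt_of_le_of_ne ⟨⟨hbot _, Bool.false_le _⟩, Bool.false_le _⟩ ?_,
        lt_of_le_of_ne h1 h2⟩, ?_, ?_, ?_⟩ <;> rintro rfl <;> exact h3 rfl
  have hlt : ∀ i j i' j' : Bool, i ≤ i' → j ≤ j' → ((i, j) ≠ (i', j')) →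
      (((e, j), i) : (completeThreeSystem.Bruhat × Bool) × Bool) < ((e, j'), i') := by
    intro i j i' j' hi hj h
    refine lt_of_le_of_ne ⟨⟨le_rfl, hj⟩, hi⟩ fun he => h ?_
    rw [Prod.mk.injEq, Prod.mk.injEq] at he
    rw [he.1.2, he.2]
  have hIoo : ∀ v, φ ((e, false), false) < v ∧ v < φ ((w', true), true) ↔
      v = s ∨ ∃ a ∈ A, φ a = v := by
    intro v
    rw [hφo]
    constructor
    · rintro ⟨h1, h2⟩
      rcases hsurj v h2.le with ⟨j, rfl⟩ | ⟨a, ha, hae, rfl⟩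
      · cases j
        · exact absurd (sandwich_false_false (k := k) 1).symm h1.ne
        · exact Or.inl rfl
      · exact Or.inr ⟨a, (hA' a).2 ⟨ha, fun h => h2.ne (by rw [h]), hae⟩, rfl⟩
    · rintro (rfl | ⟨a, ha, rfl⟩)
      · exact ⟨lt_of_le_of_ne (hbot _) hse.symm, lt_of_le_of_ne
          ((hss _ le_rfl hte).2 (Or.inl rfl)) (hne _ true le_rfl hte).symm⟩
      · rw [hA'] at ha
        refine ⟨lt_of_le_of_ne (hbot _) fun h => hne a false ha.1 ha.2.2
          (h.symm.trans (sandwich_false_false (k := k) 1).symm),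
          lt_of_le_of_ne ((hle _ _ ha.1 ha.2.2 le_rfl hte).2 ha.1) fun h =>
          ha.2.1 (hinj _ _ ha.1 ha.2.2 le_rfl hte h)⟩
  -- The zipped atoms are the bottom element with exactly one flag raised; their join has both
  -- raised.
  have key := psi_zip (R := R) (ρ := rankBool (rankBool Bruhat.rank)) (σ := Bruhat.rank) φ
    (s := s) hA (by simp) (hlt _ _ _ _ le_rfl (Bool.false_le _) (by simp))
    (hlt _ _ _ _ (Bool.false_le _) le_rfl (by simp))
    (hlt _ _ _ _ (Bool.false_le _) le_rfl (by simp))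
    (hlt _ _ _ _ le_rfl (Bool.false_le _) (by simp))
    (lt_of_le_of_ne ⟨⟨h1w.le, le_rfl⟩, le_rfl⟩ fun h => hte (congrArg (fun a => a.1.1) h).symm)
    (fun a hx hy => ⟨⟨hbot _, hx.le.1.2⟩, hy.le.2⟩) rfl rfl rfl
    (rankBool_strictMono (rankBool_strictMono Bruhat.rank_strictMono))
    (fun a ha a' ha' h => by
      rw [Finset.mem_coe, hA'] at ha ha'
      exact hinj _ _ ha.1 ha.2.2 ha'.1 ha'.2.2 h)
    (fun a ha => by
      rw [hA'] at ha
      exact hne a true ha.1 ha.2.2)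
    hIoo ?_ ?_ ?_ ?_ ?_ ?_
  · rw [hφo, hφt] at key
    rw [key, psi_false_true (rankBool_strictMono Bruhat.rank_strictMono)
      (lt_of_le_of_ne ⟨h1w.le, Bool.false_le _⟩ (by simp)),
      psi_false_true Bruhat.rank_strictMono h1w, psi_true_true (x := (e, true)) (y := (w', true))
        (Prod.mk_le_mk.2 ⟨h1w.le, le_rfl⟩),
      psi_true_true h1w.le]
  · intro v
    constructor
    · rintro ⟨h1, h2⟩
      rcases (hIoo v).1 ⟨lt_of_le_of_lt (by rw [hφo]; exact hbot _) h1, h2⟩ with rfl | ⟨a, ha, rfl⟩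
      · exact absurd h1 (lt_irrefl _)
      · refine ⟨a, ha, ?_, rfl⟩
        rw [hA'] at ha
        refine ((hss a ha.1 ha.2.2).1 h1.le).imp (fun h => ?_) fun h => ?_
        · refine lt_of_le_of_ne ⟨⟨hbot _, h.ge⟩, Bool.false_le _⟩ ?_
          rintro rfl
          exact ha.2.2 rfl
        · refine lt_of_le_of_ne ⟨⟨hbot _, Bool.false_le _⟩, h.ge⟩ ?_
          rintro rfl
          exact ha.2.2 rfl
    · rintro ⟨a, ha, h, rfl⟩
      refine ⟨?_, ((hIoo _).2 (Or.inr ⟨a, ha, rfl⟩)).2⟩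
      rw [hA'] at ha
      exact lt_of_le_of_ne ((hss a ha.1 ha.2.2).2 (h.imp
        (fun h => Bool.eq_true_of_true_le h.le.1.2) fun h => Bool.eq_true_of_true_le h.le.2))
        (hne a true ha.1 ha.2.2).symm
  · intro a ha
    rw [hA'] at ha
    have hge : ∀ b, a ≤ b → b.1.1 ≠ e := fun b hb hbe =>
      ha.2.2 (le_antisymm (hb.1.1.trans hbe.le) (hbot _))
    refine psi_map φ 0 ha.1 (fun b hb b' hb' => ?_) (fun v hv => ?_) fun b hb => ?_
    · rw [Finset.mem_Icc] at hb hb'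
      exact hle b b' hb.2 (hge b hb.1) hb'.2 (hge b' hb'.1)
    · rw [Finset.mem_Icc] at hv
      rcases hsurj v hv.2 with ⟨j, rfl⟩ | ⟨b, hb, hbe, rfl⟩
      · exact absurd hv.1 (hnle a j ha.1 ha.2.2)
      · exact ⟨b, Finset.mem_Icc.2 ⟨(hle a b ha.1 ha.2.2 hb hbe).1 hv.1, hb⟩, rfl⟩
    · rw [Finset.mem_Icc] at hb
      exact hrank b hb.2 (hge b hb.1)
  · intro a ha
    rw [hA'] at ha
    exact hrank a ha.1 ha.2.2
  · rw [hφo]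
    rfl
  · exact hrank _ le_rfl hte
  · exact length_sandwich h1mem (Or.inr (Or.inl rfl))

end CompleteThree

/-! ### The explicit family -/

/-- The affine space of monic cd-polynomials. -/
def CDPoly.monicAffine (R : Type*) [CommRing R] (n : ℕ) : AffineSubspace R (CDPoly R) where
  carrier := CDPoly.monic R n
  smul_vsub_vadd_mem' r p q s hp hq hs := by
    rw [CDPoly.mem_monic] at hp hq hs ⊢
    rw [vsub_eq_sub, vadd_eq_add]
    refine ⟨add_mem (Submodule.smul_mem _ r (sub_mem hp.1 hq.1)) hs.1, ?_⟩
    simp [hp.2, hq.2, hs.2]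

theorem wordProd_ne_one_of_isReduced {B W : Type*} [Group W] {M : CoxeterMatrix B}
    {cs : CoxeterSystem M W} {ω : List B} (h : cs.IsReduced ω) (hω : ω ≠ []) :
    cs.wordProd ω ≠ 1 := by
  intro h1
  have := h.eq
  rw [h1, cs.length_one] at this
  exact hω (List.length_eq_zero_iff.1 this.symm)

namespace CompleteThree

open CoxeterSystem

theorem fibWords_spec (n : ℕ) : ∀ ω ∈ fibWords n,
    (∀ i ∈ ω, i < n) ∧ ω.length = n ∧ completeThreeSystem.IsReduced ω := by
  have h1 : completeThreeSystem.IsReduced [0] := by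
    rw [CoxeterSystem.IsReduced, wordProd_singleton, length_simple, List.length_singleton]
  induction n using Nat.strong_induction_on with
  | _ n ih =>
  match n with
  | 0 => simp [fibWords]
  | 1 =>
    intro ω hω
    rw [fibWords, Finset.mem_singleton] at hω
    subst hω
    exact ⟨by simp, rfl, h1⟩
  | 2 =>
    intro ω hω
    rw [fibWords, Finset.mem_singleton] at hω
    subst hω
    refine ⟨by simp, rfl, ?_⟩
    exact isReduced_sandwichWord (k := 1) (i := false) (j := true) (by simp) h1
      (Or.inr (Or.inl rfl))
  | n + 3 =>
    intro ω hω
    rw [fibWords, Finset.mem_union, Finset.mem_image, Finset.mem_image] at hω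
    rcases hω with ⟨ω, hω, rfl⟩ | ⟨ω, hω, rfl⟩
    · obtain ⟨hlt, hl, hr⟩ := ih (n + 2) (by omega) ω hω
      refine ⟨fun i hi => ?_, by simp [hl], ?_⟩
      · rcases List.mem_append.1 hi with hi | hi
        · have := hlt i hi
          omega
        · rw [List.mem_singleton.1 hi]
          omega
      · exact isReduced_sandwichWord (k := n + 2) (i := false) (j := true)
          (fun h => (hlt _ h).false) hr (Or.inr (Or.inl rfl))
    · obtain ⟨hlt, hl, hr⟩ := ih (n + 1) (by omega) ω hω
      refine ⟨fun i hi => ?_, by simp [hl], ?_⟩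
      · rcases List.mem_cons.1 hi with rfl | hi
        · omega
        rcases List.mem_append.1 hi with hi | hi
        · have := hlt i hi
          omega
        · rw [List.mem_singleton.1 hi]
          omega
      · refine isReduced_sandwichWord (k := n + 2) (i := true) (j := true)
          (fun h => ?_) hr (Or.inl (wordProd_ne_one_of_isReduced hr ?_))
        · have := hlt _ h
          omega
        · rintro rfl
          simp at hl

theorem notMem_of_mem_fibWords {n k : ℕ} {ω : List ℕ} (h : ω ∈ fibWords n) (hk : n ≤ k) :
    k ∉ ω := fun hi => (((fibWords_spec n ω h).1 k hi).trans_le hk).false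

/-- The first letter tells the two halves of the recursive union apart, since the new generator does
not occur in older words. -/
theorem head?_append_ne {n : ℕ} {ω : List ℕ} (h : ω ∈ fibWords (n + 2)) :
    (ω ++ [n + 2]).head? ≠ some (n + 2) := by
  obtain ⟨hlt, hl, -⟩ := fibWords_spec _ ω h
  cases ω with
  | nil => simp at hl
  | cons i ω =>
    have := hlt i (by simp)
    simp only [List.cons_append, List.head?_cons, ne_eq, Option.some.injEq]
    omega

theorem append_injective (k : ℕ) : Function.Injective fun ω : List ℕ => ω ++ [k] :=
  fun _ _ h => List.append_cancel_right h

theorem cons_append_injective (k : ℕ) : Function.Injective fun ω : List ℕ => k :: (ω ++ [k]) :=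
  fun _ _ h => append_injective k (List.cons.inj h).2

theorem disjoint_fibWords (n : ℕ) :
    Disjoint ((fibWords (n + 2)).image fun ω => ω ++ [n + 2])
      ((fibWords (n + 1)).image fun ω => (n + 2) :: (ω ++ [n + 2])) := by
  rw [Finset.disjoint_left]
  intro ω h h'
  obtain ⟨ω, hω, rfl⟩ := Finset.mem_image.1 h
  obtain ⟨η, -, hη⟩ := Finset.mem_image.1 h'
  exact head?_append_ne hω (by rw [← hη]; rfl)

theorem card_fibWords (n : ℕ) : (fibWords n).card = Nat.fib n := by
  induction n using Nat.strong_induction_on with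
  | _ n ih =>
  match n with
  | 0 => rfl
  | 1 => rfl
  | 2 => rfl
  | n + 3 =>
    rw [fibWords, Finset.card_union_of_disjoint (disjoint_fibWords n),
      Finset.card_image_of_injective _ (append_injective _),
      Finset.card_image_of_injective _ (cons_append_injective _), ih _ (by omega),
      ih _ (by omega), Nat.fib_add_two (n := n + 1), add_comm]

variable (R : Type*) [CommRing R]

/-- The cd-index of the lower interval below the product of a word of length `n + 1`. -/
noncomputable def lowerCDIndex (n : ℕ) (ω : List ℕ) : CDPoly R :=
  cdIndex R (completeThreeSystem.BruhatInterval 1 (completeThreeSystem.wordProd ω)) n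

variable {R} {k n : ℕ} {ω : List ℕ}

theorem isCDIndex_lowerCDIndex (hr : completeThreeSystem.IsReduced ω) (hl : ω.length = n + 1) :
    IsCDIndex (completeThreeSystem.BruhatInterval 1 (completeThreeSystem.wordProd ω)) n
      (lowerCDIndex R n ω) :=
  isCDIndex_cdIndex R (one_bruhatLE _) (by rw [hr.eq, hl, length_one, zero_add])

theorem toAB_lowerCDIndex (hr : completeThreeSystem.IsReduced ω) (hl : ω.length = n + 1) :
    CDPoly.toAB R (lowerCDIndex R n ω) = psi R Bruhat.rank (completeThreeSystem.toBruhat 1)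
      (completeThreeSystem.toBruhat (completeThreeSystem.wordProd ω)) :=
  toAB_cdIndex R (one_bruhatLE _) (by rw [hr.eq, hl, length_one, zero_add])

theorem lowerCDIndex_append (hr : completeThreeSystem.IsReduced ω) (hl : ω.length = n + 1)
    (hk : k ∉ ω) : lowerCDIndex R (n + 1) (ω ++ [k]) = CDPoly.pyr R (lowerCDIndex R n ω) := by
  have h1 : completeThreeSystem.wordProd ω ≠ 1 := wordProd_ne_one_of_isReduced hr <| by
    rintro rfl
    simp at hl
  apply CDPoly.toAB_injective
  rw [CDPoly.toAB_pyr, toAB_lowerCDIndex hr hl, toAB_lowerCDIndex _ (by simp [hl]),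
    wordProd_append, wordProd_singleton, psi_mul_simple R (wordProd_mem_avoiding hk) h1]
  exact isReduced_sandwichWord (i := false) (j := true) hk hr (Or.inr (Or.inl rfl))

theorem lowerCDIndex_cons_append (hr : completeThreeSystem.IsReduced ω) (hl : ω.length = n + 1)
    (hk : k ∉ ω) : lowerCDIndex R (n + 2) (k :: (ω ++ [k])) =
      CDPoly.pyr R (CDPoly.pyr R (lowerCDIndex R n ω)) -
        CDPoly.var R .d * lowerCDIndex R n ω := by
  have h1 : completeThreeSystem.wordProd ω ≠ 1 := wordProd_ne_one_of_isReduced hr <| by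
    rintro rfl
    simp at hl
  apply CDPoly.toAB_injective
  rw [map_sub, map_mul, CDPoly.toAB_var, CDPoly.toAB_pyr, CDPoly.toAB_pyr,
    toAB_lowerCDIndex hr hl, toAB_lowerCDIndex _ (by simp [hl]), wordProd_cons,
    wordProd_append, wordProd_singleton, ← mul_assoc,
    psi_simple_mul_mul_simple R (wordProd_mem_avoiding hk) h1]
  exact isReduced_sandwichWord (i := true) (j := true) hk hr (Or.inl h1)

theorem lowerCDIndex_mem_monic (h : ω ∈ fibWords (n + 1)) :
    lowerCDIndex R n ω ∈ CDPoly.monic R n :=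
  have h := fibWords_spec _ ω h
  (isCDIndex_lowerCDIndex h.2.2 h.2.1).mem_monic

theorem lowerCDIndex_zero : lowerCDIndex R 0 [0] = 1 := by
  obtain ⟨h1, h2⟩ := CDPoly.mem_monic.1
    (lowerCDIndex_mem_monic (R := R) (n := 0) (ω := [0]) (by simp [fibWords]))
  obtain ⟨r, hr⟩ := CDPoly.mem_homogeneous_zero_iff.1 h1
  rw [hr, pow_zero, coeff_algebraMap_one] at h2
  rw [hr, h2, map_one]

theorem lowerCDIndex_one : lowerCDIndex R 1 [0, 1] = CDPoly.var R .c := by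
  have h := fibWords_spec 1 [0] (by simp [fibWords])
  have := lowerCDIndex_append (R := R) (k := 1) (n := 0) h.2.2 h.2.1 (by simp)
  rw [lowerCDIndex_zero, CDPoly.pyr_one] at this
  exact this

/-- With `A` and `B` the combinations over the two preceding families, this is the map `(X, Y) ↦ pyr
X + dY` at `X = A + pyr B`, `Y = -B`, an invertible change of `(A, B)`. -/
theorem sum_fibWords (n : ℕ) (g : List ℕ → R) :
    ∑ ω ∈ fibWords (n + 3), g ω • lowerCDIndex R (n + 2) ω =
      CDPoly.pyr R (∑ ω ∈ fibWords (n + 2), g (ω ++ [n + 2]) • lowerCDIndex R (n + 1) ω +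
        CDPoly.pyr R (∑ ω ∈ fibWords (n + 1),
          g ((n + 2) :: (ω ++ [n + 2])) • lowerCDIndex R n ω)) +
      CDPoly.var R .d * -∑ ω ∈ fibWords (n + 1),
        g ((n + 2) :: (ω ++ [n + 2])) • lowerCDIndex R n ω := by
  rw [fibWords, Finset.sum_union (disjoint_fibWords n),
    Finset.sum_image fun _ _ _ _ h => append_injective _ h,
    Finset.sum_image fun _ _ _ _ h => cons_append_injective _ h]
  have h1 : ∀ ω ∈ fibWords (n + 2), g (ω ++ [n + 2]) • lowerCDIndex R (n + 2) (ω ++ [n + 2]) =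
      CDPoly.pyr R (g (ω ++ [n + 2]) • lowerCDIndex R (n + 1) ω) := by
    intro ω hω
    have h := fibWords_spec _ ω hω
    rw [lowerCDIndex_append h.2.2 h.2.1 (notMem_of_mem_fibWords hω le_rfl), map_smul]
  have h2 : ∀ ω ∈ fibWords (n + 1), g ((n + 2) :: (ω ++ [n + 2])) •
      lowerCDIndex R (n + 2) ((n + 2) :: (ω ++ [n + 2])) =
      CDPoly.pyr R (CDPoly.pyr R (g ((n + 2) :: (ω ++ [n + 2])) • lowerCDIndex R n ω)) +
        CDPoly.var R .d * -(g ((n + 2) :: (ω ++ [n + 2])) • lowerCDIndex R n ω) := by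
    intro ω hω
    have h := fibWords_spec _ ω hω
    rw [lowerCDIndex_cons_append h.2.2 h.2.1 (notMem_of_mem_fibWords hω (Nat.le_succ _)),
      map_smul, map_smul, smul_sub, mul_neg, mul_smul_comm, sub_eq_add_neg]
  rw [Finset.sum_congr rfl h1, Finset.sum_congr rfl h2, Finset.sum_add_distrib, map_add, map_sum,
    map_sum, map_sum, ← Finset.mul_sum, Finset.sum_neg_distrib, add_assoc]

theorem eq_zero_of_sum_fibWords_eq_zero (n : ℕ) (g : List ℕ → R)
    (h : ∑ ω ∈ fibWords (n + 1), g ω • lowerCDIndex R n ω = 0) :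
    ∀ ω ∈ fibWords (n + 1), g ω = 0 := by
  induction n using Nat.twoStepInduction generalizing g with
  | zero =>
    rw [fibWords, Finset.sum_singleton, lowerCDIndex_zero, ← Algebra.algebraMap_eq_smul_one] at h
    simp only [fibWords, Finset.mem_singleton, forall_eq]
    rw [← coeff_algebraMap_one (α := CDLetter) (g [0]), h]
    rfl
  | one =>
    rw [fibWords, Finset.sum_singleton, lowerCDIndex_one] at h
    simp only [fibWords, Finset.mem_singleton, forall_eq]
    have h' := CDPoly.coeff_var_mul_self (R := R) .c (algebraMap R _ (g [0, 1])) 1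
    rw [← Algebra.commutes, ← Algebra.smul_def, h, coeff_algebraMap_one] at h'
    exact h'.symm
  | more n ih1 ih2 =>
    rw [sum_fibWords] at h
    obtain ⟨h1, h2⟩ := CDPoly.eq_zero_of_pyr_add_d_mul_eq_zero h
    rw [neg_eq_zero] at h2
    rw [h2, map_zero, add_zero] at h1
    intro ω hω
    rw [fibWords, Finset.mem_union, Finset.mem_image, Finset.mem_image] at hω
    rcases hω with ⟨ω, hω, rfl⟩ | ⟨ω, hω, rfl⟩
    · exact ih2 (fun ω => g (ω ++ [n + 2])) h1 ω hω
    · exact ih1 (fun ω => g ((n + 2) :: (ω ++ [n + 2]))) h2 ω hω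

theorem exists_sum_fibWords_eq (n : ℕ) {Z : CDPoly R} (hZ : Z ∈ CDPoly.homogeneous R n) :
    ∃ g : List ℕ → R, ∑ ω ∈ fibWords (n + 1), g ω • lowerCDIndex R n ω = Z := by
  induction n using Nat.twoStepInduction generalizing Z with
  | zero =>
    obtain ⟨r, rfl⟩ := CDPoly.mem_homogeneous_zero_iff.1 hZ
    refine ⟨fun _ => r, ?_⟩
    rw [fibWords, Finset.sum_singleton, lowerCDIndex_zero, Algebra.algebraMap_eq_smul_one]
  | one =>
    obtain ⟨r, rfl⟩ := CDPoly.exists_of_mem_homogeneous_one hZ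
    refine ⟨fun _ => r, ?_⟩
    rw [fibWords, Finset.sum_singleton, lowerCDIndex_one, ← Algebra.commutes, Algebra.smul_def]
  | more n ih1 ih2 =>
    -- Inverting the change of variables gives `B = -Y` and `A = X - pyr B`.
    obtain ⟨X, hX, Y, hY, rfl⟩ := CDPoly.exists_pyr_add_d_mul_eq hZ
    obtain ⟨g₁, h1⟩ := ih1 (neg_mem hY)
    obtain ⟨g₂, h2⟩ := ih2 (sub_mem hX (CDPoly.pyr_mem_homogeneous (neg_mem hY)))
    -- The first letter decides which half a word belongs to; stripping the copies of the new
    -- generator recovers the older word.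
    refine ⟨fun ω => if ω.head? = some (n + 2) then g₁ ω.tail.dropLast else g₂ ω.dropLast, ?_⟩
    have h1' : ∑ ω ∈ fibWords (n + 1), (if ((n + 2) :: (ω ++ [n + 2])).head? = some (n + 2) then
        g₁ ((n + 2) :: (ω ++ [n + 2])).tail.dropLast else
        g₂ ((n + 2) :: (ω ++ [n + 2])).dropLast) • lowerCDIndex R n ω = -Y := by
      rw [← h1]
      refine Finset.sum_congr rfl fun ω _ => ?_
      rw [List.head?_cons, if_pos rfl, List.tail_cons, List.dropLast_concat]
    have h2' : ∑ ω ∈ fibWords (n + 2), (if (ω ++ [n + 2]).head? = some (n + 2) then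
        g₁ (ω ++ [n + 2]).tail.dropLast else
        g₂ (ω ++ [n + 2]).dropLast) • lowerCDIndex R (n + 1) ω = X - CDPoly.pyr R (-Y) := by
      rw [← h2]
      refine Finset.sum_congr rfl fun ω hω => ?_
      rw [if_neg (head?_append_ne hω), List.dropLast_concat]
    rw [sum_fibWords, h1', h2', sub_add_cancel, neg_neg]

theorem linearIndependent_lowerCDIndex (n : ℕ) :
    LinearIndependent R fun ω : fibWords (n + 1) => lowerCDIndex R n ω.1 := by
  classical
  rw [Fintype.linearIndependent_iff]
  intro g hg ω
  let g' : List ℕ → R := fun l => if h : l ∈ fibWords (n + 1) then g ⟨l, h⟩ else 0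
  have hg' : ∀ ω : fibWords (n + 1), g' ω.1 = g ω := fun ω => dif_pos ω.2
  rw [← hg']
  refine eq_zero_of_sum_fibWords_eq_zero n g' ?_ ω.1 ω.2
  rw [← hg, ← Finset.sum_coe_sort]
  simp only [hg']

/-- Comparing coefficients of `c ^ n` shows that the weights of a linear combination equal to a
monic polynomial sum to `1`, so it is affine. -/
theorem affineSpan_lowerCDIndex (n : ℕ) :
    (affineSpan R (Set.range fun ω : fibWords (n + 1) => lowerCDIndex R n ω.1) :
      Set (CDPoly R)) = CDPoly.monic R n := by
  apply Set.Subset.antisymm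
  · change affineSpan R _ ≤ CDPoly.monicAffine R n
    rw [affineSpan_le]
    rintro _ ⟨ω, rfl⟩
    exact lowerCDIndex_mem_monic ω.2
  · intro Z hZ
    rw [CDPoly.mem_monic] at hZ
    obtain ⟨g, hg⟩ := exists_sum_fibWords_eq n hZ.1
    rw [← Finset.sum_coe_sort] at hg
    have hsum : ∑ ω : fibWords (n + 1), g ω.1 = 1 := by
      rw [← hZ.2, ← hg, MonoidAlgebra.coeff_sum, Finsupp.finsetSum_apply]
      refine Finset.sum_congr rfl fun ω _ => ?_
      rw [MonoidAlgebra.coeff_smul, Finsupp.smul_apply,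
        (CDPoly.mem_monic.1 (lowerCDIndex_mem_monic ω.2)).2, smul_eq_mul, mul_one]
    rw [← Finset.affineCombination_eq_linear_combination _ _ _ hsum] at hg
    rw [← hg]
    -- Over the zero ring, weights summing to `1` do not rule out an empty family, so nonemptiness
    -- is taken from the Fibonacci count.
    have : Nonempty (fibWords (n + 1)) := by
      rw [Finset.nonempty_coe_sort, ← Finset.card_pos, card_fibWords]
      exact Nat.fib_pos.2 (Nat.succ_pos _)
    exact affineCombination_mem_affineSpan_of_nonempty hsum _

end CompleteThree

theorem mainTheorem6 (R : Type*) [CommRing R] :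
    -- every Bruhat interval has exactly one cd-index, and it is a monic cd-polynomial
    (∀ {B W : Type*} [Group W] {M : CoxeterMatrix B} (cs : CoxeterSystem M W)
      (u v : W) (n : ℕ), cs.BruhatLE u v → cs.length v = cs.length u + (n + 1) →
        IsCDIndex (cs.BruhatInterval u v) n (cdIndex R (cs.BruhatInterval u v) n) ∧
        (∀ Φ : CDPoly R, IsCDIndex (cs.BruhatInterval u v) n Φ →
          Φ = cdIndex R (cs.BruhatInterval u v) n) ∧
        cdIndex R (cs.BruhatInterval u v) n ∈ CDPoly.monic R n) ∧
    -- the cd-indices of Bruhat intervals span the affine space of monic cd-polynomials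
    (∀ n : ℕ, (affineSpan R (bruhatCDIndices R n) : Set (CDPoly R)) = CDPoly.monic R n) ∧
    -- the explicit family in degree `n`, which comes from words of length `n + 1`
    (∀ n : ℕ,
      (fibWords (n + 1)).card = Nat.fib (n + 1) ∧
      (∀ ω ∈ fibWords (n + 1), ω.length = n + 1 ∧ completeThreeSystem.IsReduced ω) ∧
      LinearIndependent R (fun ω : fibWords (n + 1) =>
        cdIndex R (completeThreeSystem.BruhatInterval 1 (completeThreeSystem.wordProd ω.1)) n) ∧
      (affineSpan R (Set.range fun ω : fibWords (n + 1) =>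
        cdIndex R (completeThreeSystem.BruhatInterval 1 (completeThreeSystem.wordProd ω.1)) n) :
          Set (CDPoly R)) = CDPoly.monic R n) := by
  refine ⟨fun cs u v n h hl => ?_, fun n => ?_, fun n => ⟨CompleteThree.card_fibWords _,
    fun ω hω => (CompleteThree.fibWords_spec _ ω hω).2,
    CompleteThree.linearIndependent_lowerCDIndex n, CompleteThree.affineSpan_lowerCDIndex n⟩⟩
  · have hΦ := cs.isCDIndex_cdIndex R h hl
    exact ⟨hΦ, fun Φ h => h.unique hΦ, hΦ.mem_monic⟩
  · apply Set.Subset.antisymm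
    · change affineSpan R _ ≤ CDPoly.monicAffine R n
      rw [affineSpan_le]
      rintro _ ⟨B, W, _, M, cs, u, w, h, hl, rfl⟩
      exact (cs.isCDIndex_cdIndex R h hl).mem_monic
    -- The explicit lower intervals are among all Bruhat intervals, and they already span.
    · rw [← CompleteThree.affineSpan_lowerCDIndex]
      apply affineSpan_mono
      rintro _ ⟨ω, rfl⟩
      obtain ⟨-, hl, hr⟩ := CompleteThree.fibWords_spec _ ω.1 ω.2
      refine ⟨_, _, _, _, completeThreeSystem, 1, completeThreeSystem.wordProd ω.1,
        CoxeterSystem.one_bruhatLE _, ?_, rfl⟩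
      rw [hr.eq, hl, CoxeterSystem.length_one, zero_add]
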